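/- Conventions. Compacta are compact subsets of metrizable spaces. A metrizable space $Q$ is an ANR if, under every closed embedding of $Q$ into a metrizable space $M$, its image is a retract of some open neighborhood in $M$. A polyhedron is a space homeomorphic to the realization of a (possibly infinite) simplicial complex with the metric topology, i.e. the topology of the metric $d(x,y)=\sum_v|x_v-y_v|$ in barycentric coordinates. An affine polyhedron in $\mathbb R^m$ is a subset that is the union of the simplexes of a (possibly infinite) simplicial complex of affine simplexes in $\mathbb R^m$ and whose subspace topology is the metric topology of this complex. A coronated polyhedron is a metrizable space $X$ that contains a compact set $K$ such that $X\setminus K$ is a polyhedron. Dimension is the Lebesgue covering dimension. Proposition. (a) Let $Q$ be a compact ANR and let $X\subset Q$ be of the form $X=K\cup P$, where $K$ is compact and $P$ is open in $Q$. Then $P$ is an ANR and $Q\setminus X$ is locally compact. (b) Let $Q$ be a compact affine polyhedron in some $\mathbb R^m$, and let $X\subset Q$ be of the form $X=K\cup P$, where $K$ is compact and $P=X\setminus K$ is a locally compact affine polyhedron. Then there exists a coronated polyhedron $Y$ with $X\subset Y\subset Q$ such that $Y$ deformation retracts onto $X$ (by a homotopy that fixes $X$ pointwise) and $Q\setminus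 Y$ is locally compact. (c) Let $X$ be a metrizable space of dimension at most $n$ of the form $X=K\cup P$, where $K$ is compact and $P=X\setminus K$ is a locally compact separable polyhedron. Then there is an embedding $f\colon X\to S^{2n+1}$, where $S^{2n+1}$ is regarded as an affine polyhedron in $\mathbb R^{2n+2}$, namely as the boundary of the cube $[-1,1]^{2n+2}$, such that $f(P)$ is an affine polyhedron in $\mathbb R^{2n+2}$. -/

import Mathlib

open Set Topology

universe u v

/-- A metrizable space `Q` is an absolute neighborhood retract (for metrizable spaces) if its image
under every closed embedding into a metrizable space `M` is a retract of some open
neighborhood of that image in `M`. -/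
def IsANR (Q : Type u) [TopologicalSpace Q] : Prop :=
  TopologicalSpace.MetrizableSpace Q ∧
    ∀ (M : Type u) [TopologicalSpace M] [TopologicalSpace.MetrizableSpace M] (i : Q → M),
      IsClosedEmbedding i →
        ∃ (U : Set M) (r : U → Q), IsOpen U ∧ range i ⊆ U ∧ Continuous r ∧
          ∀ (q : Q) (hq : i q ∈ U), r ⟨i q, hq⟩ = q

/-- The realization of an abstract simplicial complex `L` on the set `V`, as a set of functions
on `V` (barycentric coordinates): non-negative functions whose support is a face of `L` and whose
values have sum `1`. As a subset of `ℓ¹(V)` it carries the metric topology, given by the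
metric `d(x, y) = ∑ v, |x v - y v|`. -/
def simplicialRealization {V : Type u} (L : PreAbstractSimplicialComplex V) :
    Set (lp (fun _ : V => ℝ) 1) :=
  {x | (∀ v, 0 ≤ x v) ∧ ∃ s ∈ L.faces, Function.support (fun v => x v) = ↑s ∧ ∑ v ∈ s, x v = 1}

/-- A polyhedron is a space homeomorphic to the realization, with the metric topology, of
some (arbitrary) simplicial complex. -/
def IsPolyhedron (X : Type u) [TopologicalSpace X] : Prop :=
  ∃ (V : Type u) (L : PreAbstractSimplicialComplex V), Nonempty (X ≃ₜ simplicialRealization L)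

/-- An affine polyhedron in `E` is the union `P` of the simplexes of a (possibly infinite)
simplicial complex `C` made of affine simplexes in `E`, such that the subspace topology of `P` is
the metric topology of `C`; that is, the map sending a tuple of barycentric coordinates
to the corresponding point of `E` is a topological embedding of the realization (its image
is `P`). -/
def IsAffinePolyhedron {E : Type u} [AddCommGroup E] [Module ℝ E] [TopologicalSpace E]
    (P : Set E) : Prop :=
  ∃ C : Geometry.SimplicialComplex ℝ E, C.space = P ∧
    IsEmbedding (fun x : simplicialRealization C.toPreAbstractSimplicialComplex =>
      ∑ᶠ v : E, (x : lp (fun _ : E => ℝ) 1) v • v)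

/-- A coronated polyhedron is a metrizable space with a compact subset whose complement is
a polyhedron. -/
def IsCoronatedPolyhedron (X : Type u) [TopologicalSpace X] : Prop :=
  TopologicalSpace.MetrizableSpace X ∧
    ∃ K : Set X, IsCompact K ∧ IsPolyhedron (Kᶜ : Set X)

/-- `Y` deformation retracts onto its subset `X`: the identity of `Y` is homotopic, through maps
`Y → Y` that fix every point of `X`, to a map with values in `X`. -/
def DeformationRetractsOnto {E : Type u} [TopologicalSpace E] (Y X : Set E) : Prop :=
  X ⊆ Y ∧ ∃ r : C(Y, Y), (∀ y, (r y : E) ∈ X) ∧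
    (ContinuousMap.id Y).HomotopicRel r {y | (y : E) ∈ X}

/-- The (Lebesgue) covering dimension of `X` is at most `n`: every finite open cover has an open
refinement covering `X` such that no point lies in more than `n + 1` of its members. -/
def CoveringDimLE (X : Type u) [TopologicalSpace X] (n : ℕ) : Prop :=
  ∀ 𝒰 : Set (Set X), 𝒰.Finite → (∀ U ∈ 𝒰, IsOpen U) → ⋃₀ 𝒰 = univ →
    ∃ 𝒱 : Set (Set X), (∀ W ∈ 𝒱, IsOpen W) ∧ ⋃₀ 𝒱 = univ ∧ (∀ W ∈ 𝒱, ∃ U ∈ 𝒰, W ⊆ U) ∧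
      ∀ x : X, {W ∈ 𝒱 | x ∈ W}.encard ≤ n + 1

/-- The sphere of dimension `m` as an affine polyhedron in `ℝ^(m+1)`: the boundary of
the cube `[-1, 1]^(m+1)`. -/
def polyhedralSphere (m : ℕ) : Set (EuclideanSpace ℝ (Fin (m + 1))) :=
  {x | (∀ i, |x i| ≤ 1) ∧ ∃ i, |x i| = 1}

/-! (a) Embed `Q` as a closed subset of `ℝ^ℕ`. If `P` is closed in `M`, Tietze extends the
coordinates of the inclusion of `P` to `M`. Following this extension by a neighborhood retraction
onto `Q` gives a map from an open set of `M` to `Q`, and its restriction to the preimage of `P` is a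
retraction. The complement of `K ∪ P` is the intersection of an open and a closed set.

(b) As `P` is locally compact, `Z = K ∪ (closure P \ P)` is closed, and in `W = Q \ Z` the simplexes
of `Q` and `P` together are locally finite. Enumerate the half-spaces that cut out these simplexes
together with all rational coordinate hyperplanes. The first `k` hyperplanes divide `Q` into cells;
give each point the least `k` for which its closed star is small enough and is properly cut by the
simplexes that it meets. The cells of variable level form a locally finite partition of `W`
(`FineCells.cellOrder`), and finite chains of cell representatives triangulate `W`
(`CellOrder.range_bary`, `CellOrder.isEmbedding`). In this triangulation `P` is a full subcomplex
and simplexes shrink towards `Z`. The set `Y` is `K` together with the open star of `P`: radial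
projection to `P` moves a point no further than its distance to `K`, so it extends continuously by
the identity of `K`. As `Y \ K` is open in `Q`, the same method triangulates it.

(c) A Baire category argument embeds `X` in `ℝ^(2n+1)` (`exists_isEmbedding_of_coveringDimLE`). The
same cells, used in `ℓ¹`, subdivide `P` so finely that simplexes are small compared with the
distance of their images from a closed set `B` containing the image of `K`. Moving vertex images
into general position and extending affinely changes the embedding so little near `B` that it
remains one (`isEmbedding_of_dist_le`). General position suffices because faces have at most `n + 1`
vertices; this is Lebesgue's theorem that an `(n+1)`-simplex has covering dimension above `n`,
obtained from Sperner's lemma mod 2 through the KKM lemma. Finally `ℝ^(2n+1)` is placed in a face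
hyperplane of the cube. -/

/-! ### Realizations of complexes and their maps to linear spaces -/

section Realization

variable {V : Type*}

/-- The map from the realization of a complex determined by the images of the vertices. -/
noncomputable def bary {F : Type*} [AddCommGroup F] [Module ℝ F]
    (D : PreAbstractSimplicialComplex V) (w : V → F) (x : simplicialRealization D) : F :=
  ∑ᶠ v, x.1 v • w v

/-- A complex is locally finite if every vertex lies in finitely many faces. -/
def LocFin (D : PreAbstractSimplicialComplex V) : Prop := ∀ v, {s ∈ D.faces | v ∈ s}.Finite

/-- The family of simplices `convexHull (w '' s)` is locally finite at the point `z`. -/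
def SimplicesLocFinAt {F : Type*} [AddCommGroup F] [Module ℝ F] [TopologicalSpace F]
    (D : PreAbstractSimplicialComplex V) (w : V → F) (z : F) : Prop :=
  ∃ U ∈ 𝓝 z, {s ∈ D.faces | (convexHull ℝ (w '' (s : Set V)) ∩ U).Nonempty}.Finite

lemma continuous_lp_coord (v : V) : Continuous fun x : lp (fun _ : V => ℝ) 1 => x v :=
  (continuous_apply v).comp (lp.uniformContinuous_coe (p := 1)).continuous

/-- The finitely supported element of `ℓ¹` with coordinates `c` on `s`. -/
noncomputable def lpOfFinset (s : Finset V) (c : V → ℝ) : lp (fun _ : V => ℝ) 1 :=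
  open Classical in ∑ v ∈ s, c v • lp.single 1 v (1 : ℝ)

lemma lpOfFinset_apply [DecidableEq V] (s : Finset V) (c : V → ℝ) (v : V) :
    lpOfFinset s c v = if v ∈ s then c v else 0 := by
  classical
  simp only [lpOfFinset, lp.coeFn_sum, Finset.sum_apply, lp.coeFn_smul, Pi.smul_apply,
    lp.single_apply, smul_eq_mul, Pi.single_apply]
  simp

variable {D : PreAbstractSimplicialComplex V}

lemma realization_nonneg (x : simplicialRealization D) (v : V) : 0 ≤ x.1 v := x.2.1 v

lemma exists_support_face (x : simplicialRealization D) :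
    ∃ s ∈ D.faces, (∀ v, v ∈ s ↔ x.1 v ≠ 0) ∧ ∑ v ∈ s, x.1 v = 1 := by
  obtain ⟨s, hs, h1, h2⟩ := x.2.2
  refine ⟨s, hs, fun v => ?_, h2⟩
  have := congrArg (v ∈ ·) h1
  simp only [Function.mem_support, Finset.mem_coe] at this
  exact (iff_of_eq this).symm

lemma realization_ext {x y : simplicialRealization D} (h : ∀ v, x.1 v = y.1 v) : x = y :=
  Subtype.ext (lp.ext (funext h))

lemma bary_eq_sum {F : Type*} [AddCommGroup F] [Module ℝ F] (w : V → F)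
    (x : simplicialRealization D) (t : Finset V) (ht : ∀ v, x.1 v ≠ 0 → v ∈ t) :
    bary D w x = ∑ v ∈ t, x.1 v • w v := by
  refine finsum_eq_sum_of_support_subset _ fun v hv => ht v fun h => ?_
  simp [h] at hv

lemma mem_convexHull_image_finset {F : Type*} [AddCommGroup F] [Module ℝ F] {w : V → F}
    {s : Finset V} {z : F} : z ∈ convexHull ℝ (w '' (s : Set V)) ↔
      ∃ c : V → ℝ, (∀ v ∈ s, 0 ≤ c v) ∧ ∑ v ∈ s, c v = 1 ∧ ∑ v ∈ s, c v • w v = z := by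
  classical
  constructor
  · intro h
    refine convexHull_min (t := {z | ∃ c : V → ℝ, (∀ v ∈ s, 0 ≤ c v) ∧ ∑ v ∈ s, c v = 1 ∧
      ∑ v ∈ s, c v • w v = z}) ?_ ?_ h
    · rintro _ ⟨v, hv, rfl⟩
      refine ⟨Pi.single v 1, fun u _ => ?_, ?_, ?_⟩
      · by_cases h : u = v
        · subst h; simp
        · simp [h]
      · simpa [Finset.sum_pi_single'] using hv
      · rw [Finset.sum_eq_single v] <;> simp_all
    · rintro _ ⟨c, h1, h2, rfl⟩ _ ⟨d, h3, h4, rfl⟩ a b ha hb hab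
      refine ⟨fun v => a * c v + b * d v, fun v hv => ?_, ?_, ?_⟩
      · have := h1 v hv; have := h3 v hv; positivity
      · rw [Finset.sum_add_distrib, ← Finset.mul_sum, ← Finset.mul_sum, h2, h4]; linarith
      · simp [add_smul, Finset.sum_add_distrib, Finset.smul_sum, mul_smul]
  · rintro ⟨c, h1, h2, rfl⟩
    exact (convex_convexHull ℝ _).sum_mem h1 h2 fun v hv =>
      subset_convexHull ℝ _ (mem_image_of_mem w hv)

lemma lpOfFinset_mem {s : Finset V} (hs : s ∈ D.faces) {c : V → ℝ} (h0 : ∀ v ∈ s, 0 ≤ c v)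
    (h1 : ∑ v ∈ s, c v = 1) : lpOfFinset s c ∈ simplicialRealization D := by
  classical
  refine ⟨fun v => ?_, s.filter (fun v => c v ≠ 0), ?_, ?_, ?_⟩
  · rw [lpOfFinset_apply]; split_ifs with h
    exacts [h0 v h, le_rfl]
  · refine (D.isRelLowerSet_faces hs).2 (Finset.filter_subset _ _) ?_
    by_contra hne
    rw [Finset.not_nonempty_iff_eq_empty, Finset.filter_eq_empty_iff] at hne
    rw [Finset.sum_eq_zero (fun v hv => not_not.1 (hne hv))] at h1
    exact zero_ne_one h1
  · ext v
    simp only [Function.mem_support, lpOfFinset_apply]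
    simp
  · rw [← h1, Finset.sum_filter_of_ne (p := fun v => c v ≠ 0) (f := lpOfFinset s c)]
    · exact Finset.sum_congr rfl fun v hv => by rw [lpOfFinset_apply, if_pos hv]
    · intro v hv h
      rwa [lpOfFinset_apply, if_pos hv] at h

/-- The point of the realization with barycentric coordinates `c` on the face `s`. -/
noncomputable def pointOfFace {s : Finset V} (hs : s ∈ D.faces) {c : V → ℝ}
    (h0 : ∀ v ∈ s, 0 ≤ c v) (h1 : ∑ v ∈ s, c v = 1) : simplicialRealization D :=
  ⟨lpOfFinset s c, lpOfFinset_mem hs h0 h1⟩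

lemma pointOfFace_apply [DecidableEq V] {s : Finset V} (hs : s ∈ D.faces) {c : V → ℝ}
    (h0 : ∀ v ∈ s, 0 ≤ c v) (h1 : ∑ v ∈ s, c v = 1) (v : V) :
    (pointOfFace hs h0 h1).1 v = if v ∈ s then c v else 0 := lpOfFinset_apply s c v

lemma bary_pointOfFace {F : Type*} [AddCommGroup F] [Module ℝ F] (w : V → F)
    {s : Finset V} (hs : s ∈ D.faces) {c : V → ℝ}
    (h0 : ∀ v ∈ s, 0 ≤ c v) (h1 : ∑ v ∈ s, c v = 1) :
    bary D w (pointOfFace hs h0 h1) = ∑ v ∈ s, c v • w v := by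
  classical
  rw [bary_eq_sum w _ s]
  · exact Finset.sum_congr rfl fun v hv => by rw [pointOfFace_apply, if_pos hv]
  · intro v hv
    rw [pointOfFace_apply] at hv
    by_contra h
    simp [h] at hv

/-- The closed simplex of the realization spanned by the face `s`. -/
def closedFace (D : PreAbstractSimplicialComplex V) (s : Finset V) :
    Set (simplicialRealization D) :=
  {x | ∀ v, x.1 v ≠ 0 → v ∈ s}

lemma bary_mem_convexHull {F : Type*} [AddCommGroup F] [Module ℝ F] (w : V → F)
    (x : simplicialRealization D) {s : Finset V} (hx : x ∈ closedFace D s) :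
    bary D w x ∈ convexHull ℝ (w '' (s : Set V)) := by
  obtain ⟨t, ht, h1, h2⟩ := exists_support_face x
  rw [mem_convexHull_image_finset]
  refine ⟨fun v => x.1 v, fun v _ => realization_nonneg x v, ?_, (bary_eq_sum w x s hx).symm⟩
  rw [← h2]
  refine (Finset.sum_subset (fun v hv => hx v ((h1 v).1 hv)) fun v _ hv => ?_).symm
  exact not_not.1 fun h => hv ((h1 v).2 h)

lemma exists_bary_eq_of_mem_convexHull {F : Type*} [AddCommGroup F] [Module ℝ F] (w : V → F)
    {s : Finset V} (hs : s ∈ D.faces) {z : F} (hz : z ∈ convexHull ℝ (w '' (s : Set V))) :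
    ∃ x ∈ closedFace D s, bary D w x = z := by
  classical
  obtain ⟨c, h0, h1, rfl⟩ := mem_convexHull_image_finset.1 hz
  refine ⟨pointOfFace hs h0 h1, fun v hv => ?_, bary_pointOfFace w hs h0 h1⟩
  by_contra h
  rw [pointOfFace_apply, if_neg h] at hv
  exact hv rfl

lemma exists_vertex (x : simplicialRealization D) : ∃ v, 0 < x.1 v := by
  obtain ⟨s, hs, h1, h2⟩ := exists_support_face x
  obtain ⟨v, hv⟩ := (D.isRelLowerSet_faces hs).1
  exact ⟨v, lt_of_le_of_ne (realization_nonneg x v) ((h1 v).1 hv).symm⟩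

lemma isOpen_openStar (v : V) : IsOpen {x : simplicialRealization D | 0 < x.1 v} :=
  isOpen_lt continuous_const ((continuous_lp_coord v).comp continuous_subtype_val)

/-- On the open star of a vertex only finitely many vertices carry weight, so there the finsum is a
sum over one fixed finite set. -/
lemma continuous_bary {F : Type*} [NormedAddCommGroup F] [NormedSpace ℝ F] (hD : LocFin D)
    (w : V → F) : Continuous (bary D w) := by
  classical
  refine continuous_iff_continuousAt.2 fun x => ?_
  obtain ⟨v, hv⟩ := exists_vertex x
  set T : Finset V := (hD v).toFinset.biUnion id
  have key : ∀ y : simplicialRealization D, 0 < y.1 v →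
      bary D w y = ∑ u ∈ T, y.1 u • w u := by
    intro y hy
    refine bary_eq_sum w y T fun u hu => ?_
    obtain ⟨s, hs, h1, h2⟩ := exists_support_face y
    exact Finset.mem_biUnion.2 ⟨s, by simpa using ⟨hs, (h1 v).2 hy.ne'⟩, (h1 u).2 hu⟩
  have hc : Continuous fun y : simplicialRealization D => ∑ u ∈ T, y.1 u • w u :=
    continuous_finsetSum _ fun u _ =>
      ((continuous_lp_coord u).comp continuous_subtype_val).smul continuous_const
  refine hc.continuousAt.congr ?_
  filter_upwards [(isOpen_openStar v).mem_nhds hv] with y hy using (key y hy).symm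

lemma isCompact_closedFace {s : Finset V} (hs : s ∈ D.faces) : IsCompact (closedFace D s) := by
  classical
  rw [Topology.IsInducing.subtypeVal.isCompact_iff]
  have : (Subtype.val '' closedFace D s) =
      (fun c : s → ℝ => ∑ v : s, c v • lp.single (E := fun _ : V => ℝ) 1 v.1 (1 : ℝ)) ''
        stdSimplex ℝ s := by
    ext x
    constructor
    · rintro ⟨x, hx, rfl⟩
      obtain ⟨t, ht, h1, h2⟩ := exists_support_face x
      refine ⟨fun v => x.1 v, ⟨fun v => realization_nonneg x v, ?_⟩, ?_⟩
      · rw [Finset.sum_coe_sort s (fun v => x.1 v), ← h2]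
        refine (Finset.sum_subset (fun v hv => hx v ((h1 v).1 hv)) fun v _ hv => ?_).symm
        exact not_not.1 fun h => hv ((h1 v).2 h)
      · simp only
        rw [Finset.sum_coe_sort s (fun v => x.1 v • lp.single (E := fun _ : V => ℝ) 1 v (1 : ℝ))]
        have := lpOfFinset_apply s (fun v => x.1 v)
        refine lp.ext (funext fun v => ?_)
        have h3 := this v
        simp only [lpOfFinset] at h3
        convert h3 using 1
        split_ifs with h
        · rfl
        · exact not_not.1 fun h' => h (hx v h')
    · rintro ⟨c, ⟨h0, h1⟩, rfl⟩
      set c' : V → ℝ := fun v => if h : v ∈ s then c ⟨v, h⟩ else 0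
      have hc' : ∀ v : s, c' v = c v := fun v => by simp [c']
      have h0' : ∀ v ∈ s, 0 ≤ c' v := fun v hv => by simpa [c', hv] using h0 ⟨v, hv⟩
      have h1' : ∑ v ∈ s, c' v = 1 := by
        rw [← Finset.sum_coe_sort s, ← h1]; exact Finset.sum_congr rfl fun v _ => hc' v
      refine ⟨pointOfFace hs h0' h1', fun v hv => ?_, ?_⟩
      · by_contra h
        rw [pointOfFace_apply, if_neg h] at hv
        exact hv rfl
      · simp only [pointOfFace, lpOfFinset]
        rw [← Finset.sum_coe_sort s]
        refine Finset.sum_congr rfl fun v _ => ?_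
        rw [hc' v]
  rw [this]
  refine (isCompact_stdSimplex ℝ s).image ?_
  exact continuous_finsetSum _ fun v _ => (continuous_apply v).smul continuous_const

/-- A continuous injection of a compact set into a Hausdorff space is a homeomorphism onto its
image; here this is localized at a point with a neighborhood whose whole preimage is trapped in a
compact set. -/
lemma comap_nhds_le_of_compact_preimage {X Y : Type*} [TopologicalSpace X] [TopologicalSpace Y]
    [T2Space Y] {f : X → Y} (hf : Continuous f) (hinj : Function.Injective f) {x : X} {U : Set Y}
    (hU : U ∈ 𝓝 (f x)) {C : Set X} (hC : IsCompact C) (hUC : f ⁻¹' U ⊆ C) :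
    Filter.comap f (𝓝 (f x)) ≤ 𝓝 x := by
  intro W hW
  obtain ⟨O, hOW, hO, hxO⟩ := mem_nhds_iff.1 hW
  have hcl : IsClosed (f '' (C \ O)) := ((hC.diff hO).image hf).isClosed
  have hx : f x ∉ f '' (C \ O) := by
    rintro ⟨y, hy, hyx⟩
    exact hy.2 (hinj hyx ▸ hxO)
  refine ⟨U ∩ (f '' (C \ O))ᶜ, Filter.inter_mem hU (hcl.isOpen_compl.mem_nhds hx), ?_⟩
  rintro y ⟨hy1, hy2⟩
  by_contra hyW
  exact hy2 ⟨y, ⟨hUC hy1, fun h => hyW (hOW h)⟩, rfl⟩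

/-- A neighborhood that meets finitely many simplexes has its preimage inside a finite union of
compact closed faces. -/
lemma isEmbedding_bary {F : Type*} [NormedAddCommGroup F] [NormedSpace ℝ F] (hD : LocFin D)
    {w : V → F} (hinj : Function.Injective (bary D w))
    (h : ∀ z ∈ range (bary D w), SimplicesLocFinAt D w z) : IsEmbedding (bary D w) := by
  refine ⟨isInducing_iff_nhds.2 fun x =>
    le_antisymm ((continuous_bary hD w).tendsto x).le_comap ?_, hinj⟩
  obtain ⟨U, hU, hfin⟩ := h _ (mem_range_self x)
  refine comap_nhds_le_of_compact_preimage (continuous_bary hD w) hinj hU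
    (C := ⋃ s ∈ {s ∈ D.faces | (convexHull ℝ (w '' (s : Set V)) ∩ U).Nonempty},
    closedFace D s) (hfin.isCompact_biUnion fun s hs => isCompact_closedFace hs.1) ?_
  intro y hy
  obtain ⟨s, hs, h1, h2⟩ := exists_support_face y
  have hys : y ∈ closedFace D s := fun v hv => (h1 v).2 hv
  exact mem_iUnion₂.2 ⟨s, ⟨hs, _, bary_mem_convexHull w y hys, hy⟩, hys⟩

/-- The image of the open star of `v` is cut out of the range by an open set, and a face whose
simplex meets that open set must contain `v`. -/
lemma simplicesLocFinAt_of_isEmbedding {F : Type*} [NormedAddCommGroup F] [NormedSpace ℝ F]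
    (hD : LocFin D) {w : V → F} (h : IsEmbedding (bary D w)) :
    ∀ z ∈ range (bary D w), SimplicesLocFinAt D w z := by
  rintro _ ⟨x, rfl⟩
  obtain ⟨v, hv⟩ := exists_vertex x
  obtain ⟨U, hU, hUv⟩ := h.isInducing.isOpen_iff.1 (isOpen_openStar (D := D) v)
  have hx : x ∈ bary D w ⁻¹' U := hUv ▸ hv
  refine ⟨U, hU.mem_nhds hx, (hD v).subset ?_⟩
  rintro s ⟨hs, z, hz, hzU⟩
  obtain ⟨y, hy, rfl⟩ := exists_bary_eq_of_mem_convexHull w hs hz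
  have hyv : y ∈ {x : simplicialRealization D | 0 < x.1 v} := hUv ▸ hzU
  exact ⟨hs, hy v (ne_of_gt hyv)⟩

/-- Finitely many balls of radius `δ` cover `C`; their centers have finite support, and the `ℓ¹`
norm dominates each coordinate. -/
lemma finite_large_coord {C : Set (simplicialRealization D)} (hC : IsCompact C) {δ : ℝ}
    (hδ : 0 < δ) : {v | ∃ y ∈ C, δ ≤ y.1 v}.Finite := by
  obtain ⟨t, ht, hfin, hcov⟩ := hC.finite_cover_balls hδ
  refine (hfin.biUnion (t := fun x => {v | x.1 v ≠ 0}) fun x _ => ?_).subset ?_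
  · obtain ⟨s, hs, h1, h2⟩ := exists_support_face x
    exact s.finite_toSet.subset fun v hv => (h1 v).2 hv
  · rintro v ⟨y, hy, hyv⟩
    obtain ⟨x, hx, hxy⟩ := mem_iUnion₂.1 (hcov hy)
    refine mem_biUnion hx fun h0 => ?_
    have h1 := lp.norm_apply_le_norm one_ne_zero (y.1 - x.1) v
    rw [lp.coeFn_sub, Pi.sub_apply, h0, sub_zero, Real.norm_eq_abs] at h1
    have h2 : ‖y.1 - x.1‖ < δ := by rw [← dist_eq_norm]; exact hxy
    linarith [le_abs_self (y.1 v)]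

/-- For each neighbor `u` of `v`, the point `(1 - δ) v + δ u` lies in a fixed compact neighborhood
of `v`, and its `u`-coordinate is `δ`. By `finite_large_coord` there are finitely many such `u`. -/
lemma locFin_of_locallyCompactSpace (h : LocallyCompactSpace (simplicialRealization D)) :
    LocFin D := by
  classical
  intro v
  by_cases hv : {v} ∈ D.faces
  swap
  · convert! finite_empty
    ext s
    simp only [mem_ofPred_eq, mem_empty_iff_false, iff_false, not_and]
    exact fun hs hvs => hv ((D.isRelLowerSet_faces hs).2 (by simpa using hvs) (by simp))
  suffices hN : {u | {v, u} ∈ D.faces}.Finite by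
    refine (Finset.finite_toSet hN.toFinset.powerset).subset ?_
    rintro s ⟨hs, hvs⟩
    rw [Finset.mem_coe, Finset.mem_powerset]
    intro u hu
    rw [Finite.mem_toFinset]
    refine (D.isRelLowerSet_faces hs).2 ?_ (by simp)
    intro a ha
    simp only [Finset.mem_insert, Finset.mem_singleton] at ha
    rcases ha with rfl | rfl <;> assumption
  have hx0 : ∑ u ∈ ({v} : Finset V), (fun _ => (1 : ℝ)) u = 1 := by simp
  let x₀ : simplicialRealization D := pointOfFace hv (c := fun _ => 1) (by simp) hx0
  obtain ⟨C, hC, hCx⟩ := exists_compact_mem_nhds x₀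
  obtain ⟨ε, hε, hball⟩ := Metric.mem_nhds_iff.1 hCx
  -- The displaced point is at distance at most `2δ` from the vertex, which is below `ε`.
  set δ := min (ε / 4) (1 / 2) with hδ
  have hδ0 : 0 < δ := by positivity
  have hδ1 : δ ≤ 1 / 2 := min_le_right _ _
  have hδ2 : δ ≤ ε / 4 := min_le_left _ _
  refine ((finite_large_coord hC hδ0).union (finite_singleton v)).subset ?_
  intro u hu
  by_cases huv : u = v
  · exact Or.inr huv
  left
  have hc0 : ∀ a ∈ ({v, u} : Finset V), 0 ≤ (fun a => if a = v then 1 - δ else δ) a := by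
    intro a _
    simp only
    split_ifs <;> linarith
  have hc1 : ∑ a ∈ ({v, u} : Finset V), (fun a => if a = v then 1 - δ else δ) a = 1 := by
    rw [Finset.sum_pair (Ne.symm huv)]; simp [huv]
  refine ⟨pointOfFace hu hc0 hc1, hball ?_, ?_⟩
  · rw [Metric.mem_ball, Subtype.dist_eq, dist_eq_norm]
    have : (pointOfFace hu hc0 hc1).1 - x₀.1 =
        δ • lp.single (E := fun _ : V => ℝ) 1 u (1 : ℝ) - δ • lp.single 1 v (1 : ℝ) := by
      refine lp.ext (funext fun a => ?_)
      rw [lp.coeFn_sub, Pi.sub_apply, pointOfFace_apply, pointOfFace_apply]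
      simp only [lp.coeFn_sub, lp.coeFn_smul, Pi.sub_apply, Pi.smul_apply, lp.single_apply,
        Finset.mem_insert, Finset.mem_singleton, Pi.single_apply, smul_eq_mul]
      by_cases h1 : a = v
      · subst h1; simp [Ne.symm huv]
      · by_cases h2 : a = u
        · subst h2; simp [huv]
        · simp [h1, h2]
    rw [this]
    refine (norm_sub_le _ _).trans_lt ?_
    rw [norm_smul, norm_smul, lp.norm_single one_pos, lp.norm_single one_pos]
    simp only [Real.norm_eq_abs, abs_of_pos hδ0, abs_one]
    linarith
  · rw [pointOfFace_apply, if_pos (by simp), if_neg huv]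

/-- Countably many open stars cover, and a vertex lies in no open star of another vertex; hence
every face contains the center of one of these stars. -/
lemma countable_faces (hD : LocFin D) [LindelofSpace (simplicialRealization D)] :
    D.faces.Countable := by
  classical
  have hne : ∀ x : simplicialRealization D, ∃ v, 0 < x.1 v := exists_vertex
  choose g hg using hne
  obtain ⟨t, ht, hcov⟩ := LindelofSpace.elim_nhds_subcover
    (fun x => {y : simplicialRealization D | 0 < y.1 (g x)})
    fun x => (isOpen_openStar (g x)).mem_nhds (hg x)
  refine (ht.biUnion (t := fun x _ => {s ∈ D.faces | g x ∈ s})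
    fun x _ => (hD (g x)).countable).mono fun s hs => ?_
  obtain ⟨v, hv⟩ := (D.isRelLowerSet_faces hs).1
  have hv' : {v} ∈ D.faces := (D.isRelLowerSet_faces hs).2 (by simpa using hv) (by simp)
  obtain ⟨x, hx, hxv⟩ := mem_iUnion₂.1 (hcov.symm ▸ mem_univ
    (pointOfFace hv' (c := fun _ => 1) (by simp) (by simp)) : _ ∈ ⋃ x ∈ t, _)
  refine mem_iUnion₂.2 ⟨x, hx, hs, ?_⟩
  rw [mem_ofPred_eq, pointOfFace_apply] at hxv
  by_cases h : g x ∈ ({v} : Finset V)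
  · rw [Finset.mem_singleton] at h; exact h ▸ hv
  · simp [h] at hxv

/-- Joint independence of the vertices of two faces makes their simplexes meet exactly in the
simplex on the common vertices. As `w` may fail to be injective on points that are not vertices of
faces, coordinates are compared face by face. -/
lemma isAffinePolyhedron_range {E : Type u} [NormedAddCommGroup E] [NormedSpace ℝ E]
    (hD : LocFin D) {w : V → E}
    (hw : ∀ s ∈ D.faces, ∀ t ∈ D.faces, ∀ r : Finset V, (∀ v ∈ r, v ∈ s ∨ v ∈ t) →
      AffineIndependent ℝ fun v : r => w v)
    (hemb : IsEmbedding (bary D w)) : IsAffinePolyhedron (range (bary D w)) := by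
  classical
  have hinj : ∀ s ∈ D.faces, ∀ t ∈ D.faces, ∀ a ∈ s, ∀ b ∈ t, w a = w b → a = b := by
    intro s hs t ht a ha b hb hab
    have := (hw s hs t ht (s ∪ t) (by simp)).injective (a₁ := ⟨a, by simp [ha]⟩)
      (a₂ := ⟨b, by simp [hb]⟩) hab
    simpa using this
  have hind : ∀ s ∈ D.faces, ∀ t ∈ D.faces, ∀ r : Finset V, (∀ v ∈ r, v ∈ s ∨ v ∈ t) →
      AffineIndependent ℝ ((↑) : {e // e ∈ r.image w} → E) := by
    intro s hs t ht r hr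
    refine (hw s hs t ht r hr).range.mono (s := ((r.image w : Finset E) : Set E)) ?_
    intro e he
    obtain ⟨v, hv, rfl⟩ := Finset.mem_image.1 (Finset.mem_coe.1 he)
    exact ⟨⟨v, hv⟩, rfl⟩
  let C : Geometry.SimplicialComplex ℝ E :=
    { faces := (fun s : Finset V => s.image w) '' D.faces
      isRelLowerSet_faces := by
        rintro _ ⟨s, hs, rfl⟩
        refine ⟨(D.isRelLowerSet_faces hs).1.image w, fun t ht htne => ?_⟩
        have hts : (s.filter fun v => w v ∈ t).image w = t := by
          ext e
          simp only [Finset.mem_image, Finset.mem_filter]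
          constructor
          · rintro ⟨v, ⟨-, hv⟩, rfl⟩; exact hv
          · intro he
            obtain ⟨v, hv, rfl⟩ := Finset.mem_image.1 (ht he)
            exact ⟨v, ⟨hv, he⟩, rfl⟩
        refine ⟨_, (D.isRelLowerSet_faces hs).2 (Finset.filter_subset _ _) ?_, hts⟩
        rw [← hts] at htne
        exact Finset.image_nonempty.1 htne
      indep := by
        rintro _ ⟨s, hs, rfl⟩
        exact hind s hs s hs s (fun v hv => Or.inl hv)
      inter_subset_convexHull := by
        rintro _ _ ⟨s, hs, rfl⟩ ⟨t, ht, rfl⟩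
        rw [← (hind s hs t ht (s ∪ t) (by simp)).convexHull_inter
          (Finset.image_subset_image Finset.subset_union_left)
          (Finset.image_subset_image Finset.subset_union_right)] }
  have hC : ∀ x : simplicialRealization C.toPreAbstractSimplicialComplex,
      ∃ y : simplicialRealization D, bary D w y = bary _ id x ∧
        (∀ e, x.1 e ≠ 0 → ∃ v, w v = e ∧ y.1 v ≠ 0) ∧ ∀ v, y.1 v ≠ 0 → y.1 v = x.1 (w v) := by
    intro x
    obtain ⟨_, ⟨s, hs, rfl⟩, h1, h2⟩ := exists_support_face x
    have hsum : ∀ {F : Type u} [AddCommGroup F] (f : E → F),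
        ∑ e ∈ s.image w, f e = ∑ v ∈ s, f (w v) := fun f =>
      Finset.sum_image fun a ha b hb => hinj s hs s hs a ha b hb
    have h3 : ∑ v ∈ s, x.1 (w v) = 1 := by
      rw [← h2]
      exact (Finset.sum_image fun a ha b hb => hinj s hs s hs a ha b hb).symm
    refine ⟨pointOfFace hs (c := fun v => x.1 (w v)) (fun v _ => realization_nonneg x _) h3,
      ?_, ?_, ?_⟩
    · rw [bary_pointOfFace, bary_eq_sum _ x (s.image w) fun e he => (h1 e).2 he, hsum]
      rfl
    · intro e he
      obtain ⟨v, hv, rfl⟩ := Finset.mem_image.1 ((h1 e).2 he)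
      exact ⟨v, rfl, by rwa [pointOfFace_apply, if_pos hv]⟩
    · intro v hv
      rw [pointOfFace_apply] at hv ⊢
      split_ifs at hv ⊢ with h
      · rfl
      · exact absurd rfl hv
  have hrange : C.space = range (bary D w) := by
    ext z
    rw [Geometry.SimplicialComplex.mem_space_iff]
    constructor
    · rintro ⟨_, ⟨s, hs, rfl⟩, hz⟩
      rw [Finset.coe_image] at hz
      obtain ⟨x, -, rfl⟩ := exists_bary_eq_of_mem_convexHull w hs hz
      exact mem_range_self x
    · rintro ⟨x, rfl⟩
      obtain ⟨s, hs, h1, h2⟩ := exists_support_face x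
      refine ⟨_, ⟨s, hs, rfl⟩, ?_⟩
      rw [Finset.coe_image]
      exact bary_mem_convexHull w x fun v hv => (h1 v).2 hv
  refine ⟨C, hrange, ?_⟩
  change IsEmbedding (bary C.toPreAbstractSimplicialComplex id)
  refine isEmbedding_bary ?_ ?_ ?_
  · intro e
    by_cases he : ∃ s ∈ D.faces, ∃ u ∈ s, w u = e
    · obtain ⟨s₀, hs₀, u, hu, rfl⟩ := he
      refine ((hD u).image fun s : Finset V => s.image w).subset ?_
      rintro _ ⟨⟨s, hs, rfl⟩, hus⟩
      obtain ⟨v, hv, hvu⟩ := Finset.mem_image.1 hus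
      exact ⟨s, ⟨hs, hinj s hs s₀ hs₀ v hv u hu hvu ▸ hv⟩, rfl⟩
    · convert! finite_empty
      ext F
      simp only [mem_ofPred_eq, mem_empty_iff_false, iff_false, not_and]
      rintro ⟨s, hs, rfl⟩ heF
      obtain ⟨v, hv, hve⟩ := Finset.mem_image.1 heF
      exact he ⟨s, hs, v, hv, hve⟩
  · have key : ∀ x x' : simplicialRealization C.toPreAbstractSimplicialComplex,
        bary _ id x = bary _ id x' → ∀ e, x.1 e ≠ 0 → x.1 e = x'.1 e := by
      intro x x' hxx e he
      obtain ⟨y, h1, h2, h3⟩ := hC x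
      obtain ⟨y', h1', h2', h3'⟩ := hC x'
      have hyy : y = y' := hemb.injective (by rw [h1, h1', hxx])
      subst hyy
      obtain ⟨v, rfl, hv⟩ := h2 e he
      rw [← h3 v hv, ← h3' v hv]
    intro x x' hxx
    refine realization_ext fun e => ?_
    by_cases he : x.1 e = 0
    · by_cases he' : x'.1 e = 0
      · rw [he, he']
      · exact (key x' x hxx.symm e he').symm
    · exact key x x' hxx e he
  · rintro _ ⟨x, rfl⟩
    obtain ⟨y, hy, -⟩ := hC x
    obtain ⟨U, hU, hfin⟩ := simplicesLocFinAt_of_isEmbedding hD hemb _ (mem_range_self y)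
    rw [← hy]
    refine ⟨U, hU, (hfin.image fun s : Finset V => s.image w).subset ?_⟩
    rintro _ ⟨⟨s, hs, rfl⟩, hne⟩
    refine ⟨s, ⟨hs, ?_⟩, rfl⟩
    rwa [image_id, Finset.coe_image] at hne

end Realization

/-! ### Derived complex of a locally finite partition into convex cells -/

section Derived

/-- A preorder on `W` whose equivalence classes are the relatively open convex cells of a locally
finite partition of `W`, with `le x y` meaning that `x` lies in the closure of the cell of `y`. -/
structure CellOrder {E : Type*} [NormedAddCommGroup E] [NormedSpace ℝ E] (W : Set E)
    (le : E → E → Prop) : Prop where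
  mem_left : ∀ {x y}, le x y → x ∈ W
  mem_right : ∀ {x y}, le x y → y ∈ W
  refl : ∀ {x}, x ∈ W → le x x
  trans : ∀ {x y z}, le x y → le y z → le x z
  convex : ∀ w, Convex ℝ {x | le x w}
  segment : ∀ {x w}, le x w → ∀ t : ℝ, 0 < t → t ≤ 1 → le w (x + t • (w - x))
  exit : ∀ {x p}, le x p → le p x → x ≠ p →
    ∃ s : ℝ, 1 < s ∧ le (p + s • (x - p)) p ∧ ¬ le p (p + s • (x - p))
  finite_lower : ∀ p ∈ W, ∃ F : Set E, F.Finite ∧ ∀ x, le x p → ∃ y ∈ F, le x y ∧ le y x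
  star_mem_nhds : ∀ p ∈ W, ∃ U ∈ 𝓝 p, ∀ x ∈ W, x ∈ U → le p x
  finite_upper : ∀ p ∈ W, ∃ F : Set E, F.Finite ∧ ∀ x, le p x → ∃ y ∈ F, le x y ∧ le y x

variable {E : Type*} [NormedAddCommGroup E] [NormedSpace ℝ E] {W : Set E} {le : E → E → Prop}

/-- A chosen representative of the cell of a point. -/
noncomputable def cellRep (le : E → E → Prop) (x : E) : E :=
  Classical.epsilon fun y => le x y ∧ le y x

/-- The derived complex of a cell order: its vertices are the representatives of the cells and its
faces are the finite chains. -/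
def derivedComplex (W : Set E) (le : E → E → Prop) : PreAbstractSimplicialComplex E where
  faces := {s | s.Nonempty ∧ (∀ v ∈ s, v ∈ W ∧ cellRep le v = v) ∧ ∀ a ∈ s, ∀ b ∈ s, le a b ∨ le b a}
  isRelLowerSet_faces := fun _ hs => ⟨hs.1, fun _ hts hne =>
    ⟨hne, fun v hv => hs.2.1 v (hts hv), fun a ha b hb => hs.2.2 a (hts ha) b (hts hb)⟩⟩

namespace CellOrder

variable (h : CellOrder W le)
include h

lemma rep_spec {x : E} (hx : x ∈ W) : le x (cellRep le x) ∧ le (cellRep le x) x :=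
  Classical.epsilon_spec (p := fun y => le x y ∧ le y x) ⟨x, h.refl hx, h.refl hx⟩

lemma rep_eq {x y : E} (h1 : le x y) (h2 : le y x) : cellRep le x = cellRep le y := by
  have : (fun z => le x z ∧ le z x) = fun z => le y z ∧ le z y := by
    funext z
    exact propext ⟨fun a => ⟨h.trans h2 a.1, h.trans a.2 h1⟩,
      fun a => ⟨h.trans h1 a.1, h.trans a.2 h2⟩⟩
  simp only [cellRep, this]

lemma rep_rep {x : E} (hx : x ∈ W) : cellRep le (cellRep le x) = cellRep le x :=
  (h.rep_eq (h.rep_spec hx).1 (h.rep_spec hx).2).symm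

lemma antisymm {x y : E} (hx : cellRep le x = x) (hy : cellRep le y = y) (h1 : le x y)
    (h2 : le y x) : x = y := by
  rw [← hx, ← hy]; exact h.rep_eq h1 h2

lemma finite_vertices_lower {p : E} (hp : p ∈ W) : {v | cellRep le v = v ∧ le v p}.Finite := by
  obtain ⟨F, hF, hF'⟩ := h.finite_lower p hp
  refine (hF.image (cellRep le)).subset ?_
  rintro v ⟨hv, hvp⟩
  obtain ⟨y, hy, h1, h2⟩ := hF' v hvp
  exact ⟨y, hy, by rw [← h.rep_eq h1 h2, hv]⟩

lemma finite_vertices_upper {p : E} (hp : p ∈ W) : {v | cellRep le v = v ∧ le p v}.Finite := by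
  obtain ⟨F, hF, hF'⟩ := h.finite_upper p hp
  refine (hF.image (cellRep le)).subset ?_
  rintro v ⟨hv, hvp⟩
  obtain ⟨y, hy, h1, h2⟩ := hF' v hvp
  exact ⟨y, hy, by rw [← h.rep_eq h1 h2, hv]⟩

lemma exists_top {s : Finset E} (hs : s ∈ (derivedComplex W le).faces) :
    ∃ w ∈ s, ∀ v ∈ s, le v w := by
  classical
  obtain ⟨hne, hv, hc⟩ := hs
  induction hne using Finset.Nonempty.cons_induction with
  | singleton a => exact ⟨a, by simp, by simpa using h.refl (hv a (by simp)).1⟩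
  | cons a s ha hne ih =>
    obtain ⟨w, hw, hw'⟩ := ih (fun v hv' => hv v (by simp [hv'])) fun x hx y hy =>
      hc x (by simp [hx]) y (by simp [hy])
    rcases hc a (by simp) w (by simp [hw]) with h1 | h1
    · refine ⟨w, by simp [hw], fun v hv' => ?_⟩
      rcases Finset.mem_cons.1 hv' with rfl | hv'
      exacts [h1, hw' v hv']
    · refine ⟨a, by simp, fun v hv' => ?_⟩
      rcases Finset.mem_cons.1 hv' with rfl | hv'
      exacts [h.refl (hv v (by simp)).1, h.trans (hw' v hv') h1]

-- This writes a convex combination as a point of the segment from the vertex `w` to the normalized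
-- remainder; inductions over chains peel off the top vertex in this way.
omit h in
lemma split_sum [DecidableEq E] {s : Finset E} {c : E → ℝ} (h1 : ∑ v ∈ s, c v = 1) {w : E}
    (hw : w ∈ s) (hcw : c w < 1) : ∑ v ∈ s.erase w, c v / (1 - c w) = 1 ∧
      ∑ v ∈ s, c v • v - w = (1 - c w) • (∑ v ∈ s.erase w, (c v / (1 - c w)) • v - w) := by
  have h2 : (1 - c w) ≠ 0 := by linarith
  constructor
  · rw [← Finset.sum_div, div_eq_one_iff_eq h2, ← h1, ← Finset.add_sum_erase s c hw]; ring
  · rw [← Finset.add_sum_erase s _ hw, smul_sub, Finset.smul_sum]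
    simp_rw [smul_smul, mul_div_cancel₀ _ h2]
    module

lemma comb_le {s : Finset E} {c : E → ℝ} (h0 : ∀ v ∈ s, 0 < c v) (h1 : ∑ v ∈ s, c v = 1) {w : E}
    (hle : ∀ v ∈ s, le v w) : le (∑ v ∈ s, c v • v) w :=
  (h.convex w).sum_mem (fun v hv => (h0 v hv).le) h1 hle

/-- The equation puts `y'` on the segment from `y` to `w`, strictly beyond `y`, where `segment`
applies. -/
lemma le_of_scaling {w y y' : E} {a b : ℝ} (hy : le y w) (hab : a < b) (hb : b ≤ 1)
    (heq : (1 - a) • (y' - w) = (1 - b) • (y - w)) : le w y' := by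
  have ha : (1 - a) ≠ 0 := by linarith
  have : y' = y + (1 - (1 - b) / (1 - a)) • (w - y) := by
    have h3 : y' - w = ((1 - b) / (1 - a)) • (y - w) := by
      rw [div_eq_inv_mul, mul_smul, ← heq, smul_smul, inv_mul_cancel₀ ha, one_smul]
    rw [eq_add_of_sub_eq h3]
    module
  rw [this]
  refine h.segment hy _ ?_ ?_
  · rw [sub_pos, div_lt_one (by linarith)]; linarith
  · have : 0 ≤ (1 - b) / (1 - a) := div_nonneg (by linarith) (by linarith)
    linarith

lemma le_comb {s : Finset E} {c : E → ℝ} (h0 : ∀ v ∈ s, 0 < c v) (h1 : ∑ v ∈ s, c v = 1) {w : E}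
    (hw : w ∈ s) (hle : ∀ v ∈ s, le v w) : le w (∑ v ∈ s, c v • v) := by
  classical
  by_cases hcw : c w < 1
  · obtain ⟨h2, h3⟩ := split_sum h1 hw hcw
    refine h.le_of_scaling (y := ∑ v ∈ s.erase w, (c v / (1 - c w)) • v) (a := 0) (b := c w)
      ?_ (h0 w hw) hcw.le (by rw [sub_zero, one_smul, h3])
    refine h.comb_le (fun v hv => ?_) h2 fun v hv => hle v (Finset.mem_of_mem_erase hv)
    exact div_pos (h0 v (Finset.mem_of_mem_erase hv)) (by linarith)
  · have h2 : s.erase w = ∅ := by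
      by_contra hne
      have h3 : 0 < ∑ v ∈ s.erase w, c v :=
        Finset.sum_pos (fun v hv => h0 v (Finset.mem_of_mem_erase hv))
          (Finset.nonempty_iff_ne_empty.2 hne)
      have := Finset.add_sum_erase s c hw
      linarith
    have h3 : s = {w} := by
      rw [← Finset.insert_erase hw, h2]; simp
    subst h3
    have : c w = 1 := by simpa using h1
    simpa [this] using h.refl (h.mem_right (hle w hw))

omit [NormedAddCommGroup E] [NormedSpace ℝ E] h in
lemma eq_singleton {s : Finset E} {c : E → ℝ} (h0 : ∀ v ∈ s, 0 < c v) (h1 : ∑ v ∈ s, c v = 1)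
    {w : E} (hw : w ∈ s) (hcw : ¬ c w < 1) : s = {w} := by
  classical
  refine Finset.eq_singleton_iff_unique_mem.2 ⟨hw, fun v hv => ?_⟩
  by_contra hne
  have h3 : 0 < ∑ v ∈ s.erase w, c v :=
    Finset.sum_pos (fun v hv => h0 v (Finset.mem_of_mem_erase hv)) ⟨v, by simp [hne, hv]⟩
  have := Finset.add_sum_erase s c hw
  linarith

/-- The part of a convex combination over a face that remains after removing the top vertex lies
in a strictly smaller cell. -/
lemma rest_spec [DecidableEq E] {s : Finset E} (hs : s ∈ (derivedComplex W le).faces) {c : E → ℝ}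
    (h0 : ∀ v ∈ s, 0 < c v) (h1 : ∑ v ∈ s, c v = 1) {w : E} (hw : w ∈ s) (hle : ∀ v ∈ s, le v w)
    (hcw : c w < 1) : s.erase w ∈ (derivedComplex W le).faces ∧
      (∀ v ∈ s.erase w, 0 < c v / (1 - c w)) ∧
      le (∑ v ∈ s.erase w, (c v / (1 - c w)) • v) w ∧
      ¬ le w (∑ v ∈ s.erase w, (c v / (1 - c w)) • v) := by
  obtain ⟨h2, h3⟩ := split_sum h1 hw hcw
  have hne : (s.erase w).Nonempty := by
    by_contra hne
    rw [Finset.not_nonempty_iff_eq_empty] at hne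
    rw [hne] at h2
    simp at h2
  have hf : s.erase w ∈ (derivedComplex W le).faces :=
    ((derivedComplex W le).isRelLowerSet_faces hs).2 (Finset.erase_subset _ _) hne
  have hpos : ∀ v ∈ s.erase w, 0 < c v / (1 - c w) := fun v hv =>
    div_pos (h0 v (Finset.mem_of_mem_erase hv)) (by linarith)
  refine ⟨hf, hpos, h.comb_le hpos h2 fun v hv => hle v (Finset.mem_of_mem_erase hv), fun hc => ?_⟩
  obtain ⟨w', hw', hle'⟩ := h.exists_top hf
  have h4 := h.comb_le hpos h2 hle'
  refine Finset.ne_of_mem_erase hw' (h.antisymm (hf.2.1 w' hw').2 (hs.2.1 w hw).2 ?_ ?_)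
  exacts [hle w' (Finset.mem_of_mem_erase hw'), h.trans hc h4]

/-- The top vertex of a combination lies in the cell of the point, so the two tops agree. If their
weights differed, one remainder would lie strictly between the other and `w`, hence in a cell at or
above that of `w`, against `rest_spec`. So the weights agree, the top cancels, and induction handles
the remainders. -/
lemma comb_unique (n : ℕ) : ∀ {s t : Finset E} {c d : E → ℝ}, s.card = n →
    s ∈ (derivedComplex W le).faces → t ∈ (derivedComplex W le).faces →
    (∀ v ∈ s, 0 < c v) → (∀ v ∈ t, 0 < d v) → ∑ v ∈ s, c v = 1 → ∑ v ∈ t, d v = 1 →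
    ∑ v ∈ s, c v • v = ∑ v ∈ t, d v • v → s = t ∧ ∀ v ∈ s, c v = d v := by
  classical
  induction n with
  | zero =>
    intro s t c d hn hs
    exact absurd (Finset.card_eq_zero.1 hn) hs.1.ne_empty
  | succ n ih =>
    intro s t c d hn hs ht hc0 hd0 hc1 hd1 heq
    obtain ⟨w, hw, hws⟩ := h.exists_top hs
    obtain ⟨w', hw', hwt⟩ := h.exists_top ht
    obtain rfl : w = w' := by
      refine h.antisymm (hs.2.1 w hw).2 (ht.2.1 w' hw').2 ?_ ?_
      · exact h.trans (h.le_comb hc0 hc1 hw hws) (heq ▸ h.comb_le hd0 hd1 hwt)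
      · exact h.trans (h.le_comb hd0 hd1 hw' hwt) (heq ▸ h.comb_le hc0 hc1 hws)
    have hwW := (hs.2.1 w hw).1
    by_cases hcw : c w < 1 <;> by_cases hdw : d w < 1
    · obtain ⟨h2, h3⟩ := split_sum hc1 hw hcw
      obtain ⟨h2', h3'⟩ := split_sum hd1 hw' hdw
      obtain ⟨hsf, hspos, hsle, hsn⟩ := h.rest_spec hs hc0 hc1 hw hws hcw
      obtain ⟨htf, htpos, htle, htn⟩ := h.rest_spec ht hd0 hd1 hw' hwt hdw
      have key := h3.symm.trans ((congrArg (· - w) heq).trans h3')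
      rcases lt_trichotomy (c w) (d w) with hlt | hlt | hlt
      · exact absurd (h.le_of_scaling htle hlt hdw.le key) hsn
      · rw [← hlt] at key
        have hne : (1 - c w) ≠ 0 := by linarith
        have key2 := sub_left_injective (smul_right_injective E hne key)
        obtain ⟨h5, h6⟩ := ih (by rw [Finset.card_erase_of_mem hw]; omega) hsf htf hspos
          (by rwa [← hlt] at htpos) h2 (by rwa [← hlt] at h2') key2
        refine ⟨by rw [← Finset.insert_erase hw, h5, Finset.insert_erase hw'], fun v hv => ?_⟩
        by_cases hvw : v = w
        · rw [hvw, hlt]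
        · have := h6 v (by simp [hvw, hv])
          field_simp at this
          exact this
      · exact absurd (h.le_of_scaling hsle hlt hcw.le key.symm) htn
    · obtain rfl := eq_singleton hd0 hd1 hw' hdw
      obtain ⟨h2, h3⟩ := split_sum hc1 hw hcw
      obtain ⟨hsf, hspos, hsle, hsn⟩ := h.rest_spec hs hc0 hc1 hw hws hcw
      have hd : d w = 1 := by simpa using hd1
      refine absurd (h.le_of_scaling (h.refl hwW) hcw (le_refl 1) (h3.symm.trans ?_)) hsn
      rw [heq]; simp [hd]
    · obtain rfl := eq_singleton hc0 hc1 hw hcw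
      obtain ⟨h2, h3⟩ := split_sum hd1 hw' hdw
      obtain ⟨hsf, hspos, hsle, hsn⟩ := h.rest_spec ht hd0 hd1 hw' hwt hdw
      have hd : c w = 1 := by simpa using hc1
      refine absurd (h.le_of_scaling (h.refl hwW) hdw (le_refl 1) (h3.symm.trans ?_)) hsn
      rw [← heq]; simp [hd]
    · obtain rfl := eq_singleton hd0 hd1 hw' hdw
      obtain rfl := eq_singleton hc0 hc1 hw hcw
      refine ⟨rfl, fun v hv => ?_⟩
      obtain rfl := Finset.mem_singleton.1 hv
      rw [show c v = 1 by simpa using hc1, show d v = 1 by simpa using hd1]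

/-- The ray from the representative `p` through `x` leaves the cell at a point `x'` of a strictly
lower cell, which has fewer vertices below it. Join the chain obtained for `x'` with `p`. -/
lemma exists_comb (n : ℕ) : ∀ x ∈ W, {v | cellRep le v = v ∧ le v x}.ncard = n →
    ∃ s ∈ (derivedComplex W le).faces, ∃ c : E → ℝ, (∀ v ∈ s, 0 < c v) ∧ ∑ v ∈ s, c v = 1 ∧
      ∑ v ∈ s, c v • v = x ∧ ∀ v ∈ s, le v x := by
  classical
  induction n using Nat.strong_induction_on with
  | _ n ih =>
  intro x hx hn
  set p := cellRep le x with hp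
  obtain ⟨hxp, hpx⟩ := h.rep_spec hx
  rw [← hp] at hxp hpx
  have hpW := h.mem_right hxp
  by_cases hxp' : x = p
  · refine ⟨{p}, ⟨by simp, ?_, ?_⟩, fun _ => 1, by simp, by simp, by simp [hxp'], by simpa using hpx⟩
    · simpa using ⟨hpW, h.rep_rep hx⟩
    · simpa using h.refl hpW
  obtain ⟨r, hr, h1, h2⟩ := h.exit hxp hpx hxp'
  set x' := p + r • (x - p) with hx'
  have hx'W := h.mem_left h1
  have hlt : {v | cellRep le v = v ∧ le v x'}.ncard < n := by
    rw [← hn]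
    refine ncard_lt_ncard ⟨fun v hv => ⟨hv.1, h.trans hv.2 (h.trans h1 hpx)⟩, fun hsub => ?_⟩
      (h.finite_vertices_lower hx)
    exact h2 (hsub ⟨h.rep_rep hx, hpx⟩).2
  obtain ⟨s, hs, c, hc0, hc1, hcx, hsx⟩ := ih _ hlt x' hx'W rfl
  have hps : p ∉ s := fun hps => h2 (hsx p hps)
  have hr0 : 0 < r := by linarith
  have hr1 : r⁻¹ < 1 := inv_lt_one_of_one_lt₀ hr
  have hne : ∀ v ∈ s, v ≠ p := fun v hv hvp => hps (hvp ▸ hv)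
  -- Solving `x' = p + r • (x - p)` for `x` gives weight `1 - r⁻¹` at `p` and `r⁻¹` at `x'`.
  refine ⟨insert p s, ⟨by simp, ?_, ?_⟩, fun v => if v = p then 1 - r⁻¹ else r⁻¹ * c v, ?_, ?_, ?_, ?_⟩
  · intro v hv
    rcases Finset.mem_insert.1 hv with rfl | hv
    exacts [⟨hpW, h.rep_rep hx⟩, hs.2.1 v hv]
  · intro a ha b hb
    rcases Finset.mem_insert.1 ha with rfl | ha <;> rcases Finset.mem_insert.1 hb with rfl | hb
    · exact Or.inl (h.refl hpW)
    · exact Or.inr (h.trans (hsx b hb) h1)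
    · exact Or.inl (h.trans (hsx a ha) h1)
    · exact hs.2.2 a ha b hb
  · intro v hv
    simp only
    split_ifs with hvp
    · linarith
    · exact mul_pos (by positivity) (hc0 v ((Finset.mem_insert.1 hv).resolve_left hvp))
  · rw [Finset.sum_insert hps, if_pos rfl,
      Finset.sum_congr rfl fun v hv => if_neg (hne v hv), ← Finset.mul_sum, hc1]
    ring
  · beta_reduce
    rw [Finset.sum_insert hps, if_pos rfl,
      Finset.sum_congr rfl fun v hv => by rw [if_neg (hne v hv), mul_smul], ← Finset.smul_sum, hcx,
      hx', smul_add, smul_smul, inv_mul_cancel₀ hr0.ne']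
    module
  · intro v hv
    rcases Finset.mem_insert.1 hv with rfl | hv
    exacts [hpx, h.trans (hsx v hv) (h.trans h1 hpx)]

lemma bary_top (x : simplicialRealization (derivedComplex W le)) {s : Finset E}
    (h1 : ∀ v, v ∈ s ↔ x.1 v ≠ 0)
    (h2 : ∑ v ∈ s, x.1 v = 1) {w : E} (hw : w ∈ s) (hle : ∀ v ∈ s, le v w) :
    le (bary _ id x) w ∧ le w (bary _ id x) := by
  rw [bary_eq_sum id x s fun v hv => (h1 v).2 hv]
  have h0 : ∀ v ∈ s, 0 < x.1 v := fun v hv =>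
    lt_of_le_of_ne (realization_nonneg x v) ((h1 v).1 hv).symm
  exact ⟨h.comb_le h0 h2 hle, h.le_comb h0 h2 hw hle⟩

lemma exists_vertex_top (x : simplicialRealization (derivedComplex W le)) :
    ∃ w, x.1 w ≠ 0 ∧ (∀ v, x.1 v ≠ 0 → le v w) ∧
      le (bary _ id x) w ∧ le w (bary _ id x) := by
  obtain ⟨s, hs, h1, h2⟩ := exists_support_face x
  obtain ⟨w, hw, hle⟩ := h.exists_top hs
  exact ⟨w, (h1 w).1 hw, fun v hv => hle v ((h1 v).2 hv), h.bary_top x h1 h2 hw hle⟩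

lemma range_bary : range (bary (derivedComplex W le) id) = W := by
  ext x
  constructor
  · rintro ⟨y, rfl⟩
    obtain ⟨w, -, -, h1, -⟩ := h.exists_vertex_top y
    exact h.mem_left h1
  · intro hx
    obtain ⟨s, hs, c, hc0, hc1, rfl, -⟩ := h.exists_comb _ x hx rfl
    exact ⟨pointOfFace hs (fun v hv => (hc0 v hv).le) hc1, bary_pointOfFace _ _ _ _⟩

lemma injective_bary : Function.Injective (bary (derivedComplex W le) id) := by
  intro x y hxy
  obtain ⟨s, hs, h1, h2⟩ := exists_support_face x
  obtain ⟨t, ht, h3, h4⟩ := exists_support_face y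
  have h0 : ∀ v ∈ s, 0 < x.1 v := fun v hv =>
    lt_of_le_of_ne (realization_nonneg x v) ((h1 v).1 hv).symm
  have h0' : ∀ v ∈ t, 0 < y.1 v := fun v hv =>
    lt_of_le_of_ne (realization_nonneg y v) ((h3 v).1 hv).symm
  rw [bary_eq_sum id x s fun v hv => (h1 v).2 hv, bary_eq_sum id y t fun v hv => (h3 v).2 hv] at hxy
  obtain ⟨rfl, h5⟩ := h.comb_unique _ rfl hs ht h0 h0' h2 h4 hxy
  refine realization_ext fun v => ?_
  by_cases hv : v ∈ s
  · exact h5 v hv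
  · rw [not_not.1 fun hh => hv ((h1 v).2 hh), not_not.1 fun hh => hv ((h3 v).2 hh)]

lemma locFin : LocFin (derivedComplex W le) := by
  classical
  intro v
  by_cases hv : v ∈ W
  · have hfin := (h.finite_vertices_lower hv).union (h.finite_vertices_upper hv)
    refine (Finset.finite_toSet hfin.toFinset.powerset).subset ?_
    rintro s ⟨hs, hvs⟩
    rw [Finset.mem_coe, Finset.mem_powerset]
    intro u hu
    rw [Finite.mem_toFinset]
    rcases hs.2.2 u hu v hvs with h1 | h1
    exacts [Or.inl ⟨(hs.2.1 u hu).2, h1⟩, Or.inr ⟨(hs.2.1 u hu).2, h1⟩]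
  · convert! finite_empty
    ext s
    simp only [mem_ofPred_eq, mem_empty_iff_false, iff_false, not_and]
    exact fun hs hvs => hv (hs.2.1 v hvs).1

/-- A face whose simplex meets the star neighborhood of `p` has its top vertex above `p`. There are
finitely many such tops, and finitely many chains below each. -/
lemma isEmbedding : IsEmbedding (bary (derivedComplex W le) id) := by
  classical
  refine isEmbedding_bary h.locFin h.injective_bary fun p hp => ?_
  rw [h.range_bary] at hp
  obtain ⟨U, hU, hUs⟩ := h.star_mem_nhds p hp
  refine ⟨U, hU, ?_⟩
  refine ((h.finite_vertices_upper hp).biUnion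
    (t := fun w => {s | w ∈ W ∧ ↑s ⊆ {v | cellRep le v = v ∧ le v w}}) fun w hw => ?_).subset ?_
  · have hfin := h.finite_vertices_lower (h.mem_right hw.2)
    refine (Finset.finite_toSet hfin.toFinset.powerset).subset fun s hs => ?_
    rw [Finset.mem_coe, Finset.mem_powerset]
    exact fun v hv => hfin.mem_toFinset.2 (hs.2 hv)
  · rintro s ⟨hs, z, hz, hzU⟩
    obtain ⟨x, hx, rfl⟩ := exists_bary_eq_of_mem_convexHull id hs hz
    obtain ⟨w, hw, hle⟩ := h.exists_top hs
    obtain ⟨w', hw', -, h1, h2⟩ := h.exists_vertex_top x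
    have hpw : le p w := h.trans (h.trans (hUs _ (h.mem_left h1) hzU) h1) (hle w' (hx w' hw'))
    exact mem_iUnion₂.2 ⟨w, ⟨(hs.2.1 w hw).2, hpw⟩, h.mem_right hpw,
      fun v hv => ⟨(hs.2.1 v hv).2, hle v hv⟩⟩

end CellOrder

end Derived

/-! ### Cells of hyperplane arrangements of variable level -/

section SignCells

variable {E : Type*} [NormedAddCommGroup E] [NormedSpace ℝ E]

/-- `x` lies in the closure of the cell of `y` in the arrangement of the first `k` hyperplanes. -/
def signLE (h : ℕ → E →ᴬ[ℝ] ℝ) (k : ℕ) (x y : E) : Prop :=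
  ∀ i < k, (0 < h i x → 0 < h i y) ∧ (h i x < 0 → h i y < 0)

/-- The closed star in `Q` of the cell of `p` in the arrangement of the first `k` hyperplanes. -/
def closedStar (h : ℕ → E →ᴬ[ℝ] ℝ) (Q : Set E) (k : ℕ) (p : E) : Set E :=
  {x ∈ Q | ∃ y ∈ Q, signLE h k p y ∧ signLE h k x y}

variable {h : ℕ → E →ᴬ[ℝ] ℝ} {k : ℕ} {x y z p : E}

lemma signLE.refl : signLE h k x x := fun _ _ => ⟨id, id⟩

lemma signLE.trans (h1 : signLE h k x y) (h2 : signLE h k y z) : signLE h k x z := fun i hi =>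
  ⟨(h2 i hi).1 ∘ (h1 i hi).1, (h2 i hi).2 ∘ (h1 i hi).2⟩

lemma signLE.mono {j : ℕ} (hjk : j ≤ k) (h1 : signLE h k x y) : signLE h j x y := fun i hi =>
  h1 i (hi.trans_le hjk)

lemma closedStar_anti {Q : Set E} (h1 : signLE h k x y) : closedStar h Q k y ⊆ closedStar h Q k x :=
  fun _ ⟨hz, w, hw, h2, h3⟩ => ⟨hz, w, hw, h1.trans h2, h3⟩

lemma eventually_signLE (h : ℕ → E →ᴬ[ℝ] ℝ) (k : ℕ) (p : E) : ∀ᶠ x in 𝓝 p, signLE h k p x := by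
  have : ∀ i ∈ Finset.range k, ∀ᶠ x in 𝓝 p, (0 < h i p → 0 < h i x) ∧ (h i p < 0 → h i x < 0) := by
    intro i _
    have hc := (h i).continuous.continuousAt (x := p)
    rw [Filter.eventually_and]
    constructor
    · by_cases hp : 0 < h i p
      · filter_upwards [hc.eventually (lt_mem_nhds hp)] with x hx _ using hx
      · exact Filter.Eventually.of_forall fun x hx => absurd hx hp
    · by_cases hp : h i p < 0
      · filter_upwards [hc.eventually (gt_mem_nhds hp)] with x hx _ using hx
      · exact Filter.Eventually.of_forall fun x hx => absurd hx hp
  filter_upwards [(Filter.eventually_all_finset _).2 this] with x hx i hi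
    using hx i (Finset.mem_range.2 hi)

lemma apply_line (f : E →ᴬ[ℝ] ℝ) (p x : E) (s : ℝ) :
    f (p + s • (x - p)) = f p + s * (f x - f p) := by
  have := f.toAffineMap.apply_lineMap p x s
  simp only [AffineMap.lineMap_apply, vsub_eq_sub, vadd_eq_add, smul_eq_mul] at this
  rw [add_comm p, add_comm (f p)]
  exact this

/-- The conditions under which the cells of the arrangements of the first `k` hyperplanes, each
point of `W` being assigned the least level `k` at which its closed star is good, form a locally
finite partition of `W`. -/
structure FineCells (Q W : Set E) (h : ℕ → E →ᴬ[ℝ] ℝ) (Good : ℕ → Set E → Prop) : Prop where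
  mono : ∀ {k A B}, A ⊆ B → Good k B → Good k A
  subset : W ⊆ Q
  exists_good : ∀ p ∈ W, ∃ k, Good k (closedStar h Q k p)
  star_subset : ∀ {k p}, p ∈ Q → Good k (closedStar h Q k p) → closedStar h Q k p ⊆ W
  convex : ∀ {k p}, p ∈ Q → Good k (closedStar h Q k p) → Convex ℝ {x ∈ Q | signLE h k x p}
  compact : ∀ {k p}, p ∈ Q → Good k (closedStar h Q k p) → IsCompact {x ∈ Q | signLE h k x p}
  line_mem : ∀ {k p x}, p ∈ Q → x ∈ Q → Good k (closedStar h Q k p) → signLE h k x p →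
    signLE h k p x → ∀ s : ℝ, signLE h k (p + s • (x - p)) p → signLE h k p (p + s • (x - p)) →
      p + s • (x - p) ∈ Q

namespace FineCells

/-- The level of a point: the least one at which its closed star is good. -/
noncomputable def level (Q : Set E) (h : ℕ → E →ᴬ[ℝ] ℝ) (Good : ℕ → Set E → Prop) (p : E) : ℕ :=
  sInf {k | Good k (closedStar h Q k p)}

/-- The closure order of the cells of variable level. -/
def le (Q W : Set E) (h : ℕ → E →ᴬ[ℝ] ℝ) (Good : ℕ → Set E → Prop) (x y : E) : Prop :=
  x ∈ W ∧ y ∈ W ∧ signLE h (level Q h Good y) x y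

variable {Q W : Set E} {Good : ℕ → Set E → Prop} (H : FineCells Q W h Good)
include H

lemma level_spec (hp : p ∈ W) :
    Good (level Q h Good p) (closedStar h Q (level Q h Good p) p) :=
  Nat.sInf_mem (H.exists_good p hp)

/-- Passing to a larger cell shrinks the closed star, so goodness is inherited upwards. This
monotonicity makes `le` transitive although its level varies. -/
lemma level_le_of_signLE (hg : Good k (closedStar h Q k x)) (hxy : signLE h k x y) :
    level Q h Good y ≤ k :=
  Nat.sInf_le (H.mono (closedStar_anti hxy) hg)

lemma level_le (hxy : le Q W h Good x y) : level Q h Good y ≤ level Q h Good x := by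
  by_contra hlt
  exact hlt (H.level_le_of_signLE (H.level_spec hxy.1) (hxy.2.2.mono (not_le.1 hlt).le))

/-- Membership in `W` is automatic, because the good closed star of `w` lies in `W`. So cell
closures are described inside `Q`, where convexity and compactness are known. -/
lemma lower_eq {w : E} (hw : w ∈ W) :
    {x | le Q W h Good x w} = {x ∈ Q | signLE h (level Q h Good w) x w} := by
  ext x
  refine ⟨fun hx => ⟨H.subset hx.1, hx.2.2⟩, fun hx => ⟨?_, hw, hx.2⟩⟩
  exact H.star_subset (H.subset hw) (H.level_spec hw) ⟨hx.1, w, H.subset hw, signLE.refl, hx.2⟩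

lemma le_of_signLE (hx : x ∈ W) (hy : y ∈ W) (hxy : signLE h (level Q h Good x) x y) :
    le Q W h Good x y :=
  ⟨hx, hy, hxy.mono (H.level_le_of_signLE (H.level_spec hx) hxy)⟩

-- At bounded level, the cell of a point is determined by its level and by the signs of finitely
-- many functions.
omit H in
lemma finite_classes (K : ℕ) : ∃ F : Set E, F.Finite ∧ ∀ x ∈ W, level Q h Good x ≤ K →
    ∃ y ∈ F, le Q W h Good x y ∧ le Q W h Good y x := by
  classical
  set S := {x ∈ W | level Q h Good x ≤ K}
  set f : E → ℕ × Finset ℕ × Finset ℕ := fun x => (level Q h Good x,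
    (Finset.range K).filter (fun i => 0 < h i x), (Finset.range K).filter (fun i => h i x < 0))
  have hfin : (f '' S).Finite := by
    refine (Finset.finite_toSet (Finset.range (K + 1) ×ˢ (Finset.range K).powerset ×ˢ
      (Finset.range K).powerset)).subset ?_
    rintro _ ⟨x, hx, rfl⟩
    simp only [f, Finset.coe_product, mem_prod, Finset.mem_coe, Finset.mem_range,
      Finset.mem_powerset, Finset.filter_subset, and_true]
    exact Nat.lt_succ_of_le hx.2
  obtain ⟨F, hFS, hFf⟩ := exists_subset_bijOn S f
  have hF : F.Finite := Finite.of_finite_image (hFf.image_eq ▸ hfin) hFf.injOn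
  refine ⟨F, hF, fun x hx hxK => ?_⟩
  obtain ⟨y, hy, hyx⟩ : f x ∈ f '' F := hFf.image_eq ▸ mem_image_of_mem f ⟨hx, hxK⟩
  have hyW := hFS hy
  simp only [f, Prod.mk.injEq, Finset.ext_iff, Finset.mem_filter, Finset.mem_range] at hyx
  obtain ⟨h1, h2, h3⟩ := hyx
  refine ⟨y, hy, ⟨hx, hyW.1, fun i hi => ?_⟩, hyW.1, hx, fun i hi => ?_⟩
  · have hiK : i < K := hi.trans_le hyW.2
    exact ⟨fun a => ((h2 i).2 ⟨hiK, a⟩).2, fun a => ((h3 i).2 ⟨hiK, a⟩).2⟩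
  · have hiK : i < K := hi.trans_le hxK
    exact ⟨fun a => ((h2 i).1 ⟨hiK, a⟩).2, fun a => ((h3 i).1 ⟨hiK, a⟩).2⟩

lemma cellOrder_segment {w : E} (hxw : le Q W h Good x w) (t : ℝ) (ht : 0 < t) (ht1 : t ≤ 1) :
    le Q W h Good w (x + t • (w - x)) := by
  have hw := hxw.2.1
  have hz : le Q W h Good (x + t • (w - x)) w := by
    have hc : Convex ℝ {x | le Q W h Good x w} := by
      rw [H.lower_eq hw]; exact H.convex (H.subset hw) (H.level_spec hw)
    have hx : x ∈ {x | le Q W h Good x w} := hxw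
    have hw' : w ∈ {x | le Q W h Good x w} := ⟨hw, hw, signLE.refl⟩
    have h1 : (1 - t) • x + t • w ∈ {x | le Q W h Good x w} :=
      hc hx hw' (sub_nonneg.2 ht1) ht.le (by ring)
    rw [show x + t • (w - x) = (1 - t) • x + t • w by module]
    exact h1
  refine H.le_of_signLE hw hz.1 fun i hi => ?_
  have h1 := hxw.2.2 i hi
  rw [apply_line]
  constructor
  · intro h2
    have h3 : 0 ≤ h i x := by
      by_contra hlt
      linarith [h1.2 (not_le.1 hlt)]
    nlinarith [mul_pos ht h2, mul_nonneg (sub_nonneg.2 ht1) h3]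
  · intro h2
    have h3 : h i x ≤ 0 := by
      by_contra hlt
      linarith [h1.1 (not_le.1 hlt)]
    nlinarith [mul_pos ht (neg_pos.2 h2), mul_nonneg (sub_nonneg.2 ht1) (neg_nonneg.2 h3)]

/-- The ray meets the compact closure of the cell in a compact set of parameters. Its last point
cannot be in the open cell, for then the ray could be followed a little further. -/
lemma cellOrder_exit (hxp : le Q W h Good x p) (hpx : le Q W h Good p x) (hne : x ≠ p) :
    ∃ s : ℝ, 1 < s ∧ le Q W h Good (p + s • (x - p)) p ∧
      ¬ le Q W h Good p (p + s • (x - p)) := by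
  have hp := hxp.2.1
  set k := level Q h Good p with hk
  have hkx : level Q h Good x = k := le_antisymm (H.level_le hpx) (H.level_le hxp)
  have hpx' : signLE h k p x := hkx ▸ hpx.2.2
  set C := {x | le Q W h Good x p} with hC
  have hCc : IsCompact C := by
    rw [hC, H.lower_eq hp]; exact H.compact (H.subset hp) (H.level_spec hp)
  have hγ : Continuous fun s : ℝ => p + s • (x - p) := by fun_prop
  have hS : IsCompact {s : ℝ | 1 ≤ s ∧ p + s • (x - p) ∈ C} := by
    refine Metric.isCompact_of_isClosed_isBounded
      (isClosed_Ici.inter (hCc.isClosed.preimage hγ)) ?_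
    obtain ⟨R, hR⟩ := hCc.isBounded.exists_norm_le
    refine (Metric.isBounded_closedBall (x := (0 : ℝ)) (r := (R + ‖p‖) / ‖x - p‖)).subset ?_
    rintro s ⟨-, hs⟩
    have h0 : 0 < ‖x - p‖ := norm_pos_iff.2 (sub_ne_zero.2 hne)
    rw [mem_closedBall_zero_iff, le_div_iff₀ h0, ← norm_smul]
    calc ‖s • (x - p)‖ = ‖(p + s • (x - p)) - p‖ := by congr 1; abel
      _ ≤ _ := (norm_sub_le _ _).trans (by linarith [hR _ hs])
  obtain ⟨s, hs, hmax⟩ := hS.exists_isGreatest ⟨1, le_rfl, by rw [one_smul, add_sub_cancel]; exact hxp⟩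
  have hnot : ¬ le Q W h Good p (p + s • (x - p)) := by
    intro hle
    have hsk : signLE h k p (p + s • (x - p)) := hle.2.2.mono (H.level_le hs.2)
    have hev := (hγ.tendsto s).eventually (eventually_signLE h k (p + s • (x - p)))
    obtain ⟨r, hr, hrs⟩ := (hev.filter_mono (nhdsWithin_le_nhds (s := Ioi s))).and
      self_mem_nhdsWithin |>.exists
    have h1 : signLE h k p (p + r • (x - p)) := hsk.trans hr
    have h2 : signLE h k (p + r • (x - p)) p := by
      intro i hi
      have h3 := h1 i hi
      have h4 := hxp.2.2 i hi
      -- A function vanishing at `p` vanishes at `x`, which has the same signs, and hence on the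
      -- whole line.
      have h5 : h i p = 0 → h i (p + r • (x - p)) = 0 := by
        intro h0
        have h6 : h i x = 0 := by
          rcases lt_trichotomy (h i x) 0 with h7 | h7 | h7
          · linarith [h4.2 h7]
          · exact h7
          · linarith [h4.1 h7]
        rw [apply_line, h0, h6]; ring
      rcases lt_trichotomy (h i p) 0 with h7 | h7 | h7
      · exact ⟨fun a => by linarith [h3.2 h7], fun _ => h7⟩
      · exact ⟨fun a => by linarith [h5 h7], fun a => by linarith [h5 h7]⟩
      · exact ⟨fun _ => h7, fun a => by linarith [h3.1 h7]⟩
    have h6 : p + r • (x - p) ∈ C := by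
      rw [hC, H.lower_eq hp]
      exact ⟨H.line_mem (H.subset hp) (H.subset hxp.1) (H.level_spec hp) hxp.2.2 hpx' r h2 h1, h2⟩
    have h7 : r ≤ s := hmax ⟨hs.1.trans (le_of_lt hrs), h6⟩
    exact absurd hrs (not_lt.2 h7)
  refine ⟨s, lt_of_le_of_ne hs.1 fun h1 => hnot ?_, hs.2, hnot⟩
  rw [← h1, one_smul, add_sub_cancel]
  exact hpx

lemma cellOrder_star (hp : p ∈ W) : ∃ U ∈ 𝓝 p, ∀ x ∈ W, x ∈ U → le Q W h Good p x :=
  ⟨_, eventually_signLE h (level Q h Good p) p, fun _ hx hxU => H.le_of_signLE hp hx hxU⟩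

lemma cellOrder : CellOrder W (le Q W h Good) where
  mem_left := fun h1 => h1.1
  mem_right := fun h1 => h1.2.1
  refl := fun hx => ⟨hx, hx, signLE.refl⟩
  trans := fun h1 h2 => ⟨h1.1, h2.2.1, (h1.2.2.mono (H.level_le h2)).trans h2.2.2⟩
  convex := by
    intro w
    by_cases hw : w ∈ W
    · rw [H.lower_eq hw]; exact H.convex (H.subset hw) (H.level_spec hw)
    · convert! convex_empty
      ext x
      simp only [mem_ofPred_eq, mem_empty_iff_false, iff_false]
      exact fun h1 => hw h1.2.1
  segment := fun hxw t ht ht1 => H.cellOrder_segment hxw t ht ht1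
  exit := fun hxp hpx hne => H.cellOrder_exit hxp hpx hne
  finite_lower := by
    intro p hp
    have hCc : IsCompact {x | le Q W h Good x p} := by
      rw [H.lower_eq hp]; exact H.compact (H.subset hp) (H.level_spec hp)
    -- Levels inside a star do not exceed that of its center, so a finite cover of the compact cell
    -- closure by stars bounds all levels there.
    have hU : ∀ x ∈ {x | le Q W h Good x p}, ∃ U ∈ 𝓝 x, ∀ y ∈ W, y ∈ U → le Q W h Good x y :=
      fun x hx => H.cellOrder_star hx.1
    choose! U hU1 hU2 using hU
    obtain ⟨t, ht, hcov⟩ := hCc.elim_nhds_subcover U hU1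
    obtain ⟨F, hF, hF'⟩ := finite_classes (Q := Q) (W := W) (h := h) (Good := Good)
      (t.sup (level Q h Good))
    refine ⟨F, hF, fun x hx => hF' x hx.1 ?_⟩
    obtain ⟨q, hq, hxq⟩ := mem_iUnion₂.1 (hcov hx)
    exact (H.level_le (hU2 q (ht q hq) x hx.1 hxq)).trans (Finset.le_sup (f := level Q h Good) hq)
  star_mem_nhds := fun p hp => H.cellOrder_star hp
  finite_upper := by
    intro p _
    obtain ⟨F, hF, hF'⟩ := finite_classes (Q := Q) (W := W) (h := h) (Good := Good)
      (level Q h Good p)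
    exact ⟨F, hF, fun x hx => hF' x hx.2.1 (H.level_le hx)⟩

/-- Triangulation of `W` by the derived complex of the cells of variable level. -/
theorem exists_triangulation : ∃ D : PreAbstractSimplicialComplex E, LocFin D ∧
    IsEmbedding (bary D id) ∧ range (bary D id) = W ∧
    ∀ x : simplicialRealization D, ∃ w, x.1 w ≠ 0 ∧ ∃ k, w ∈ Q ∧ Good k (closedStar h Q k w) ∧
      (∀ v, x.1 v ≠ 0 → v ∈ Q ∧ signLE h k v w) ∧
      signLE h k (bary D id x) w ∧ signLE h k w (bary D id x) := by
  have hc := H.cellOrder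
  refine ⟨_, hc.locFin, hc.isEmbedding, hc.range_bary, fun x => ?_⟩
  obtain ⟨w, hw, h1, h2, h3⟩ := hc.exists_vertex_top x
  have hwW := h2.2.1
  exact ⟨w, hw, _, H.subset hwW, H.level_spec hwW,
    fun v hv => ⟨H.subset (h1 v hv).1, (h1 v hv).2.2⟩, h2.2.2, h3.2.2.mono (H.level_le h2)⟩

end FineCells

end SignCells

/-! ### Open subsets of compact ANRs; locally closed sets -/

section ANR

lemma exists_isClosedEmbedding_pi_real (Q : Type u) [TopologicalSpace Q] [CompactSpace Q]
    [TopologicalSpace.MetrizableSpace Q] : ∃ e : Q → ℕ → ℝ, IsClosedEmbedding e := by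
  let := TopologicalSpace.metrizableSpaceMetric Q
  obtain ⟨F, hF⟩ := Metric.PiNatEmbed.exists_embedding_to_hilbert_cube (X := Q)
  have h2 : IsEmbedding fun (x : ℕ → unitInterval) n => (x n : ℝ) :=
    IsEmbedding.piMap fun _ => IsEmbedding.subtypeVal
  exact ⟨_, (h2.comp hF).continuous.isClosedEmbedding (h2.comp hF).injective⟩

/-- An open subset of a compact absolute neighborhood retract is an absolute neighborhood
retract. -/
lemma IsANR.of_isOpen {Q : Type u} [TopologicalSpace Q] [CompactSpace Q] (hQ : IsANR Q)
    {P : Set Q} (hP : IsOpen P) : IsANR P := by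
  obtain ⟨hm, hext⟩ := hQ
  refine ⟨inferInstance, fun M _ _ i hi => ?_⟩
  obtain ⟨e, he⟩ := exists_isClosedEmbedding_pi_real Q
  -- The test spaces in `IsANR` live in universe `u`, so `ℕ → ℝ` has to be lifted.
  have hup : IsClosedEmbedding fun q => ULift.up.{u} (e q) :=
    Homeomorph.ulift.symm.isClosedEmbedding.comp he
  have : TopologicalSpace.MetrizableSpace (ULift.{u} (ℕ → ℝ)) :=
    Homeomorph.ulift.isEmbedding.metrizableSpace
  obtain ⟨U, r, hU, hrange, hr, hri⟩ := hext (ULift.{u} (ℕ → ℝ)) _ hup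
  obtain ⟨G, hG⟩ := ContinuousMap.exists_extension' hi
    ⟨fun p : P => e p, he.continuous.comp continuous_subtype_val⟩
  have hG' : ∀ p, G (i p) = e p := fun p => congrFun hG p
  set O : Set M := {m | ULift.up.{u} (G m) ∈ U}
  have hGc : Continuous fun m => ULift.up.{u} (G m) := continuous_uliftUp.comp G.continuous
  have hO : IsOpen O := hU.preimage hGc
  -- `F` extends the inclusion of `P` in `Q` over the neighborhood `O`; since `P` is open, `F ⁻¹' P`
  -- is the required neighborhood and `F` retracts it.
  let F : O → Q := fun m => r ⟨ULift.up (G m), m.2⟩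
  have hF : Continuous F := hr.comp
    ((hGc.comp continuous_subtype_val).subtype_mk fun m : O => m.2)
  have hFi : ∀ (p : P) (hp : i p ∈ O), F ⟨i p, hp⟩ = p := by
    intro p hp
    have h1 := hri p (hrange (mem_range_self _))
    rw [← h1]
    simp only [F, hG']
  have hmem : ∀ p : P, i p ∈ O := fun p => by
    change ULift.up (G (i p)) ∈ U
    rw [hG']; exact hrange (mem_range_self _)
  have hsub : ∀ m ∈ Subtype.val '' (F ⁻¹' P), ∃ h : m ∈ O, F ⟨m, h⟩ ∈ P := by
    rintro _ ⟨m, hm, rfl⟩; exact ⟨m.2, hm⟩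
  refine ⟨Subtype.val '' (F ⁻¹' P), fun m => ⟨F ⟨m, (hsub m m.2).1⟩, (hsub m m.2).2⟩,
    hO.isOpenMap_subtype_val _ (hP.preimage hF), ?_, ?_, ?_⟩
  · rintro _ ⟨p, rfl⟩
    exact ⟨⟨i p, hmem p⟩, by rw [mem_preimage, hFi]; exact p.2, rfl⟩
  · exact (hF.comp (continuous_subtype_val.subtype_mk _)).subtype_mk _
  · intro p hp
    exact Subtype.ext (hFi p _)

/-- The complement of the union of a compact set and an open set in a compact Hausdorff space is
locally compact. -/
lemma locallyCompactSpace_compl_union {Q : Type u} [TopologicalSpace Q] [CompactSpace Q] [T2Space Q]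
    {K P : Set Q} (hK : IsCompact K) (hP : IsOpen P) :
    LocallyCompactSpace ((K ∪ P)ᶜ : Set Q) := by
  have h : IsLocallyClosed (K ∪ P)ᶜ := by
    rw [compl_union]
    exact hK.isClosed.isOpen_compl.isLocallyClosed.inter hP.isClosed_compl.isLocallyClosed
  exact h.locallyCompactSpace

/-- A locally compact subset is open in its closure: a compact neighborhood in `P` contains `O ∩ P`
for some open `O`, and being closed it contains `O ∩ closure P` too. -/
lemma isClosed_closure_diff_of_locallyCompactSpace {X : Type*} [TopologicalSpace X] [T2Space X]
    {P : Set X} (hP : LocallyCompactSpace P) : IsClosed (closure P \ P) := by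
  rw [← isOpen_compl_iff, isOpen_iff_mem_nhds]
  intro x hx
  by_cases hxP : x ∈ P
  · obtain ⟨C, hC, hCx⟩ := exists_compact_mem_nhds (⟨x, hxP⟩ : P)
    obtain ⟨U, hU, hUC⟩ := mem_nhds_subtype _ _ _ |>.1 hCx
    obtain ⟨O, hOU, hO, hxO⟩ := mem_nhds_iff.1 hU
    filter_upwards [hO.mem_nhds hxO] with y hy hyc
    have h1 : closure (O ∩ P) ⊆ Subtype.val '' C := by
      refine closure_minimal ?_ (hC.image continuous_subtype_val).isClosed
      rintro z ⟨hz, hzP⟩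
      exact ⟨⟨z, hzP⟩, hUC (hOU hz), rfl⟩
    obtain ⟨z, -, rfl⟩ := h1 (hO.inter_closure ⟨hy, hyc.1⟩)
    exact hyc.2 z.2
  · have : x ∉ closure P := fun h => hx ⟨h, hxP⟩
    filter_upwards [isClosed_closure.isOpen_compl.mem_nhds this] with y hy hyc using hy hyc.1

end ANR

/-! ### Simplexes as finite intersections of half-spaces -/

section Halfspaces

/-- The convex hull of an affinely independent finite set is the intersection of finitely many
closed half-spaces. -/
lemma exists_finite_halfspaces {E : Type*} [NormedAddCommGroup E] [NormedSpace ℝ E]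
    [FiniteDimensional ℝ E] {s : Finset E} (hs : AffineIndependent ℝ ((↑) : s → E)) :
    ∃ A : Set (E →ᴬ[ℝ] ℝ), A.Finite ∧
      convexHull ℝ (s : Set E) = {x | ∀ h ∈ A, 0 ≤ h x} := by
  classical
  obtain ⟨t, hst, htind, htspan⟩ := exists_subset_affineIndependent_affineSpan_eq_top hs
  have : Finite t := finite_of_fin_dim_affineIndependent ℝ htind
  let : Fintype t := Fintype.ofFinite t
  have hspan : affineSpan ℝ (range ((↑) : t → E)) = ⊤ := by rwa [Subtype.range_coe]
  let b : AffineBasis t ℝ E := ⟨((↑) : t → E), htind, hspan⟩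
  let f : t → E →ᴬ[ℝ] ℝ := fun i => ⟨b.coord i, (b.coord i).continuous_of_finiteDimensional⟩
  have hf : ∀ i x, f i x = b.coord i x := fun _ _ => rfl
  -- Take the barycentric coordinates of an affine basis extending `s`; adding the opposite
  -- inequality for the vertices outside `s` forces those coordinates to vanish.
  refine ⟨range f ∪ (fun i => - f i) '' {i | (i : E) ∉ s},
    (finite_range f).union ((toFinite _).image _), ?_⟩
  ext x
  constructor
  · intro hx g hg
    have hconv : Convex ℝ {x | 0 ≤ g x} := by
      intro y hy z hz a c ha hc hac
      have h1 : g (a • y + c • z) = a * g y + c * g z := by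
        have := Convex.combo_affine_apply (f := g.toAffineMap) (x := y) (y := z) hac
        simpa using this
      simp only [mem_ofPred_eq] at hy hz ⊢
      rw [h1]; positivity
    refine convexHull_min ?_ hconv hx
    intro y hy
    have hyt : y ∈ t := hst hy
    have hb : ∀ i : t, b.coord i y = if i = ⟨y, hyt⟩ then 1 else 0 := fun i =>
      b.coord_apply i ⟨y, hyt⟩
    rcases hg with ⟨i, rfl⟩ | ⟨i, hi, rfl⟩
    · change 0 ≤ b.coord i y
      rw [hb]; split_ifs <;> norm_num
    · change 0 ≤ -(b.coord i y)
      have : i ≠ ⟨y, hyt⟩ := by rintro rfl; exact hi hy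
      rw [hb, if_neg this, neg_zero]
  · intro hx
    have h0 : ∀ i, 0 ≤ b.coord i x := fun i => hx (f i) (Or.inl (mem_range_self i))
    have h1 : ∀ i : t, (i : E) ∉ s → b.coord i x = 0 := fun i hi => by
      have : 0 ≤ -(b.coord i x) := hx (- f i) (Or.inr ⟨i, hi, rfl⟩)
      linarith [h0 i]
    have hsum := b.sum_coord_apply_eq_one x
    have hx' := b.linear_combination_coord_eq_self x
    rw [← hx']
    have h2 : ∑ i ∈ Finset.univ.filter (fun i : t => (i : E) ∈ s), b.coord i x = 1 := by
      rw [← hsum]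
      refine Finset.sum_subset (Finset.subset_univ _) fun i _ hi => h1 i ?_
      simpa using hi
    have h3 : ∑ i, b.coord i x • b i =
        ∑ i ∈ Finset.univ.filter (fun i : t => (i : E) ∈ s), b.coord i x • b i := by
      refine (Finset.sum_subset (Finset.subset_univ _) fun i _ hi => ?_).symm
      rw [h1 i (by simpa using hi), zero_smul]
    rw [h3]
    refine (convex_convexHull ℝ _).sum_mem (fun i _ => h0 i) h2 fun i hi => ?_
    exact subset_convexHull ℝ _ (Finset.mem_filter.1 hi).2

end Halfspaces

/-! ### Adapted triangulations in Euclidean space -/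

section Triangulation

/-- Two rational levels of `f` bracket `f p` within `ε`; once both are among the first `k`
hyperplanes, the closed star is trapped between them. -/
lemma abs_sub_lt_of_mem_closedStar {E : Type*} [NormedAddCommGroup E] [NormedSpace ℝ E]
    {h : ℕ → E →ᴬ[ℝ] ℝ} (Q : Set E) {f : E → ℝ} (hf : ∀ q : ℚ, ∃ i, ∀ x, h i x = f x - q)
    (p : E) {ε : ℝ} (hε : 0 < ε) :
    ∃ k₀, ∀ k ≥ k₀, ∀ x ∈ closedStar h Q k p, |f x - f p| < ε := by
  obtain ⟨a, ha1, ha2⟩ := exists_rat_btwn (show f p - ε < f p by linarith)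
  obtain ⟨b, hb1, hb2⟩ := exists_rat_btwn (show f p < f p + ε by linarith)
  obtain ⟨i, hi⟩ := hf a
  obtain ⟨j, hj⟩ := hf b
  refine ⟨max (i + 1) (j + 1), fun k hk x hx => ?_⟩
  obtain ⟨-, y, -, hpy, hxy⟩ := hx
  have hik : i < k := (le_max_left (i + 1) (j + 1)).trans hk
  have hjk : j < k := (le_max_right (i + 1) (j + 1)).trans hk
  have h1 : 0 < h i y := (hpy i hik).1 (by rw [hi]; linarith)
  have h2 : h j y < 0 := (hpy j hjk).2 (by rw [hj]; linarith)
  have h3 : 0 ≤ h i x := by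
    by_contra hlt
    linarith [(hxy i hik).2 (not_le.1 hlt)]
  have h4 : h j x ≤ 0 := by
    by_contra hlt
    linarith [(hxy j hjk).1 (not_le.1 hlt)]
  rw [hi] at h3
  rw [hj] at h4
  rw [abs_lt]
  constructor <;> linarith

lemma isClosed_signLE {E : Type*} [NormedAddCommGroup E] [NormedSpace ℝ E]
    (h : ℕ → E →ᴬ[ℝ] ℝ) (k : ℕ) (p : E) : IsClosed {x | signLE h k x p} := by
  rw [← isOpen_compl_iff, isOpen_iff_mem_nhds]
  intro x hx
  filter_upwards [eventually_signLE h k x] with y hy hyp using hx (hy.trans hyp)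

lemma convex_signLE {E : Type*} [NormedAddCommGroup E] [NormedSpace ℝ E]
    (h : ℕ → E →ᴬ[ℝ] ℝ) (k : ℕ) (p : E) : Convex ℝ {x | signLE h k x p} := by
  intro x hx y hy a b ha hb hab i hi
  have h1 : h i (a • x + b • y) = a * h i x + b * h i y := by
    have := Convex.combo_affine_apply (f := (h i).toAffineMap) (x := x) (y := y) hab
    simpa using this
  rw [h1]
  constructor
  · intro hpos
    by_contra hp
    have hx' : h i x ≤ 0 := not_lt.1 fun hh => hp ((hx i hi).1 hh)
    have hy' : h i y ≤ 0 := not_lt.1 fun hh => hp ((hy i hi).1 hh)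
    nlinarith [mul_nonneg ha (neg_nonneg.2 hx'), mul_nonneg hb (neg_nonneg.2 hy')]
  · intro hneg
    by_contra hp
    have hx' : 0 ≤ h i x := not_lt.1 fun hh => hp ((hx i hi).2 hh)
    have hy' : 0 ≤ h i y := not_lt.1 fun hh => hp ((hy i hi).2 hh)
    nlinarith [mul_nonneg ha hx', mul_nonneg hb hy']

lemma mem_convexHull_of_signLE {E : Type*} [NormedAddCommGroup E] [NormedSpace ℝ E]
    {h : ℕ → E →ᴬ[ℝ] ℝ} {k : ℕ} {x y : E} {A : Set (E →ᴬ[ℝ] ℝ)} {s : Finset E}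
    (hs : convexHull ℝ (s : Set E) = {x | ∀ g ∈ A, 0 ≤ g x}) (hA : A ⊆ h '' Iio k)
    (hxy : signLE h k x y) (hy : y ∈ convexHull ℝ (s : Set E)) :
    x ∈ convexHull ℝ (s : Set E) := by
  rw [hs] at hy ⊢
  intro g hg
  obtain ⟨i, hi, rfl⟩ := hA hg
  by_contra hlt
  linarith [(hxy i hi).2 (not_le.1 hlt), hy _ hg]

variable {m : ℕ}

/-- A subset `W` of a compact union `Q` of simplices, in which a countable family `S` of simplices is
locally finite, has a triangulation adapted to `S` that is as fine as one wishes. -/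
theorem exists_adapted_triangulation {Q W : Set (EuclideanSpace ℝ (Fin m))} (hQ : IsCompact Q)
    {S S' : Set (Finset (EuclideanSpace ℝ (Fin m)))} (hS : S.Countable)
    (hind : ∀ s ∈ S, AffineIndependent ℝ ((↑) : s → EuclideanSpace ℝ (Fin m)))
    (hSS : S' ⊆ S) (hQS : Q = ⋃ s ∈ S', convexHull ℝ (s : Set (EuclideanSpace ℝ (Fin m))))
    (hlf : ∀ p ∈ W, ∃ U ∈ 𝓝 p,
      {s ∈ S | (convexHull ℝ (s : Set (EuclideanSpace ℝ (Fin m))) ∩ U).Nonempty}.Finite)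
    (G : Set (EuclideanSpace ℝ (Fin m)) → Prop) (hGmono : ∀ {A B}, A ⊆ B → G B → G A)
    (hWQ : W ⊆ Q) (hGW : ∀ p ∈ W, ∃ U ∈ 𝓝 p, G (U ∩ Q)) (hG : ∀ A, G A → A ⊆ W) :
    ∃ D : PreAbstractSimplicialComplex (EuclideanSpace ℝ (Fin m)), LocFin D ∧
      IsEmbedding (bary D id) ∧ range (bary D id) = W ∧
      ∀ x : simplicialRealization D, ∃ A, G A ∧ bary D id x ∈ A ∧ (∀ v, x.1 v ≠ 0 → v ∈ A) ∧
        ∃ w, x.1 w ≠ 0 ∧ ∀ s ∈ S,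
          (w ∈ convexHull ℝ (s : Set (EuclideanSpace ℝ (Fin m))) → ∀ v, x.1 v ≠ 0 →
            v ∈ convexHull ℝ (s : Set (EuclideanSpace ℝ (Fin m)))) ∧
          (bary D id x ∈ convexHull ℝ (s : Set (EuclideanSpace ℝ (Fin m))) ↔
            w ∈ convexHull ℝ (s : Set (EuclideanSpace ℝ (Fin m)))) := by
  have hhalf : ∀ s ∈ S, ∃ A : Set (EuclideanSpace ℝ (Fin m) →ᴬ[ℝ] ℝ), A.Finite ∧
      convexHull ℝ (s : Set (EuclideanSpace ℝ (Fin m))) = {x | ∀ h ∈ A, 0 ≤ h x} :=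
    fun s hs => exists_finite_halfspaces (hind s hs)
  choose! A hAfin hA using hhalf
  let g : Fin m × ℚ → EuclideanSpace ℝ (Fin m) →ᴬ[ℝ] ℝ := fun i =>
    (EuclideanSpace.proj i.1 : EuclideanSpace ℝ (Fin m) →L[ℝ] ℝ).toContinuousAffineMap -
      ContinuousAffineMap.const ℝ _ (i.2 : ℝ)
  -- The zero function only serves to make the set nonempty, so that a sequence can enumerate it.
  have hcount : (insert 0 (range g ∪ ⋃ s ∈ S, A s)).Countable :=
    ((countable_range g).union (hS.biUnion fun s hs => (hAfin s hs).countable)).insert 0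
  obtain ⟨h, hh⟩ := hcount.exists_eq_range (insert_nonempty _ _)
  have hgh : ∀ i : Fin m, ∀ q : ℚ, ∃ j, ∀ x, h j x = x i - q := by
    intro i q
    have : g (i, q) ∈ range h := hh ▸ Or.inr (Or.inl (mem_range_self _))
    obtain ⟨j, hj⟩ := this
    exact ⟨j, fun x => by rw [hj]; rfl⟩
  have hAh : ∀ s ∈ S, ∃ k, A s ⊆ h '' Iio k := by
    intro s hs
    have h1 : A s ⊆ range h := hh ▸ fun a ha => Or.inr (Or.inr (mem_iUnion₂.2 ⟨s, hs, ha⟩))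
    have h2 : ∀ a ∈ A s, ∃ i, h i = a := fun a ha => h1 ha
    choose! i hi using h2
    obtain ⟨b, hb⟩ := ((hAfin s hs).image i).bddAbove
    exact ⟨b + 1, fun a ha => ⟨i a, Nat.lt_succ_of_le (hb (mem_image_of_mem i ha)), hi a ha⟩⟩
  choose! κ hκ using hAh
  -- If all half-spaces of a simplex are among the first `k`, membership in it passes from a cell to
  -- its closure; this is demanded of every simplex that meets `B`.
  set Good : ℕ → Set (EuclideanSpace ℝ (Fin m)) → Prop := fun k B => G B ∧
    ∀ s ∈ S, (convexHull ℝ (s : Set (EuclideanSpace ℝ (Fin m))) ∩ B).Nonempty → A s ⊆ h '' Iio k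
  have hstar : ∀ {k p}, p ∈ Q → p ∈ closedStar h Q k p := fun hp =>
    ⟨hp, _, hp, signLE.refl, signLE.refl⟩
  have hsimp : ∀ {k p}, p ∈ Q → Good k (closedStar h Q k p) → ∃ s ∈ S',
      p ∈ convexHull ℝ (s : Set (EuclideanSpace ℝ (Fin m))) ∧ A s ⊆ h '' Iio k := by
    intro k p hp hg
    have hp' := hp
    rw [hQS] at hp'
    obtain ⟨s, hs, hps⟩ := mem_iUnion₂.1 hp'
    exact ⟨s, hs, hps, hg.2 s (hSS hs) ⟨p, hps, hstar hp⟩⟩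
  have hsub : ∀ s ∈ S', convexHull ℝ (s : Set (EuclideanSpace ℝ (Fin m))) ⊆ Q := fun s hs => by
    rw [hQS]; exact subset_biUnion_of_mem (u := fun s : Finset (EuclideanSpace ℝ (Fin m)) =>
      convexHull ℝ (s : Set (EuclideanSpace ℝ (Fin m)))) hs
  have H : FineCells Q W h Good :=
    { mono := fun hAB hB => ⟨hGmono hAB hB.1, fun s hs hne =>
        hB.2 s hs (hne.mono (inter_subset_inter_right _ hAB))⟩
      subset := hWQ
      exists_good := by
        intro p hp
        obtain ⟨U₁, hU₁, hGU⟩ := hGW p hp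
        obtain ⟨U₂, hU₂, hfin⟩ := hlf p hp
        obtain ⟨k₁, hk₁⟩ := (hfin.image κ).bddAbove
        let e := EuclideanSpace.equiv (Fin m) ℝ
        have hV : e.symm ⁻¹' (U₁ ∩ U₂) ∈ 𝓝 (e p) :=
          e.symm.continuous.continuousAt.preimage_mem_nhds (by
            rw [e.symm_apply_apply]; exact Filter.inter_mem hU₁ hU₂)
        obtain ⟨ε, hε, hball⟩ := Metric.mem_nhds_iff.1 hV
        have hcl : ∀ i : Fin m, ∃ k₀, ∀ k ≥ k₀, ∀ x ∈ closedStar h Q k p, |x i - p i| < ε :=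
          fun i => abs_sub_lt_of_mem_closedStar Q (hgh i) p hε
        choose k₀ hk₀ using hcl
        -- `k₁` accounts for the half-spaces of the finitely many simplexes near `p`, and the `k₀ i`
        -- make the star small in each coordinate.
        refine ⟨max k₁ (Finset.univ.sup k₀), ?_⟩
        have hin : closedStar h Q (max k₁ (Finset.univ.sup k₀)) p ⊆ (U₁ ∩ U₂) ∩ Q := by
          intro x hx
          refine ⟨?_, hx.1⟩
          have h1 : e x ∈ Metric.ball (e p) ε := by
            rw [Metric.mem_ball, dist_pi_lt_iff hε]
            intro i
            exact hk₀ i _ ((Finset.le_sup (Finset.mem_univ i)).trans (le_max_right _ _)) x hx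
          have := hball h1
          rwa [mem_preimage, e.symm_apply_apply] at this
        have hin' : closedStar h Q (max k₁ (Finset.univ.sup k₀)) p ⊆ U₁ ∩ Q :=
          hin.trans (inter_subset_inter_left _ inter_subset_left)
        refine ⟨hGmono hin' hGU, fun s hs hne => ?_⟩
        refine (hκ s hs).trans (image_mono fun i hi => ?_)
        have h2 : κ s ≤ k₁ := hk₁ (mem_image_of_mem κ ⟨hs, hne.mono
          (inter_subset_inter_right _ fun x hx => (hin hx).1.2)⟩)
        exact lt_of_lt_of_le hi (h2.trans (le_max_left _ _))
      star_subset := fun _ hg => hG _ hg.1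
      convex := by
        intro k p hp hg
        obtain ⟨s, hs, hps, hAs⟩ := hsimp hp hg
        have : {x ∈ Q | signLE h k x p} =
            convexHull ℝ (s : Set (EuclideanSpace ℝ (Fin m))) ∩ {x | signLE h k x p} := by
          ext x
          exact ⟨fun hx => ⟨mem_convexHull_of_signLE (hA s (hSS hs)) hAs hx.2 hps, hx.2⟩,
            fun hx => ⟨hsub s hs hx.1, hx.2⟩⟩
        rw [this]
        exact (convex_convexHull ℝ _).inter (convex_signLE h k p)
      compact := fun _ _ => hQ.inter_right (isClosed_signLE h _ _)
      line_mem := by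
        intro k p x hp _ hg _ _ t ht _
        obtain ⟨s, hs, hps, hAs⟩ := hsimp hp hg
        exact hsub s hs (mem_convexHull_of_signLE (hA s (hSS hs)) hAs ht hps) }
  obtain ⟨D, hD, hemb, hrange, htop⟩ := H.exists_triangulation
  refine ⟨D, hD, hemb, hrange, fun x => ?_⟩
  obtain ⟨w, hw, k, hwQ, hg, hv, hxw, hwx⟩ := htop x
  have hxQ : bary D id x ∈ Q := hWQ (hrange ▸ mem_range_self x)
  have hxs : bary D id x ∈ closedStar h Q k w := ⟨hxQ, w, hwQ, signLE.refl, hxw⟩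
  refine ⟨closedStar h Q k w, hg.1, hxs, fun v hvx => (⟨(hv v hvx).1, w, hwQ, signLE.refl, (hv v hvx).2⟩ : v ∈ closedStar h Q k w),
    w, hw,
    fun s hs => ⟨fun hws v hv' => ?_, fun hxs' => ?_, fun hws => ?_⟩⟩
  · exact mem_convexHull_of_signLE (hA s hs) (hg.2 s hs ⟨w, hws, hstar hwQ⟩) (hv v hv').2 hws
  · exact mem_convexHull_of_signLE (hA s hs) (hg.2 s hs ⟨_, hxs', hxs⟩) hwx hxs'
  · exact mem_convexHull_of_signLE (hA s hs) (hg.2 s hs ⟨w, hws, hstar hwQ⟩) hxw hws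

end Triangulation

/-! ### Locally compact affine polyhedra -/

section AffinePolyhedra

/-- The space of a locally compact affine polyhedron is the union of a countable family of simplices
that is locally finite at its points. -/
lemma IsAffinePolyhedron.exists_simplices {E : Type u} [NormedAddCommGroup E] [NormedSpace ℝ E]
    [SecondCountableTopology E] {P : Set E} (hP : IsAffinePolyhedron P)
    (hlc : LocallyCompactSpace P) : ∃ S : Set (Finset E), S.Countable ∧
      (∀ s ∈ S, AffineIndependent ℝ ((↑) : s → E)) ∧
      P = ⋃ s ∈ S, convexHull ℝ (s : Set E) ∧
      ∀ p ∈ P, ∃ U ∈ 𝓝 p, {s ∈ S | (convexHull ℝ (s : Set E) ∩ U).Nonempty}.Finite := by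
  obtain ⟨C, rfl, hemb⟩ := hP
  change IsEmbedding (bary C.toPreAbstractSimplicialComplex id) at hemb
  have hrange : range (bary C.toPreAbstractSimplicialComplex id) = C.space := by
    ext z
    rw [Geometry.SimplicialComplex.mem_space_iff]
    constructor
    · rintro ⟨x, rfl⟩
      obtain ⟨s, hs, h1, h2⟩ := exists_support_face x
      refine ⟨s, hs, ?_⟩
      have := bary_mem_convexHull id x (s := s) fun v hv => (h1 v).2 hv
      rwa [image_id] at this
    · rintro ⟨s, hs, hz⟩
      rw [← image_id (s : Set E)] at hz
      obtain ⟨x, -, rfl⟩ := exists_bary_eq_of_mem_convexHull id hs hz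
      exact mem_range_self x
  have hlc' : LocallyCompactSpace (simplicialRealization C.toPreAbstractSimplicialComplex) := by
    rw [← hrange] at hlc
    exact hemb.toHomeomorph.isClosedEmbedding.locallyCompactSpace
  have hD := locFin_of_locallyCompactSpace hlc'
  have := hemb.secondCountableTopology
  refine ⟨C.faces, countable_faces hD, fun s hs => C.indep hs, rfl, fun p hp => ?_⟩
  rw [← hrange] at hp
  obtain ⟨U, hU, hfin⟩ := simplicesLocFinAt_of_isEmbedding hD hemb p hp
  simp only [image_id] at hfin
  exact ⟨U, hU, hfin⟩

lemma isPolyhedron_of_isEmbedding {X E : Type u} [TopologicalSpace X] [NormedAddCommGroup E]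
    [NormedSpace ℝ E] {j : X → E} (hj : IsEmbedding j) {V : Type u}
    {D : PreAbstractSimplicialComplex V} {w : V → E} (hb : IsEmbedding (bary D w))
    (hrange : range j = range (bary D w)) : IsPolyhedron X :=
  ⟨V, D, ⟨hj.toHomeomorph.trans ((Homeomorph.setCongr hrange).trans hb.toHomeomorph.symm)⟩⟩

end AffinePolyhedra

/-! ### Radial deformation of an open star -/

section Deformation

variable {E : Type u} [NormedAddCommGroup E] [NormedSpace ℝ E]
  {D : PreAbstractSimplicialComplex E} {P : Set E}

/-- The sum of the barycentric coordinates at the vertices in `P`. -/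
noncomputable def weightIn (D : PreAbstractSimplicialComplex E) (P : Set E)
    (x : simplicialRealization D) : ℝ :=
  bary D (P.indicator fun _ => (1 : ℝ)) x

/-- The radial projection of the realization to the full subcomplex with vertices in `P`. -/
noncomputable def projTo (D : PreAbstractSimplicialComplex E) (P : Set E)
    (x : simplicialRealization D) : E :=
  (weightIn D P x)⁻¹ • bary D (P.indicator id) x

/-- Restricting coordinates to `P` and normalizing stays in the face of `x`, so the whole segment is
realized in that face; at `t = 1` only vertices in `P` remain. -/
lemma exists_point_segment_projTo (x : simplicialRealization D) (hx : 0 < weightIn D P x) {t : ℝ}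
    (ht0 : 0 ≤ t) (ht1 : t ≤ 1) : ∃ y : simplicialRealization D,
      bary D id y = bary D id x + t • (projTo D P x - bary D id x) ∧ 0 < weightIn D P y ∧
      ∀ v, y.1 v ≠ 0 → x.1 v ≠ 0 ∧ (t = 1 → v ∈ P) := by
  classical
  obtain ⟨s, hs, h1, h2⟩ := exists_support_face x
  have hxs : ∀ v, x.1 v ≠ 0 → v ∈ s := fun v hv => (h1 v).2 hv
  set χ : E → ℝ := P.indicator fun _ => (1 : ℝ) with hχ
  set a := weightIn D P x with ha
  have hχ2 : ∀ v, χ v * χ v = χ v := fun v => by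
    by_cases hv : v ∈ P <;> simp [hχ, hv]
  have hχ0 : ∀ v, 0 ≤ χ v := fun v => by by_cases hv : v ∈ P <;> simp [hχ, hv]
  have hid : P.indicator id = fun v => χ v • v := by
    funext v
    by_cases hv : v ∈ P <;> simp [hχ, hv]
  have ha' : ∑ v ∈ s, x.1 v * χ v = a := by
    rw [ha, weightIn, bary_eq_sum _ x s hxs]; rfl
  set c : E → ℝ := fun v => (1 - t) * x.1 v + t * (a⁻¹ * (x.1 v * χ v)) with hc
  have hc0 : ∀ v ∈ s, 0 ≤ c v := fun v _ => by
    have := realization_nonneg x v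
    have := hχ0 v
    have : 0 ≤ 1 - t := by linarith
    positivity
  have hc1 : ∑ v ∈ s, c v = 1 := by
    simp only [hc]
    rw [Finset.sum_add_distrib, ← Finset.mul_sum, ← Finset.mul_sum, ← Finset.mul_sum, h2, ha',
      inv_mul_cancel₀ hx.ne']
    ring
  refine ⟨pointOfFace hs hc0 hc1, ?_, ?_, ?_⟩
  · rw [bary_pointOfFace, bary_eq_sum id x s hxs, projTo, hid, bary_eq_sum _ x s hxs]
    simp only [hc, add_smul, Finset.sum_add_distrib, mul_smul, ← Finset.smul_sum, id]
    rw [← ha]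
    module
  · rw [weightIn, bary_pointOfFace]
    have : ∑ v ∈ s, c v • χ v = (1 - t) * a + t := by
      simp only [hc, smul_eq_mul, add_mul, Finset.sum_add_distrib, mul_assoc, hχ2]
      rw [← Finset.mul_sum, ← Finset.mul_sum, ← Finset.mul_sum, ha', inv_mul_cancel₀ hx.ne', mul_one]
    rw [this]
    rcases ht0.eq_or_lt with rfl | h0
    · simpa using hx
    · have : 0 ≤ 1 - t := by linarith
      positivity
  · intro v hv
    rw [pointOfFace_apply] at hv
    have hvs : v ∈ s := by
      by_contra hh
      simp [hh] at hv
    rw [if_pos hvs] at hv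
    refine ⟨(h1 v).1 hvs, fun ht => ?_⟩
    by_contra hvP
    simp [hc, ht, hχ, hvP] at hv

lemma projTo_eq_self {x : simplicialRealization D} (hx : ∀ v, x.1 v ≠ 0 → v ∈ P) :
    weightIn D P x = 1 ∧ projTo D P x = bary D id x := by
  obtain ⟨s, hs, h1, h2⟩ := exists_support_face x
  have hxs : ∀ v, x.1 v ≠ 0 → v ∈ s := fun v hv => (h1 v).2 hv
  have h3 : weightIn D P x = 1 := by
    rw [weightIn, bary_eq_sum _ x s hxs]
    refine Eq.trans ?_ h2
    exact Finset.sum_congr rfl fun v hv => by simp [hx v ((h1 v).1 hv)]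
  refine ⟨h3, ?_⟩
  rw [projTo, h3, inv_one, one_smul, bary_eq_sum _ x s hxs, bary_eq_sum _ x s hxs]
  exact Finset.sum_congr rfl fun v hv => by simp [hx v ((h1 v).1 hv)]

omit [NormedAddCommGroup E] [NormedSpace ℝ E] in
lemma continuous_weightIn (hD : LocFin D) : Continuous (weightIn D P) := continuous_bary hD _

lemma continuousAt_projTo (hD : LocFin D) {x : simplicialRealization D} (hx : 0 < weightIn D P x) :
    ContinuousAt (projTo D P) x :=
  ((continuous_weightIn hD).continuousAt.inv₀ hx.ne').smul (continuous_bary hD _).continuousAt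

/-- If `W` is triangulated so that `P` is a full subcomplex and the simplices shrink near `K`, then
the union of `K` and the open star of `P` deformation retracts onto `K ∪ P`. -/
lemma deformationRetractsOnto_star {W K Z : Set E} (hD : LocFin D)
    (hemb : IsEmbedding (bary D id)) (hrange : range (bary D id) = W) (hKZ : K ⊆ Z)
    (hZ : IsClosed Z) (hWZ : Disjoint W Z)
    (hPW : P ⊆ W)
    (htop : ∀ x : simplicialRealization D, ∃ w, x.1 w ≠ 0 ∧
      (w ∈ P → ∀ v, x.1 v ≠ 0 → v ∈ P) ∧ (bary D id x ∈ P ↔ w ∈ P))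
    (hclose : ∀ x : simplicialRealization D, ∀ v, x.1 v ≠ 0 → ∀ z ∈ K,
      dist (bary D id x) v ≤ dist (bary D id x) z) :
    DeformationRetractsOnto (K ∪ bary D id '' {x | 0 < weightIn D P x}) (K ∪ P) := by
  classical
  set b := bary D id with hb
  set N := b '' {x | 0 < weightIn D P x} with hN
  have hNW : N ⊆ W := by
    rintro _ ⟨x, -, rfl⟩
    exact hrange ▸ mem_range_self x
  have hPsupp : ∀ x, b x ∈ P → ∀ v, x.1 v ≠ 0 → v ∈ P := fun x hx => by
    obtain ⟨w, -, h1, h2⟩ := htop x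
    exact h1 (h2.1 hx)
  have hPN : P ⊆ N := by
    intro p hp
    obtain ⟨x, rfl⟩ : p ∈ range b := hrange.symm ▸ hPW hp
    refine ⟨x, ?_, rfl⟩
    rw [mem_ofPred_eq, (projTo_eq_self (hPsupp x hp)).1]
    exact one_pos
  have hKN : ∀ y ∈ K, y ∉ N := fun y hy hyN => hWZ.le_bot ⟨hNW hyN, hKZ hy⟩
  -- The retraction is the radial projection on `N` and the identity elsewhere, in particular on
  -- `K`.
  have hρ : ∀ y : E, ∃ y' : E, (∀ x, b x = y → 0 < weightIn D P x → y' = projTo D P x) ∧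
      (y ∉ N → y' = y) := by
    intro y
    by_cases hy : y ∈ N
    · obtain ⟨x, hx, rfl⟩ := hy
      exact ⟨projTo D P x, fun x' hx' _ => by rw [hemb.injective hx'], fun h => absurd ⟨x, hx, rfl⟩ h⟩
    · exact ⟨y, fun x hx hx0 => absurd ⟨x, hx0, hx⟩ hy, fun _ => rfl⟩
  choose ρ hρ1 hρ2 using hρ
  have hρb : ∀ x, 0 < weightIn D P x → ρ (b x) = projTo D P x := fun x hx => hρ1 _ x rfl hx
  have hρK : ∀ y ∈ K, ρ y = y := fun y hy => hρ2 y (hKN y hy)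
  have hρP : ∀ y ∈ P, ρ y = y := by
    intro y hy
    obtain ⟨x, hx, rfl⟩ := hPN hy
    rw [hρb x hx, (projTo_eq_self (hPsupp x hy)).2]
  have hρmem : ∀ y ∈ N, ρ y ∈ P := by
    rintro _ ⟨x, hx, rfl⟩
    obtain ⟨y, hy1, hy2, hy3⟩ := exists_point_segment_projTo x hx zero_le_one le_rfl
    rw [one_smul, add_sub_cancel] at hy1
    rw [hρb x hx, ← hy1]
    obtain ⟨w, hw, -, h2⟩ := htop y
    exact h2.2 ((hy3 w hw).2 rfl)
  have hseg : ∀ y ∈ K ∪ N, ∀ t : ℝ, 0 ≤ t → t ≤ 1 → y + t • (ρ y - y) ∈ K ∪ N := by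
    rintro y (hy | ⟨x, hx, rfl⟩) t ht0 ht1
    · rw [hρK y hy, sub_self, smul_zero, add_zero]; exact Or.inl hy
    · obtain ⟨y, hy1, hy2, -⟩ := exists_point_segment_projTo x hx ht0 ht1
      rw [hρb x hx, ← hy1]
      exact Or.inr ⟨y, hy2, rfl⟩
  -- The projection is a convex combination of vertices of the face of `y`, all of which are this
  -- close to `y` by `hclose`. The bound yields continuity at `K`.
  have hdist : ∀ y ∈ K ∪ N, ∀ z ∈ K, dist (ρ y) y ≤ dist y z := by
    rintro y (hy | ⟨x, hx, rfl⟩) z hz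
    · rw [hρK y hy, dist_self]; exact dist_nonneg
    · obtain ⟨y, hy1, hy2, hy3⟩ := exists_point_segment_projTo x hx zero_le_one le_rfl
      rw [one_smul, add_sub_cancel] at hy1
      rw [hρb x hx, ← hy1]
      obtain ⟨s, hs, h1, h2⟩ := exists_support_face y
      have h3 : bary D id y ∈ Metric.closedBall (b x) (dist (b x) z) := by
        rw [bary_eq_sum id y s fun v hv => (h1 v).2 hv]
        refine (convex_closedBall _ _).sum_mem (fun v _ => realization_nonneg y v) h2 fun v hv => ?_
        rw [Metric.mem_closedBall, dist_comm]
        exact hclose x v (hy3 v ((h1 v).1 hv)).1 z hz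
      exact h3
  have hcont : ContinuousOn ρ (K ∪ N) := by
    rintro y (hy | ⟨x, hx, rfl⟩)
    · refine tendsto_iff_dist_tendsto_zero.2 ?_
      have h0 : Filter.Tendsto (fun z => 2 * dist z y) (𝓝[K ∪ N] y) (𝓝 0) := by
        have : ContinuousAt (fun z => 2 * dist z y) y := by fun_prop
        have h1 := this.tendsto
        rw [dist_self, mul_zero] at h1
        exact h1.mono_left nhdsWithin_le_nhds
      refine squeeze_zero' (Filter.Eventually.of_forall fun _ => dist_nonneg) ?_ h0
      filter_upwards [self_mem_nhdsWithin] with z hz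
      rw [hρK y hy]
      linarith [dist_triangle (ρ z) z y, hdist z hz y hy]
    · have hxW : b x ∈ W := hNW ⟨x, hx, rfl⟩
      -- As `Z` is closed and contains `K`, near `b x` only points of `N` occur; continuity is then
      -- tested in `W` and pulled back along the embedding `b`.
      have h1 : 𝓝[K ∪ N] (b x) ≤ 𝓝[W] (b x) := by
        refine nhdsWithin_le_iff.2 ?_
        have h2 : Zᶜ ∈ 𝓝 (b x) := hZ.isOpen_compl.mem_nhds fun hh => hWZ.le_bot ⟨hxW, hh⟩
        filter_upwards [self_mem_nhdsWithin, mem_nhdsWithin_of_mem_nhds h2] with z hz hzZ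
        exact hz.elim (fun hh => absurd (hKZ hh) hzZ) fun hh => hNW hh
      refine Filter.Tendsto.mono_left ?_ h1
      rw [← hrange, ← hemb.map_nhds_eq, Filter.tendsto_map'_iff, hρb x hx]
      refine (continuousAt_projTo hD hx).tendsto.congr' ?_
      filter_upwards [(isOpen_lt continuous_const (continuous_weightIn hD)).mem_nhds hx] with z hz
      exact (hρb z hz).symm
  have hsub : K ∪ P ⊆ K ∪ N := union_subset_union_right K hPN
  have hρX : ∀ y ∈ K ∪ N, ρ y ∈ K ∪ P := fun y hy =>
    hy.elim (fun h => Or.inl ((hρK y h).symm ▸ h)) fun h => Or.inr (hρmem y h)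
  have hρX' : ∀ y ∈ K ∪ P, ρ y = y := fun y hy => hy.elim (hρK y) (hρP y)
  have hρc : Continuous fun y : ↥(K ∪ N) => ρ y := continuousOn_iff_continuous_domRestrict.1 hcont
  refine ⟨hsub, ⟨fun y => ⟨ρ y, hsub (hρX y y.2)⟩, hρc.subtype_mk _⟩, fun y => hρX y y.2, ⟨?_⟩⟩
  refine
    { toFun := fun q => ⟨q.2 + (q.1 : ℝ) • (ρ q.2 - q.2), hseg q.2 q.2.2 q.1 q.1.2.1 q.1.2.2⟩
      continuous_toFun := ?_
      map_zero_left := fun y => Subtype.ext (by simp)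
      map_one_left := fun y => Subtype.ext (by simp)
      prop' := fun t y hy => Subtype.ext ?_ }
  · refine Continuous.subtype_mk ?_ _
    have h1 : Continuous fun q : unitInterval × ↥(K ∪ N) => ρ q.2 := hρc.comp continuous_snd
    have h2 : Continuous fun q : unitInterval × ↥(K ∪ N) => (q.2 : E) := by fun_prop
    have h3 : Continuous fun q : unitInterval × ↥(K ∪ N) => (q.1 : ℝ) := by fun_prop
    exact h2.add (h3.smul (h1.sub h2))
  · have : ρ y = y := hρX' y hy
    simp [this]

end Deformation

/-! ### The coronated neighborhood of part (b) -/

section PartB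

theorem exists_coronated_deformation_neighborhood {m : ℕ}
    {Q K P : Set (EuclideanSpace ℝ (Fin m))} (hQ : IsCompact Q) (hQa : IsAffinePolyhedron Q)
    (hKQ : K ⊆ Q) (hPQ : P ⊆ Q) (hKP : Disjoint K P) (hK : IsCompact K)
    (hPa : IsAffinePolyhedron P) (hPl : LocallyCompactSpace P) :
    ∃ Y : Set (EuclideanSpace ℝ (Fin m)), Y ⊆ Q ∧ IsCoronatedPolyhedron Y ∧
      DeformationRetractsOnto Y (K ∪ P) ∧
      LocallyCompactSpace (Q \ Y : Set (EuclideanSpace ℝ (Fin m))) := by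
  classical
  have hQl : LocallyCompactSpace Q := by
    have := isCompact_iff_compactSpace.1 hQ
    infer_instance
  obtain ⟨S₁, hS₁c, hS₁i, hS₁, hS₁l⟩ := hQa.exists_simplices hQl
  obtain ⟨S₂, hS₂c, hS₂i, hS₂, hS₂l⟩ := hPa.exists_simplices hPl
  -- Removing the frontier points of `P` as well makes `P` closed in `W`, so the simplexes of `P`
  -- are locally finite at every point of `W`.
  set Z := K ∪ (closure P \ P) with hZdef
  have hZ : IsClosed Z := hK.isClosed.union (isClosed_closure_diff_of_locallyCompactSpace hPl)
  set W := Q \ Z with hWdef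
  have hWZ : Disjoint W Z := disjoint_sdiff_left
  have hPW : P ⊆ W := fun p hp => ⟨hPQ hp, fun h => h.elim
    (fun h => hKP.le_bot ⟨h, hp⟩) fun h => h.2 hp⟩
  have hlf₁ : ∀ p ∈ W, ∃ U ∈ 𝓝 p, {s ∈ S₁ | (convexHull ℝ (s : Set (EuclideanSpace ℝ (Fin m))) ∩
      U).Nonempty}.Finite := fun p hp => hS₁l p hp.1
  have hlf : ∀ p ∈ W, ∃ U ∈ 𝓝 p, {s ∈ S₁ ∪ S₂ | (convexHull ℝ (s : Set (EuclideanSpace ℝ (Fin m))) ∩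
      U).Nonempty}.Finite := by
    intro p hp
    obtain ⟨U₁, hU₁, hf₁⟩ := hlf₁ p hp
    have h2 : ∃ U ∈ 𝓝 p, {s ∈ S₂ | (convexHull ℝ (s : Set (EuclideanSpace ℝ (Fin m))) ∩
        U).Nonempty}.Finite := by
      by_cases hpP : p ∈ P
      · exact hS₂l p hpP
      · have hpc : p ∉ closure P := fun h => hp.2 (Or.inr ⟨h, hpP⟩)
        refine ⟨(closure P)ᶜ, isClosed_closure.isOpen_compl.mem_nhds hpc, ?_⟩
        convert! finite_empty
        ext s
        simp only [mem_ofPred_eq, mem_empty_iff_false, iff_false, not_and]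
        rintro hs ⟨z, hz, hzc⟩
        exact hzc (subset_closure (hS₂ ▸ mem_iUnion₂.2 ⟨s, hs, hz⟩))
    obtain ⟨U₂, hU₂, hf₂⟩ := h2
    refine ⟨U₁ ∩ U₂, Filter.inter_mem hU₁ hU₂, (hf₁.union hf₂).subset ?_⟩
    rintro s ⟨hs | hs, hne⟩
    · exact Or.inl ⟨hs, hne.mono (inter_subset_inter_right _ inter_subset_left)⟩
    · exact Or.inr ⟨hs, hne.mono (inter_subset_inter_right _ inter_subset_right)⟩
  obtain ⟨D, hD, hemb, hrange, htop⟩ := exists_adapted_triangulation hQ (W := W) (S := S₁ ∪ S₂)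
    (S' := S₁) (hS₁c.union hS₂c) (fun s hs => hs.elim (hS₁i s) (hS₂i s)) subset_union_left hS₁ hlf
    -- Simplexes must be no larger than their distance from `Z`. Balls of radius `ε / 3` qualify:
    -- two points are less than `2ε/3` apart, and each is more than `2ε/3` away from `Z`.
    (fun A => A ⊆ W ∧ ∀ a ∈ A, ∀ b ∈ A, ∀ z ∈ Z, dist a b ≤ dist a z)
    (fun hAB hB => ⟨hAB.trans hB.1, fun a ha b hb => hB.2 a (hAB ha) b (hAB hb)⟩)
    sdiff_subset (by
      intro p hp
      obtain ⟨ε, hε, hball⟩ := Metric.mem_nhds_iff.1 (hZ.isOpen_compl.mem_nhds hp.2)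
      refine ⟨Metric.ball p (ε / 3), Metric.ball_mem_nhds p (by positivity), ?_, ?_⟩
      · exact fun x hx => ⟨hx.2, hball (Metric.ball_subset_ball (by linarith) hx.1)⟩
      · rintro a ⟨ha, -⟩ b ⟨hb, -⟩ z hz
        have h1 : ε ≤ dist z p := not_lt.1 fun hlt => hball hlt hz
        rw [Metric.mem_ball] at ha hb
        linarith [dist_triangle_right a b p, dist_triangle_left z p a])
    fun A hA => hA.1
  set N := bary D id '' {x | 0 < weightIn D P x} with hN
  have hNW : N ⊆ W := by
    rintro _ ⟨x, -, rfl⟩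
    exact hrange ▸ mem_range_self x
  obtain ⟨O, hO, hNO⟩ : ∃ O, IsOpen O ∧ N = Q ∩ O := by
    obtain ⟨O, hO, hO'⟩ := hemb.isInducing.isOpen_iff.1
      (isOpen_lt continuous_const (continuous_weightIn hD (P := P)))
    refine ⟨O ∩ Zᶜ, hO.inter hZ.isOpen_compl, ?_⟩
    rw [hN, ← hO', image_preimage_eq_inter_range, hrange, hWdef]
    ext; simp only [mem_inter_iff, mem_sdiff, mem_compl_iff]; tauto
  have hKN : Disjoint K N := by
    rw [disjoint_left]
    exact fun y hy hyN => (hNW hyN).2 (Or.inl hy)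
  refine ⟨K ∪ N, union_subset hKQ (hNW.trans sdiff_subset), ⟨inferInstance, ?_⟩, ?_, ?_⟩
  -- An open star need not be a subcomplex of `D`, so it is triangulated afresh, as an open subset
  -- of `Q`.
  · obtain ⟨D', hD', hemb', hrange', -⟩ := exists_adapted_triangulation hQ (W := N) (S := S₁)
      (S' := S₁) hS₁c hS₁i subset_rfl hS₁ (fun p hp => hlf₁ p (hNW hp)) (fun A => A ⊆ N)
      (fun hAB hB => hAB.trans hB) (hNW.trans sdiff_subset)
      (fun p hp => ⟨O, hO.mem_nhds (hNO ▸ hp : p ∈ Q ∩ O).2, by rw [hNO, inter_comm]⟩)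
      fun A hA => hA
    refine ⟨Subtype.val ⁻¹' K, ?_, ?_⟩
    · rw [IsInducing.subtypeVal.isCompact_iff, Subtype.image_preimage_coe,
        inter_eq_right.2 subset_union_left]
      exact hK
    · refine isPolyhedron_of_isEmbedding (IsEmbedding.subtypeVal.comp IsEmbedding.subtypeVal)
        hemb' ?_
      rw [hrange']
      ext y
      constructor
      · rintro ⟨⟨⟨y, hy⟩, hyK⟩, rfl⟩
        exact hy.resolve_left hyK
      · exact fun hy => ⟨⟨⟨y, Or.inr hy⟩, fun hyK => hKN.le_bot ⟨hyK, hy⟩⟩, rfl⟩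
  · refine deformationRetractsOnto_star hD hemb hrange (K := K) (Z := Z) subset_union_left hZ hWZ hPW
      (fun x => ?_) fun x v hv z hz => ?_
    · obtain ⟨A, -, -, -, w, hw, hws⟩ := htop x
      refine ⟨w, hw, fun hwP v hv => ?_, fun hxP => ?_, fun hwP => ?_⟩
      · rw [hS₂] at hwP ⊢
        obtain ⟨s, hs, hws'⟩ := mem_iUnion₂.1 hwP
        exact mem_iUnion₂.2 ⟨s, hs, (hws s (Or.inr hs)).1 hws' v hv⟩
      · rw [hS₂] at hxP ⊢
        obtain ⟨s, hs, hxs⟩ := mem_iUnion₂.1 hxP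
        exact mem_iUnion₂.2 ⟨s, hs, (hws s (Or.inr hs)).2.1 hxs⟩
      · rw [hS₂] at hwP ⊢
        obtain ⟨s, hs, hxs⟩ := mem_iUnion₂.1 hwP
        exact mem_iUnion₂.2 ⟨s, hs, (hws s (Or.inr hs)).2.2 hxs⟩
    · obtain ⟨A, hA, hxA, hvA, -⟩ := htop x
      exact hA.2 _ hxA v (hvA v hv) z (Or.inl hz)
  · have : Q \ (K ∪ N) = Q ∩ (Kᶜ ∩ Oᶜ) := by
      rw [hNO]
      ext y; simp only [mem_sdiff, mem_union, mem_inter_iff, mem_compl_iff]; tauto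
    rw [this]
    exact (hQ.isClosed.isLocallyClosed.inter (hK.isClosed.isOpen_compl.isLocallyClosed.inter
      hO.isClosed_compl.isLocallyClosed)).locallyCompactSpace

end PartB

/-! ### Cochains mod 2, barycentric subdivision and labels -/

section Sperner

variable {X : Type*}

/-- The dual of barycentric subdivision, as an operator on cochains with values in `ZMod 2`;
`b` is the choice of barycenters. -/
def subdivide (b : ∀ n, (Fin n → X) → X) :
    ∀ n, ((Fin n → X) → ZMod 2) → (Fin n → X) → ZMod 2
  | 0, F, σ => F σ
  | n + 1, F, σ => ∑ i : Fin (n + 1),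
      subdivide b n (fun τ => F (Fin.cons (b (n + 1) σ) τ)) fun j => σ (i.succAbove j)

/-- The coboundary operator of augmented cochains with values in `ZMod 2`. -/
def coboundary {n : ℕ} (G : (Fin n → X) → ZMod 2) (σ : Fin (n + 1) → X) : ZMod 2 :=
  ∑ i : Fin (n + 1), G fun j => σ (i.succAbove j)

variable (b : ∀ n, (Fin n → X) → X)

lemma subdivide_add (n : ℕ) : ∀ (F G : (Fin n → X) → ZMod 2) (σ : Fin n → X),
    subdivide b n (F + G) σ = subdivide b n F σ + subdivide b n G σ := by
  induction n with
  | zero => intro F G σ; rfl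
  | succ n ih =>
    intro F G σ
    simp only [subdivide]
    rw [← Finset.sum_add_distrib]
    exact Finset.sum_congr rfl fun i _ => ih _ _ _

/-- Each pair of vertices is deleted in two orders, and the two terms cancel mod 2. -/
lemma sum_coboundary_eq_zero {n : ℕ} (A : (Fin n → X) → ZMod 2) (σ : Fin (n + 2) → X) :
    ∑ i : Fin (n + 2), coboundary A (fun j => σ (i.succAbove j)) = 0 := by
  simp only [coboundary]
  rw [Finset.sum_sigma']
  refine Finset.sum_involution
    (fun p _ => (⟨p.1.succAbove p.2, p.2.predAbove p.1⟩ : (_ : Fin (n + 2)) × Fin (n + 1)))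
    ?_ ?_ ?_ ?_
  · rintro ⟨i, j⟩ _
    simp only [Fin.succAbove_succAbove_succAbove_predAbove]
    exact CharTwo.add_self_eq_zero _
  · rintro ⟨i, j⟩ _ _ h
    exact Fin.succAbove_ne i j (congrArg Sigma.fst h)
  · simp
  · rintro ⟨i, j⟩ _
    simp only [Fin.succAbove_succAbove_predAbove, Fin.predAbove_predAbove_succAbove]

lemma coboundary_cons {n : ℕ} (G : (Fin (n + 1) → X) → ZMod 2) (a : X) (τ : Fin (n + 1) → X) :
    coboundary G (Fin.cons a τ) = G τ + coboundary (fun τ' => G (Fin.cons a τ')) τ := by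
  rw [coboundary, Fin.sum_univ_succ]
  congr 1
  refine Finset.sum_congr rfl fun i _ => congrArg G (funext fun j => ?_)
  refine Fin.cases ?_ (fun k => ?_) j
  · simp
  · simp

/-- Subdivision is a chain map. By the cone formula `coboundary_cons` and induction, faces opposite
the barycenter give the right side, while faces through it form a double coboundary and cancel. -/
lemma subdivide_coboundary (n : ℕ) : ∀ (G : (Fin n → X) → ZMod 2) (σ : Fin (n + 1) → X),
    subdivide b (n + 1) (coboundary G) σ = coboundary (subdivide b n G) σ := by
  induction n with
  | zero =>
    intro G σ
    change ∑ i : Fin 1, ∑ j : Fin 1, G _ = ∑ i : Fin 1, G _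
    rw [Fin.sum_univ_one, Fin.sum_univ_one, Fin.sum_univ_one]
    exact congrArg G (Subsingleton.elim _ _)
  | succ n ih =>
    intro G σ
    rw [subdivide]
    have h1 : ∀ i : Fin (n + 2), subdivide b (n + 1)
        (fun τ => coboundary G (Fin.cons (b (n + 1 + 1) σ) τ)) (fun j => σ (i.succAbove j)) =
        subdivide b (n + 1) G (fun j => σ (i.succAbove j)) +
        coboundary (subdivide b n fun τ' => G (Fin.cons (b (n + 1 + 1) σ) τ'))
          fun j => σ (i.succAbove j) := by
      intro i
      rw [← ih, ← subdivide_add]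
      congr 1
      funext τ
      exact coboundary_cons _ _ _
    rw [Finset.sum_congr rfl fun i _ => h1 i, Finset.sum_add_distrib, sum_coboundary_eq_zero,
      add_zero]
    rfl

lemma iterate_subdivide_coboundary (n m : ℕ) (G : (Fin n → X) → ZMod 2) :
    (subdivide b (n + 1))^[m] (coboundary G) = coboundary ((subdivide b n)^[m] G) := by
  induction m with
  | zero => rfl
  | succ m ih =>
    rw [Function.iterate_succ_apply', Function.iterate_succ_apply', ih]
    exact funext fun σ => subdivide_coboundary b n _ σ

lemma iterate_subdivide_add (n m : ℕ) (F G : (Fin n → X) → ZMod 2) :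
    (subdivide b n)^[m] (F + G) = (subdivide b n)^[m] F + (subdivide b n)^[m] G := by
  induction m with
  | zero => rfl
  | succ m ih =>
    simp only [Function.iterate_succ_apply', ih]
    exact funext fun σ => subdivide_add b n _ _ σ

variable (l : X → ℕ)

/-- The cochain that detects tuples whose labels are `0, …, n - 1` in some order. -/
def fullyLabelled (n : ℕ) (τ : Fin n → X) : ZMod 2 :=
  Matrix.det (Matrix.of fun i k : Fin n => if l (τ i) = k then (1 : ZMod 2) else 0)

lemma exists_label_of_fullyLabelled_ne_zero {n : ℕ} {τ : Fin n → X} (h : fullyLabelled l n τ ≠ 0)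
    {k : ℕ} (hk : k < n) : ∃ i, l (τ i) = k := by
  by_contra hne
  push Not at hne
  exact h (Matrix.det_eq_zero_of_column_eq_zero ⟨k, hk⟩ fun i => by simp [hne i])

/-- This is the parity step of Sperner's lemma. Every row of the matrix has exactly one entry `1`,
so adding all columns to the last one makes it constantly `1`; expanding along it mod 2 gives the
sum of the minors. -/
lemma fullyLabelled_eq_coboundary {n : ℕ} {τ : Fin (n + 1) → X} (h : ∀ i, l (τ i) < n + 1) :
    fullyLabelled l (n + 1) τ = coboundary (fullyLabelled l n) τ := by
  set A : Matrix (Fin (n + 1)) (Fin (n + 1)) (ZMod 2) :=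
    Matrix.of fun i k => if l (τ i) = k then (1 : ZMod 2) else 0 with hA
  have h1 := Matrix.det_updateCol_sum A (Fin.last n) (fun _ => 1)
  rw [one_smul] at h1
  change A.det = _
  rw [← h1, Matrix.det_succ_column _ (Fin.last n), coboundary]
  refine Finset.sum_congr rfl fun i _ => ?_
  have h2 : ∀ k : ℕ, (-1 : ZMod 2) ^ k = 1 := fun k => by
    rw [CharTwo.neg_eq, one_pow]
  have h3 : ∑ k, (1 : ZMod 2) • A i k = 1 := by
    rw [Finset.sum_eq_single ⟨l (τ i), h i⟩]
    · simp [hA]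
    · intro k _ hk
      have : l (τ i) ≠ k := fun hh => hk (Fin.ext hh.symm)
      simp [hA, this]
    · simp
  rw [h2, one_mul, Matrix.updateCol_self, h3, one_mul, fullyLabelled]
  congr 1
  ext a c
  simp [hA, Fin.succAbove_last, (Fin.castSucc_lt_last c).ne]

end Sperner

/-! ### Mesh of iterated subdivisions; Sperner and KKM lemmas -/

section SubdivisionMesh

variable {E : Type*} [NormedAddCommGroup E] [NormedSpace ℝ E]

/-- The barycenter of a tuple of points. -/
noncomputable def barycenter (n : ℕ) (σ : Fin n → E) : E := (n : ℝ)⁻¹ • ∑ i, σ i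

lemma barycenter_mem (n : ℕ) (σ : Fin (n + 1) → E) :
    barycenter (n + 1) σ ∈ convexHull ℝ (range σ) := by
  rw [barycenter, Finset.smul_sum]
  refine (convex_convexHull ℝ _).sum_mem (fun _ _ => by positivity) ?_
    fun i _ => subset_convexHull ℝ _ (mem_range_self i)
  simp
  field_simp

/-- The difference of a vertex and the barycenter averages `n + 1` differences, one of them zero.
This gives the factor `n / (n + 1)`, weakened to the ratio used for tuples of length `n + 1` below.
-/
lemma dist_barycenter_le {n : ℕ} {σ : Fin (n + 1) → E} {R : ℝ}
    (hR : ∀ i j, dist (σ i) (σ j) ≤ R) {y : E} (hy : y ∈ convexHull ℝ (range σ)) :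
    dist y (barycenter (n + 1) σ) ≤ (n + 1) / (n + 2) * R := by
  have hR0 : 0 ≤ R := dist_nonneg.trans (hR 0 0)
  have hsub : range σ ⊆ Metric.closedBall (barycenter (n + 1) σ) ((n + 1) / (n + 2) * R) := by
    rintro _ ⟨i, rfl⟩
    rw [Metric.mem_closedBall, dist_eq_norm]
    have h1 : σ i - barycenter (n + 1) σ = ((n : ℝ) + 1)⁻¹ • ∑ j, (σ i - σ j) := by
      rw [barycenter, Finset.sum_sub_distrib, smul_sub, Finset.sum_const, Finset.card_univ,
        Fintype.card_fin, ← Nat.cast_smul_eq_nsmul ℝ, smul_smul]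
      push_cast
      rw [inv_mul_cancel₀ (by positivity), one_smul]
    have h2 : ‖∑ j, (σ i - σ j)‖ ≤ n * R := by
      rw [Fin.sum_univ_succAbove _ i, sub_self, zero_add]
      refine (norm_sum_le _ _).trans ?_
      refine (Finset.sum_le_sum fun j _ => (dist_eq_norm (σ i) (σ (i.succAbove j)) ▸
        hR i (i.succAbove j))).trans ?_
      simp
    rw [h1, norm_smul, Real.norm_of_nonneg (by positivity)]
    calc ((n : ℝ) + 1)⁻¹ * ‖∑ j, (σ i - σ j)‖ ≤ ((n : ℝ) + 1)⁻¹ * (n * R) := by gcongr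
      _ = (n / (n + 1)) * R := by ring
      _ ≤ _ := by
        refine mul_le_mul_of_nonneg_right ?_ hR0
        rw [div_le_div_iff₀ (by positivity) (by positivity)]
        nlinarith
  exact convexHull_min hsub (convex_closedBall _ _) hy

/-- A nonzero sum has a nonzero term, so the value is witnessed by an actual simplex of the
subdivision: a barycenter joined to a small simplex in a face. -/
lemma exists_small_of_subdivide_ne_zero (n : ℕ) : ∀ {F : (Fin n → E) → ZMod 2} {σ : Fin n → E}
    {R : ℝ}, subdivide barycenter n F σ ≠ 0 → (∀ i j, dist (σ i) (σ j) ≤ R) →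
    ∃ τ, F τ ≠ 0 ∧ (∀ i, τ i ∈ convexHull ℝ (range σ)) ∧
      ∀ i j, dist (τ i) (τ j) ≤ n / (n + 1) * R := by
  induction n with
  | zero => exact fun {F σ R} h _ => ⟨σ, h, fun i => i.elim0, fun i => i.elim0⟩
  | succ n ih =>
    intro F σ R h hR
    rw [subdivide] at h
    obtain ⟨i, -, hi⟩ := Finset.exists_ne_zero_of_sum_ne_zero h
    obtain ⟨τ, hτ1, hτ2, hτ3⟩ := ih hi fun a c => hR _ _
    have hR0 : 0 ≤ R := dist_nonneg.trans (hR 0 0)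
    have hτ4 : ∀ j, τ j ∈ convexHull ℝ (range σ) := fun j =>
      convexHull_mono (by rintro _ ⟨a, rfl⟩; exact mem_range_self _) (hτ2 j)
    have hle : (n : ℝ) / (n + 1) * R ≤ (n + 1) / (n + 2) * R := by
      refine mul_le_mul_of_nonneg_right ?_ hR0
      rw [div_le_div_iff₀ (by positivity) (by positivity)]
      nlinarith
    have h2 : ((n + 1 : ℕ) : ℝ) / ((n + 1 : ℕ) + 1) = (n + 1) / (n + 2) := by push_cast; ring
    refine ⟨_, hτ1, fun j => ?_, fun j k => ?_⟩
    · refine Fin.cases ?_ (fun k => ?_) j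
      · exact barycenter_mem n σ
      · exact hτ4 k
    · rw [h2]
      refine Fin.cases ?_ (fun j => ?_) j <;> refine Fin.cases ?_ (fun k => ?_) k
      · simp only [Fin.cons_zero, dist_self]; positivity
      · simp only [Fin.cons_zero, Fin.cons_succ]
        rw [dist_comm]
        exact dist_barycenter_le hR (hτ4 k)
      · exact dist_barycenter_le hR (hτ4 j)
      · exact (hτ3 j k).trans hle

lemma exists_small_of_iterate_subdivide_ne_zero (n m : ℕ) {F : (Fin n → E) → ZMod 2}
    {σ : Fin n → E} {R : ℝ} (h : (subdivide barycenter n)^[m] F σ ≠ 0)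
    (hR : ∀ i j, dist (σ i) (σ j) ≤ R) :
    ∃ τ, F τ ≠ 0 ∧ (∀ i, τ i ∈ convexHull ℝ (range σ)) ∧
      ∀ i j, dist (τ i) (τ j) ≤ (n / (n + 1)) ^ m * R := by
  induction m generalizing σ R with
  | zero =>
    exact ⟨σ, h, fun i => subset_convexHull ℝ _ (mem_range_self i), by simpa using hR⟩
  | succ m ih =>
    rw [Function.iterate_succ_apply'] at h
    obtain ⟨τ, h1, h2, h3⟩ := exists_small_of_subdivide_ne_zero n h hR
    obtain ⟨τ', h4, h5, h6⟩ := ih h1 h3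
    refine ⟨τ', h4, fun i => ?_, fun i j => (h6 i j).trans_eq (by ring)⟩
    exact convexHull_min (by rintro _ ⟨j, rfl⟩; exact h2 j) (convex_convexHull ℝ _) (h5 i)

/-- In characteristic 2 a discrepancy is a nonzero value of the subdivided `F + G`, which some tuple
in the hull of `σ` would witness. -/
lemma iterate_subdivide_congr {n m : ℕ} {F G : (Fin n → E) → ZMod 2} {σ : Fin n → E}
    (h : ∀ τ, (∀ i, τ i ∈ convexHull ℝ (range σ)) → F τ = G τ) :
    (subdivide barycenter n)^[m] F σ = (subdivide barycenter n)^[m] G σ := by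
  by_contra hne
  obtain ⟨R, hR⟩ := (finite_range fun p : Fin n × Fin n => dist (σ p.1) (σ p.2)).bddAbove
  have h1 : (subdivide barycenter n)^[m] (F + G) σ ≠ 0 := by
    rw [iterate_subdivide_add, Pi.add_apply, Ne, CharTwo.add_eq_zero]
    exact hne
  obtain ⟨τ, h2, h3, -⟩ := exists_small_of_iterate_subdivide_ne_zero n m h1
    fun i j => hR (mem_range_self (i, j))
  rw [Pi.add_apply, Ne, CharTwo.add_eq_zero] at h2
  exact h2 (h τ h3)

/-- **Sperner's lemma** for iterated barycentric subdivisions. -/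
lemma iterate_subdivide_fullyLabelled (l : E → ℕ) (v : ℕ → E) (d m : ℕ)
    (hl : ∀ s : Set ℕ, s ⊆ Iio d → ∀ x ∈ convexHull ℝ (v '' s), l x ∈ s) (n : ℕ) (hn : n ≤ d) :
    (subdivide barycenter n)^[m] (fullyLabelled l n) (fun i : Fin n => v i) = 1 := by
  induction n with
  | zero =>
    have : ∀ m, (subdivide (X := E) barycenter 0)^[m] = id := fun m =>
      Function.iterate_id m
    rw [this]
    simp [fullyLabelled]
  | succ n ih =>
    have hlab : ∀ τ : Fin (n + 1) → E,
        (∀ i, τ i ∈ convexHull ℝ (range fun i : Fin (n + 1) => v i)) → ∀ i, l (τ i) < n + 1 := by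
      intro τ hτ i
      refine hl (Iio (n + 1)) (fun k hk => lt_of_lt_of_le hk hn) _ (convexHull_mono ?_ (hτ i))
      rintro _ ⟨j, rfl⟩
      exact mem_image_of_mem v j.2
    -- Of the faces in the coboundary, the last contributes `1` by induction; the face opposite a
    -- vertex `i < n` has no point labelled `i` and contributes `0`.
    rw [iterate_subdivide_congr (fun τ hτ => fullyLabelled_eq_coboundary l (hlab τ hτ)),
      iterate_subdivide_coboundary, coboundary, Fin.sum_univ_castSucc, Finset.sum_eq_zero, zero_add]
    · rw [← ih (by omega)]
      refine congrArg _ (funext fun j => ?_)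
      simp [Fin.succAbove_last]
    · intro i _
      by_contra hne
      obtain ⟨R, hR⟩ := (finite_range fun p : Fin n × Fin n =>
        dist (v (i.castSucc.succAbove p.1)) (v (i.castSucc.succAbove p.2))).bddAbove
      obtain ⟨τ, h1, h2, -⟩ := exists_small_of_iterate_subdivide_ne_zero n m hne
        fun a c => hR (mem_range_self (a, c))
      obtain ⟨j, hj⟩ := exists_label_of_fullyLabelled_ne_zero l h1 i.2
      have h3 := hl (Iio (n + 1) \ {(i : ℕ)}) (fun k hk => lt_of_lt_of_le hk.1 hn) (τ j)
        (convexHull_mono ?_ (h2 j))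
      · exact h3.2 hj
      · rintro _ ⟨a, rfl⟩
        refine mem_image_of_mem v ⟨(i.castSucc.succAbove a).2, fun h4 => ?_⟩
        exact Fin.succAbove_ne i.castSucc a (Fin.ext h4)

/-- The **Knaster–Kuratowski–Mazurkiewicz lemma**. -/
theorem exists_mem_of_isClosed_cover_simplex (v : ℕ → E) (d : ℕ) (F : Fin (d + 1) → Set E)
    (hF : ∀ k, IsClosed (F k)) (hcov : convexHull ℝ (v '' Iio (d + 1)) ⊆ ⋃ k, F k)
    (hKKM : ∀ s : Set ℕ, s ⊆ Iio (d + 1) → ∀ x ∈ convexHull ℝ (v '' s), ∀ k, x ∈ F k → (k : ℕ) ∈ s) :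
    ∃ x ∈ convexHull ℝ (v '' Iio (d + 1)), ∀ k, x ∈ F k := by
  classical
  set Δ := convexHull ℝ (v '' Iio (d + 1)) with hΔ
  have hΔc : IsCompact Δ := ((finite_Iio (d + 1)).image v).isCompact_convexHull ℝ
  have hlab : ∀ x, ∃ k : ℕ, x ∈ Δ → ∃ hk : k < d + 1, x ∈ F ⟨k, hk⟩ := by
    intro x
    by_cases hx : x ∈ Δ
    · obtain ⟨k, hk⟩ := mem_iUnion.1 (hcov hx)
      exact ⟨k, fun _ => ⟨k.2, hk⟩⟩
    · exact ⟨0, fun h => absurd h hx⟩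
  choose l hl using hlab
  have hl' : ∀ s : Set ℕ, s ⊆ Iio (d + 1) → ∀ x ∈ convexHull ℝ (v '' s), l x ∈ s := by
    intro s hs x hx
    obtain ⟨hk, hxk⟩ := hl x (convexHull_mono (image_mono hs) hx)
    exact hKKM s hs x hx _ hxk
  obtain ⟨R, hR⟩ := (finite_range fun p : Fin (d + 1) × Fin (d + 1) =>
    dist (v p.1) (v p.2)).bddAbove
  have hsmall : ∀ m : ℕ, ∃ x ∈ Δ, ∀ k, Metric.infDist x (F k ∩ Δ) ≤
      ((d + 1 : ℕ) / ((d + 1 : ℕ) + 1) : ℝ) ^ m * R ∧ (F k ∩ Δ).Nonempty := by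
    intro m
    have h1 : (subdivide barycenter (d + 1))^[m] (fullyLabelled l (d + 1))
        (fun i : Fin (d + 1) => v i) ≠ 0 := by
      rw [iterate_subdivide_fullyLabelled l v (d + 1) m hl' (d + 1) le_rfl]
      exact one_ne_zero
    obtain ⟨τ, h2, h3, h4⟩ := exists_small_of_iterate_subdivide_ne_zero (d + 1) m h1
      fun i j => hR (mem_range_self (i, j))
    have h5 : ∀ i, τ i ∈ Δ := fun i => convexHull_mono (by
      rintro _ ⟨j, rfl⟩; exact mem_image_of_mem v j.2) (h3 i)
    refine ⟨τ 0, h5 0, fun k => ?_⟩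
    obtain ⟨i, hi⟩ := exists_label_of_fullyLabelled_ne_zero l h2 k.2
    obtain ⟨hk, hk'⟩ := hl (τ i) (h5 i)
    have h6 : τ i ∈ F k ∩ Δ := ⟨by simpa only [hi] using hk', h5 i⟩
    exact ⟨(Metric.infDist_le_dist_of_mem h6).trans (h4 0 i), _, h6⟩
  -- Small fully labelled simplexes make this continuous function arbitrarily small on the compact
  -- `Δ`, so its minimum is zero.
  have hcont : Continuous fun x => ∑ k, Metric.infDist x (F k ∩ Δ) :=
    continuous_finsetSum _ fun k _ => Metric.continuous_infDist_pt _
  obtain ⟨x₀, hx₀, -⟩ := hsmall 0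
  obtain ⟨x, hx, hmin⟩ := hΔc.exists_isMinOn ⟨x₀, hx₀⟩ hcont.continuousOn
  refine ⟨x, hx, fun k => ?_⟩
  have hlim : Filter.Tendsto (fun m : ℕ => ∑ _k : Fin (d + 1),
      ((d + 1 : ℕ) / ((d + 1 : ℕ) + 1) : ℝ) ^ m * R) Filter.atTop (𝓝 0) := by
    have h1 : Filter.Tendsto (fun m : ℕ => ((d + 1 : ℕ) / ((d + 1 : ℕ) + 1) : ℝ) ^ m * R)
        Filter.atTop (𝓝 (0 * R)) := by
      refine (tendsto_pow_atTop_nhds_zero_of_lt_one (by positivity) ?_).mul_const R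
      rw [div_lt_one (by positivity)]; linarith
    rw [zero_mul] at h1
    simpa using tendsto_finsetSum (Finset.univ : Finset (Fin (d + 1))) fun _ _ => h1
  have hle : ∑ k, Metric.infDist x (F k ∩ Δ) ≤ 0 := by
    refine ge_of_tendsto' hlim fun m => ?_
    obtain ⟨y, hy, hyk⟩ := hsmall m
    exact (hmin hy).trans (Finset.sum_le_sum fun k _ => (hyk k).1)
  have hk0 : Metric.infDist x (F k ∩ Δ) = 0 := by
    refine le_antisymm ((Finset.single_le_sum (f := fun k => Metric.infDist x (F k ∩ Δ))
      (fun _ _ => Metric.infDist_nonneg) (Finset.mem_univ k)).trans hle) Metric.infDist_nonneg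
  exact (((hF k).inter hΔc.isClosed).mem_iff_infDist_zero ((hsmall 0).choose_spec.2 k).2).2 hk0 |>.1

end SubdivisionMesh

/-! ### Lebesgue's covering theorem -/

section CoveringDimension

/-- Each member of the refinement is assigned to one `O i` containing it, and members with the same
index are united; distinct indices at `x` come from distinct members, so the order does not grow. -/
lemma CoveringDimLE.exists_indexed {X : Type u} [TopologicalSpace X] {n : ℕ}
    (h : CoveringDimLE X n) {ι : Type*} [Finite ι] {O : ι → Set X} (hO : ∀ i, IsOpen (O i))
    (hcov : ⋃ i, O i = univ) :
    ∃ V : ι → Set X, (∀ i, IsOpen (V i)) ∧ (∀ i, V i ⊆ O i) ∧ ⋃ i, V i = univ ∧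
      ∀ x, ∀ s : Finset ι, (∀ i ∈ s, x ∈ V i) → s.card ≤ n + 1 := by
  obtain ⟨𝒱, ho, hc, hr, hn⟩ := h (range O) (finite_range O)
    (by rintro _ ⟨i, rfl⟩; exact hO i) (by rw [sUnion_range, hcov])
  have hex : ∀ W : 𝒱, ∃ i, W.1 ⊆ O i := fun W => by
    obtain ⟨_, ⟨i, rfl⟩, h⟩ := hr W W.2; exact ⟨i, h⟩
  choose c hcW using hex
  refine ⟨fun i => ⋃ W : {W : 𝒱 // c W = i}, W.1.1,
    fun i => isOpen_iUnion fun W => ho _ W.1.2, ?_, ?_, ?_⟩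
  · intro i
    refine iUnion_subset ?_
    rintro ⟨W, rfl⟩
    exact hcW W
  · refine eq_univ_of_forall fun x => ?_
    obtain ⟨W, hW, hx⟩ := mem_sUnion.1 (hc ▸ mem_univ x)
    exact mem_iUnion.2 ⟨c ⟨W, hW⟩, mem_iUnion.2 ⟨⟨⟨W, hW⟩, rfl⟩, hx⟩⟩
  · intro x s hs
    have hd : ∀ i : s, ∃ W : 𝒱, c W = i ∧ x ∈ W.1 := by
      intro i
      obtain ⟨W, hW⟩ := mem_iUnion.1 (hs i i.2)
      exact ⟨W.1, W.2, hW⟩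
    choose d hd using hd
    have hinj : Function.Injective fun i : s => (d i).1 := by
      intro i j hij
      have : d i = d j := Subtype.ext hij
      exact Subtype.ext ((hd i).1.symm.trans (this ▸ (hd j).1))
    have h1 : (range fun i : s => (d i).1).encard ≤ n + 1 := by
      refine (encard_le_encard ?_).trans (hn x)
      rintro _ ⟨i, rfl⟩
      exact ⟨(d i).2, (hd i).2⟩
    rw [← image_univ, hinj.encard_image, encard_univ] at h1
    simp only [ENat.card_eq_coe_fintype_card, Fintype.card_coe] at h1
    exact_mod_cast h1

/-- Refine the cover of the `(n+1)`-simplex by the open stars of its `n + 2` vertices and shrink the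
refinement to closed sets. The KKM lemma gives a point common to all `n + 2` of them, one more than
the order allows. -/
lemma CoveringDimLE.not_isClosedEmbedding {X : Type u} [TopologicalSpace X] {n : ℕ}
    (h : CoveringDimLE X n) {f : stdSimplex ℝ (Fin (n + 2)) → X} : ¬ IsClosedEmbedding f := by
  intro hf
  have hO : ∀ k : Fin (n + 2), ∃ O : Set X, IsOpen O ∧
      f ⁻¹' O = {x : stdSimplex ℝ (Fin (n + 2)) | 0 < x.1 k} := fun k =>
    hf.isInducing.isOpen_iff.1 (isOpen_lt continuous_const
      ((continuous_apply k).comp continuous_subtype_val))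
  choose O hO hfO using hO
  obtain ⟨V, hVo, hVO, hVc, hVn⟩ := h.exists_indexed
    -- The complement of the range is added to obtain a cover of all of `X`; it has no effect on the
    -- simplex.
    (O := fun k => O k ∪ (range f)ᶜ) (fun k => (hO k).union hf.isClosed_range.isOpen_compl) (by
      refine eq_univ_of_forall fun x => ?_
      by_cases hx : x ∈ range f
      · obtain ⟨y, rfl⟩ := hx
        obtain ⟨k, hk⟩ : ∃ k, 0 < y.1 k := by
          by_contra hne
          push Not at hne
          have h1 := y.2.2
          have h2 := Finset.sum_nonpos fun k (_ : k ∈ Finset.univ) => hne k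
          linarith
        have : y ∈ f ⁻¹' O k := hfO k ▸ hk
        exact mem_iUnion.2 ⟨k, Or.inl this⟩
      · exact mem_iUnion.2 ⟨0, Or.inr hx⟩)
  obtain ⟨F, hFc, hFcl, hFV⟩ := exists_iUnion_eq_closed_subset
    (u := fun k => f ⁻¹' V k) (fun k => (hVo k).preimage hf.continuous)
    (fun x => toFinite _) (by rw [← preimage_iUnion, hVc, preimage_univ])
  have hpos : ∀ k, ∀ x ∈ F k, 0 < x.1 k := by
    intro k x hx
    rcases hVO k (hFV k hx) with h1 | h1
    · have : x ∈ f ⁻¹' O k := h1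
      rw [hfO k] at this
      exact this
    · exact absurd (mem_range_self x) h1
  set w : ℕ → Fin (n + 2) → ℝ := fun k j => if k = (j : ℕ) then 1 else 0 with hw
  have hhull : convexHull ℝ (w '' Iio (n + 1 + 1)) ⊆ stdSimplex ℝ (Fin (n + 2)) := by
    refine convexHull_min ?_ (convex_stdSimplex ℝ _)
    rintro _ ⟨k, hk, rfl⟩
    refine ⟨fun j => by simp only [hw]; split_ifs <;> norm_num, ?_⟩
    simp only [hw]
    rw [Finset.sum_eq_single ⟨k, hk⟩]
    · simp
    · intro b _ hb
      rw [if_neg]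
      rintro rfl
      exact hb rfl
    · simp
  obtain ⟨x, hx, hxF⟩ := exists_mem_of_isClosed_cover_simplex w (n + 1)
    (fun k => Subtype.val '' F k)
    (fun k => (isClosed_stdSimplex ℝ _).isClosedEmbedding_subtypeVal.isClosedMap _ (hFcl k))
    (by
      intro x hx
      obtain ⟨k, hk⟩ := mem_iUnion.1 (hFc ▸ mem_univ (⟨x, hhull hx⟩ : stdSimplex ℝ _))
      exact mem_iUnion.2 ⟨k, ⟨_, hk, rfl⟩⟩)
    (by
      rintro s hs _ hx k ⟨x, hxk, rfl⟩
      by_contra hks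
      have : x.1 ∈ {y : Fin (n + 2) → ℝ | y k = 0} := by
        refine convexHull_min ?_ ?_ hx
        · rintro _ ⟨j, hj, rfl⟩
          have : j ≠ k := fun e => hks (e ▸ hj)
          simp [hw, this]
        · intro a ha b hb c d _ _ _
          simp only [mem_ofPred_eq] at ha hb ⊢
          simp [ha, hb]
      exact (hpos k x hxk).ne' this)
  have := hVn (f ⟨x, hhull hx⟩) Finset.univ fun k _ => by
    obtain ⟨y, hy, rfl⟩ := hxF k
    exact hFV k hy
  simp at this

lemma CoveringDimLE.card_face_le {X : Type u} [TopologicalSpace X] [T2Space X] {n : ℕ}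
    (h : CoveringDimLE X n) {V : Type*} {D : PreAbstractSimplicialComplex V}
    {j : simplicialRealization D → X} (hj : IsEmbedding j) {s : Finset V} (hs : s ∈ D.faces) :
    s.card ≤ n + 1 := by
  classical
  by_contra hlt
  obtain ⟨t, hts, ht⟩ := Finset.exists_subset_card_eq (show n + 2 ≤ s.card by lia)
  have htD : t ∈ D.faces :=
    (D.isRelLowerSet_faces hs).2 hts (Finset.card_pos.1 (by lia))
  let e : t ≃ Fin (n + 2) := t.equivFinOfCardEq ht
  let c : stdSimplex ℝ (Fin (n + 2)) → V → ℝ := fun x v => if hv : v ∈ t then x.1 (e ⟨v, hv⟩) else 0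
  have hc : ∀ x (v : t), c x v = x.1 (e v) := fun x v => by simp [c]
  have h0 : ∀ x, ∀ v ∈ t, 0 ≤ c x v := fun x v hv => by
    rw [hc x ⟨v, hv⟩]; exact x.2.1 _
  have h1 : ∀ x, ∑ v ∈ t, c x v = 1 := fun x => by
    rw [← Finset.sum_coe_sort t, ← x.2.2, ← e.sum_comp]
    exact Finset.sum_congr rfl fun v _ => hc x v
  have hcont : Continuous fun x => pointOfFace htD (h0 x) (h1 x) := by
    refine Continuous.subtype_mk ?_ _
    unfold lpOfFinset
    refine continuous_finsetSum _ fun v hv => ?_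
    have hcv : Continuous fun x => c x v := by
      simp only [c, dif_pos hv]
      exact (continuous_apply _).comp continuous_subtype_val
    exact hcv.smul continuous_const
  have hinj : Function.Injective fun x => pointOfFace htD (h0 x) (h1 x) := by
    intro x y hxy
    refine Subtype.ext (funext fun i => ?_)
    have := congrArg (fun z : simplicialRealization D => z.1 (e.symm i : V)) hxy
    simp only [pointOfFace_apply, hc, Equiv.apply_symm_apply, Finset.coe_mem, if_true] at this
    exact this
  exact h.not_isClosedEmbedding ((hj.continuous.comp hcont).isClosedEmbedding
    (hj.injective.comp hinj))

end CoveringDimension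

/-! ### General position -/

section GeneralPosition

lemma AffineIndependent.eq_of_sum_smul_eq {V E : Type*} [AddCommGroup E] [Module ℝ E]
    {w : V → E} {r : Finset V} (h : AffineIndependent ℝ fun v : r => w v) {a b : V → ℝ}
    (hab : ∑ v ∈ r, a v = ∑ v ∈ r, b v) (hw : ∑ v ∈ r, a v • w v = ∑ v ∈ r, b v • w v) :
    ∀ v ∈ r, a v = b v := by
  intro v hv
  have := affineIndependent_iff.1 h Finset.univ (fun v => a v - b v)
    (by
      rw [Finset.sum_coe_sort r (fun v => a v - b v), Finset.sum_sub_distrib, hab, sub_self])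
    (by
      rw [Finset.sum_coe_sort r (fun v => (a v - b v) • w v)]
      simp only [sub_smul]
      rw [Finset.sum_sub_distrib, hw, sub_self]) ⟨v, hv⟩ (Finset.mem_univ _)
  exact sub_eq_zero.1 this

lemma injective_bary {V E : Type*} [AddCommGroup E] [Module ℝ E]
    {D : PreAbstractSimplicialComplex V} {w : V → E}
    (hw : ∀ s ∈ D.faces, ∀ t ∈ D.faces, ∀ r : Finset V, (∀ v ∈ r, v ∈ s ∨ v ∈ t) →
      AffineIndependent ℝ fun v : r => w v) : Function.Injective (bary D w) := by
  classical
  intro x y hxy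
  obtain ⟨s, hs, hs1, hs2⟩ := exists_support_face x
  obtain ⟨t, ht, ht1, ht2⟩ := exists_support_face y
  have hx : ∀ v, x.1 v ≠ 0 → v ∈ s ∪ t := fun v hv => Finset.mem_union_left _ ((hs1 v).2 hv)
  have hy : ∀ v, y.1 v ≠ 0 → v ∈ s ∪ t := fun v hv => Finset.mem_union_right _ ((ht1 v).2 hv)
  have key := (hw s hs t ht (s ∪ t) (by simp)).eq_of_sum_smul_eq (a := x.1) (b := y.1)
    (by
      rw [← Finset.sum_subset Finset.subset_union_left, hs2,
        ← Finset.sum_subset Finset.subset_union_right, ht2]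
      · exact fun v _ hv => not_not.1 fun h => hv ((ht1 v).2 h)
      · exact fun v _ hv => not_not.1 fun h => hv ((hs1 v).2 h))
    (by rw [← bary_eq_sum w x _ hx, ← bary_eq_sum w y _ hy, hxy])
  refine realization_ext fun v => ?_
  by_cases hv : v ∈ s ∪ t
  · exact key v hv
  · rw [not_not.1 fun h => hv (hx v h), not_not.1 fun h => hv (hy v h)]

lemma AffineIndependent.disjoint_convexHull_image {V E : Type*} [DecidableEq V] [AddCommGroup E]
    [Module ℝ E] {w : V → E} {s t : Finset V} (h : AffineIndependent ℝ fun v : (s ∪ t : Finset V) => w v)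
    (hst : Disjoint s t) :
    Disjoint (convexHull ℝ (w '' (s : Set V))) (convexHull ℝ (w '' (t : Set V))) := by
  rw [Set.disjoint_left]
  intro z hs ht
  obtain ⟨a, ha0, ha1, haz⟩ := mem_convexHull_image_finset.1 hs
  obtain ⟨b, hb0, hb1, hbz⟩ := mem_convexHull_image_finset.1 ht
  have key := h.eq_of_sum_smul_eq (a := fun v => if v ∈ s then a v else 0)
    (b := fun v => if v ∈ t then b v else 0)
    (by
      simp only [Finset.sum_ite_mem, Finset.union_inter_cancel_left,
        Finset.union_inter_cancel_right, ha1, hb1])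
    (by
      simp only [ite_smul, zero_smul, Finset.sum_ite_mem, Finset.union_inter_cancel_left,
        Finset.union_inter_cancel_right, haz, hbz])
  have h0 : ∑ v ∈ s, a v = 0 := Finset.sum_eq_zero fun v hv => by
    have := key v (Finset.mem_union_left _ hv)
    rwa [if_pos hv, if_neg (Finset.disjoint_left.1 hst hv)] at this
  rw [h0] at ha1
  exact zero_ne_one ha1

variable {E : Type*} [NormedAddCommGroup E] [NormedSpace ℝ E] [FiniteDimensional ℝ E]

/-- At most `dim E` points span a proper affine subspace, which is Haar-null; finitely many of these
cannot cover a ball. -/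
lemma exists_mem_ball_notMem_affineSpan (F : Finset E) (a : E) {δ : ℝ} (hδ : 0 < δ) :
    ∃ q ∈ Metric.ball a δ, ∀ t ⊆ F, t.card ≤ Module.finrank ℝ E →
      q ∉ affineSpan ℝ (t : Set E) := by
  classical
  borelize E
  let μ : MeasureTheory.Measure E := MeasureTheory.Measure.addHaar
  have hnull : μ (⋃ t ∈ {t ∈ F.powerset | t.card ≤ Module.finrank ℝ E},
      (affineSpan ℝ (t : Set E) : Set E)) = 0 := by
    refine (MeasureTheory.measure_biUnion_null_iff (Finset.countable_toSet _)).2 fun t ht => ?_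
    rw [Finset.mem_coe, Finset.mem_filter] at ht
    rcases t.eq_empty_or_nonempty with rfl | hne
    · simp
    · refine MeasureTheory.Measure.addHaar_affineSubspace _ _ fun htop => ?_
      have h1 := (AffineSubspace.affineSpan_eq_top_iff_vectorSpan_eq_top_of_nonempty ℝ E E
        (s := (t : Set E)) (by simpa using hne)).1 htop
      have h2 := finrank_vectorSpan_image_finset_le ℝ (id : E → E) t (n := t.card - 1)
        (by have := hne.card_pos; lia)
      rw [Finset.image_id, h1, finrank_top] at h2
      have := hne.card_pos
      lia
  have hpos : 0 < μ (Metric.ball a δ) := Metric.measure_ball_pos μ a hδ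
  obtain ⟨q, hq, hqn⟩ := not_subset.1 fun hsub : Metric.ball a δ ⊆ _ =>
    hpos.ne' (MeasureTheory.measure_mono_null hsub hnull)
  refine ⟨q, hq, fun t ht hc hqt => hqn ?_⟩
  exact mem_iUnion₂.2 ⟨t, by simp [Finset.mem_powerset.2 ht, hc], hqt⟩

lemma exists_general_position_nat (a : ℕ → E) {δ : ℕ → ℝ} (hδ : ∀ i, 0 < δ i) :
    ∃ q : ℕ → E, (∀ i, dist (q i) (a i) < δ i) ∧
      ∀ s : Finset ℕ, s.card ≤ Module.finrank ℝ E + 1 → AffineIndependent ℝ fun i : s => q i := by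
  classical
  choose G hG1 hG2 using fun (F : Finset E) (i : ℕ) =>
    exists_mem_ball_notMem_affineSpan F (a i) (hδ i)
  -- `F n` consists of the points chosen before stage `n`; the new point avoids the spans of its
  -- small subsets, so independence follows by adding points in increasing order.
  let F : ℕ → Finset E := fun n => Nat.rec ∅ (fun i S => insert (G S i) S) n
  have hF : ∀ n, F (n + 1) = insert (G (F n) n) (F n) := fun n => rfl
  have hmem : ∀ n i, i < n → G (F i) i ∈ F n := by
    intro n
    induction n with
    | zero => intro i hi; exact absurd hi (Nat.not_lt_zero i)
    | succ n ih =>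
      intro i hi
      rw [hF]
      rcases Nat.lt_succ_iff_lt_or_eq.1 hi with h | rfl
      · exact Finset.mem_insert_of_mem (ih i h)
      · exact Finset.mem_insert_self _ _
  refine ⟨fun i => G (F i) i, fun i => hG1 _ i, fun s => ?_⟩
  induction s using Finset.induction_on_max with
  | empty => intro _; exact affineIndependent_of_subsingleton ℝ _
  | insert m s hm ih =>
    intro hcard
    have hms : m ∉ s := fun h => lt_irrefl _ (hm m h)
    rw [Finset.card_insert_of_notMem hms] at hcard
    refine AffineIndependent.affineIndependent_of_notMem_span
      (i := ⟨m, Finset.mem_insert_self m s⟩) ?_ ?_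
    · let φ : {y : (insert m s : Finset ℕ) // y ≠ ⟨m, Finset.mem_insert_self m s⟩} ↪ s :=
        ⟨fun y => ⟨y.1.1, (Finset.mem_insert.1 y.1.2).resolve_left fun h => y.2 (Subtype.ext h)⟩,
          fun y z h => Subtype.ext (Subtype.ext (congrArg (fun t : s => t.1) h))⟩
      exact (ih (by lia)).comp_embedding φ
    · intro hin
      refine hG2 (F m) m (s.image fun i => G (F i) i) ?_ ?_ (affineSpan_mono ℝ ?_ hin)
      · intro e he
        obtain ⟨i, hi, rfl⟩ := Finset.mem_image.1 he
        exact hmem m i (hm i hi)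
      · exact Finset.card_image_le.trans (by lia)
      · rintro _ ⟨y, hy, rfl⟩
        exact Finset.mem_coe.2 (Finset.mem_image_of_mem _
          ((Finset.mem_insert.1 y.2).resolve_left fun h => hy (Subtype.ext h)))

lemma exists_general_position {ι : Type*} [Countable ι] (a : ι → E) {δ : ι → ℝ}
    (hδ : ∀ i, 0 < δ i) : ∃ q : ι → E, (∀ i, dist (q i) (a i) < δ i) ∧
      ∀ s : Finset ι, s.card ≤ Module.finrank ℝ E + 1 → AffineIndependent ℝ fun i : s => q i := by
  obtain ⟨c, hc⟩ := exists_injective_nat ι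
  obtain ⟨q, hq1, hq2⟩ := exists_general_position_nat (Function.extend c a 0)
    (δ := Function.extend c δ 1) (by
      intro i
      by_cases hi : ∃ j, c j = i
      · obtain ⟨j, rfl⟩ := hi
        rw [hc.extend_apply]; exact hδ j
      · rw [Function.extend_apply' _ _ _ hi]; exact one_pos)
  refine ⟨q ∘ c, fun i => by simpa [hc.extend_apply] using hq1 (c i), fun s hs => ?_⟩
  let φ : s ↪ s.map ⟨c, hc⟩ := ⟨fun i => ⟨c i, Finset.mem_map_of_mem ⟨c, hc⟩ i.2⟩,
    fun i j h => Subtype.ext (hc (congrArg (fun t : s.map ⟨c, hc⟩ => t.1) h))⟩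
  exact (hq2 (s.map ⟨c, hc⟩) (by rwa [Finset.card_map])).comp_embedding φ

end GeneralPosition

/-! ### Embedding in dimension `2n + 1` by Baire category -/

section Hurewicz

open BoundedContinuousFunction

variable {X : Type u} {E : Type*} [NormedAddCommGroup E]

/-- The bounded maps that send `A` and the complement of `B` to sets at positive distance. -/
def separatingMaps (E : Type*) [NormedAddCommGroup E] [TopologicalSpace X] (A B : Set X) :
    Set (X →ᵇ E) :=
  {g | ∃ ε > 0, ∀ a ∈ A, ∀ y ∉ B, ε ≤ dist (g a) (g y)}

lemma isOpen_separatingMaps [TopologicalSpace X] (A B : Set X) :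
    IsOpen (separatingMaps E A B) := by
  refine Metric.isOpen_iff.2 ?_
  rintro g ⟨ε, hε, hg⟩
  refine ⟨ε / 4, by positivity, fun h hh => ⟨ε / 2, by positivity, fun a ha y hy => ?_⟩⟩
  have h1 := (dist_coe_le_dist (f := h) (g := g) a).trans_lt hh
  have h2 := (dist_coe_le_dist (f := h) (g := g) y).trans_lt hh
  have h3 := hg a ha y hy
  have h4 := dist_triangle4 (g a) (h a) (h y) (g y)
  rw [dist_comm (g a) (h a)] at h4
  linarith

variable [NormedSpace ℝ E]

/-- Take a cover of order at most `n + 1` by sets with small image under `h`, each inside `B` (tag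
`true`) or off `closure A` (tag `false`). A partition of unity approximates `h` by a map to
simplexes on points in general position. Points of `A` use only `true` vertices and points off `B`
only `false` ones. Two such simplexes have at most `2n + 2` vertices together, so they are disjoint,
and compactness gives a positive distance. -/
lemma dense_separatingMaps [FiniteDimensional ℝ E] [TopologicalSpace X]
    [TopologicalSpace.MetrizableSpace X] {n : ℕ} (hX : CoveringDimLE X n)
    (hE : Module.finrank ℝ E = 2 * n + 1) {A B : Set X} (hB : IsOpen B) (hAB : closure A ⊆ B) :
    Dense (separatingMaps E A B) := by
  classical
  let := TopologicalSpace.metrizableSpaceMetric X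
  refine Metric.dense_iff.2 fun h η hη => ?_
  have : ProperSpace E := FiniteDimensional.proper ℝ E
  obtain ⟨J, -, hJ⟩ := h.isBounded_range.isCompact_closure.elim_nhds_subcover
    (fun c => Metric.ball c (η / 5)) fun c _ => Metric.ball_mem_nhds c (by positivity)
  have hball : ∀ c : E, IsOpen (h ⁻¹' Metric.ball c (η / 5)) := fun c =>
    Metric.isOpen_ball.preimage h.continuous
  obtain ⟨V, hVo, hVsub, hVc, hVn⟩ := hX.exists_indexed (ι := J × Bool)
    (O := fun i => (if i.2 then B else (closure A)ᶜ) ∩ h ⁻¹' Metric.ball i.1.1 (η / 5)) (by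
      rintro ⟨c, b⟩
      cases b
      · simpa using isClosed_closure.isOpen_compl.inter (hball c)
      · simpa using hB.inter (hball c)) (by
      refine eq_univ_of_forall fun x => ?_
      obtain ⟨c, hc, hx⟩ := mem_iUnion₂.1 (hJ (subset_closure (mem_range_self x)))
      by_cases hxB : x ∈ B
      · exact mem_iUnion.2 ⟨(⟨c, hc⟩, true), by simpa using hxB, hx⟩
      · exact mem_iUnion.2 ⟨(⟨c, hc⟩, false), by simpa using fun h => hxB (hAB h), hx⟩)
  obtain ⟨φ, hφ⟩ := PartitionOfUnity.exists_isSubordinate_of_locallyFinite isClosed_univ V hVo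
    (locallyFinite_of_finite V) (by rw [hVc])
  obtain ⟨q, hq1, hq2⟩ := exists_general_position (fun i : J × Bool => i.1.1)
    (δ := fun _ => η / 5) fun _ => by positivity
  have hφV : ∀ i x, φ i x ≠ 0 → x ∈ V i := fun i x hx => hφ i (subset_tsupport _ hx)
  have hcont : Continuous fun x => ∑ᶠ i, φ i x • q i :=
    φ.continuous_finsum_smul fun i x _ => continuousAt_const
  have hclose : ∀ x, ∑ᶠ i, φ i x • q i ∈ Metric.ball (h x) (2 * (η / 5)) := by
    intro x
    refine φ.finsum_smul_mem_convex (g := fun i _ => q i) (mem_univ x) (fun i hi => ?_)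
      (convex_ball _ _)
    have h1 : dist (h x) i.1.1 < η / 5 := (hVsub i (hφV i x hi)).2
    have h2 := hq1 i
    rw [Metric.mem_ball]
    have := dist_triangle_right (q i) (h x) i.1.1
    linarith
  obtain ⟨R, hR⟩ := h.isBounded_range.subset_closedBall 0
  let g : X →ᵇ E := ofNormedAddCommGroup (fun x => ∑ᶠ i, φ i x • q i) hcont
    (R + 2 * (η / 5)) fun x => by
      have h1 := hclose x
      have h2 := hR (mem_range_self x)
      rw [mem_closedBall_zero_iff] at h2
      rw [mem_ball_iff_norm] at h1
      have := norm_sub_norm_le (∑ᶠ i, φ i x • q i) (h x)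
      linarith
  refine ⟨g, ?_, ?_⟩
  · rw [Metric.mem_ball]
    refine lt_of_le_of_lt ((dist_le (C := 2 * (η / 5)) (by positivity)).2 fun x =>
      (hclose x).le) ?_
    linarith
  · let Z : Bool → Set E := fun b =>
      ⋃ s ∈ {s : Finset (J × Bool) | s.card ≤ n + 1 ∧ ∀ i ∈ s, i.2 = b},
        convexHull ℝ (q '' (s : Set (J × Bool)))
    have hZ : ∀ b, IsCompact (Z b) := fun b =>
      (toFinite _).isCompact_biUnion fun s _ => (s.finite_toSet.image q).isCompact_convexHull ℝ
    have hgZ : ∀ b x, (∀ i, φ i x ≠ 0 → i.2 = b) → g x ∈ Z b := by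
      intro b x hx
      refine mem_iUnion₂.2 ⟨Finset.univ.filter fun i => φ i x ≠ 0, ⟨?_, ?_⟩, ?_⟩
      · exact hVn x _ fun i hi => hφV i x (Finset.mem_filter.1 hi).2
      · exact fun i hi => hx i (Finset.mem_filter.1 hi).2
      · refine φ.finsum_smul_mem_convex (g := fun i _ => q i) (mem_univ x) (fun i hi => ?_)
          (convex_convexHull ℝ _)
        exact subset_convexHull ℝ _ (mem_image_of_mem q (by simpa using hi))
    have hdisj : Disjoint (Z true) (Z false) := by
      simp only [Z, disjoint_iUnion_left, disjoint_iUnion_right]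
      rintro t ⟨ht1, ht2⟩ s ⟨hs1, hs2⟩
      refine AffineIndependent.disjoint_convexHull_image (hq2 _ ?_) ?_
      · have := Finset.card_union_le s t
        lia
      · rw [Finset.disjoint_left]
        intro i hi hit
        have h1 := hs2 i hi
        rw [ht2 i hit] at h1
        exact Bool.false_ne_true h1
    obtain ⟨r, hr, hrZ⟩ := Metric.exists_pos_forall_lt_edist (hZ true) (hZ false).isClosed hdisj
    refine ⟨r, hr, fun a ha y hy => ?_⟩
    have h1 := hrZ (g a) (hgZ true a fun i hi => by
      have h1 := (hVsub i (hφV i a hi)).1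
      by_contra h2
      rw [Bool.not_eq_true] at h2
      simp only [h2, Bool.false_eq_true, if_false] at h1
      exact h1 (subset_closure ha)) (g y) (hgZ false y fun i hi => by
      have h1 := (hVsub i (hφV i y hi)).1
      by_contra h2
      rw [Bool.not_eq_false] at h2
      simp only [h2, if_true] at h1
      exact hy h1)
    rw [edist_nndist, ENNReal.coe_lt_coe] at h1
    exact (NNReal.coe_lt_coe.2 h1).le

/-- A map that separates all pairs of basic open sets with `closure A ⊆ B` is an embedding; these
are countably many dense open conditions. -/
lemma exists_isEmbedding_of_coveringDimLE [FiniteDimensional ℝ E] [TopologicalSpace X]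
    [TopologicalSpace.MetrizableSpace X] [TopologicalSpace.SeparableSpace X] {n : ℕ}
    (hX : CoveringDimLE X n) (hE : Module.finrank ℝ E = 2 * n + 1) :
    ∃ g : X → E, IsEmbedding g ∧ Bornology.IsBounded (range g) := by
  let := TopologicalSpace.metrizableSpaceMetric X
  have : SecondCountableTopology X := UniformSpace.secondCountable_of_separable X
  have : CompleteSpace E := FiniteDimensional.complete ℝ E
  let b := TopologicalSpace.countableBasis X
  have hb : TopologicalSpace.IsTopologicalBasis b := TopologicalSpace.isBasis_countableBasis X
  let S : Set (Set X × Set X) := {p | p ∈ b ×ˢ b ∧ closure p.1 ⊆ p.2}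
  have hS : S.Countable := ((TopologicalSpace.countable_countableBasis X).prod
    (TopologicalSpace.countable_countableBasis X)).mono fun p hp => hp.1
  obtain ⟨g, hg⟩ := (dense_biInter_of_isOpen (S := S)
    (f := fun p => separatingMaps E p.1 p.2)
    (fun p _ => isOpen_separatingMaps p.1 p.2) hS fun p hp =>
      dense_separatingMaps hX hE (hb.isOpen hp.1.2) hp.2).nonempty
  have key : ∀ x, ∀ W ∈ 𝓝 x, ∃ ε > 0, ∀ y ∉ W, ε ≤ dist (g x) (g y) := by
    intro x W hW
    obtain ⟨B, hB, hxB, hBW⟩ := hb.mem_nhds_iff.1 hW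
    obtain ⟨A, hA, hxA, hAB⟩ := hb.exists_closure_subset ((hb.isOpen hB).mem_nhds hxB)
    obtain ⟨ε, hε, h⟩ := mem_iInter₂.1 hg (A, B) ⟨⟨hA, hB⟩, hAB⟩
    exact ⟨ε, hε, fun y hy => h x hxA y fun hyB => hy (hBW hyB)⟩
  refine ⟨g, ⟨isInducing_iff_nhds.2 fun x => le_antisymm (g.continuous.tendsto x).le_comap ?_,
    fun x y hxy => ?_⟩, g.isBounded_range⟩
  · intro W hW
    obtain ⟨ε, hε, h⟩ := key x W hW
    refine ⟨Metric.ball (g x) ε, Metric.ball_mem_nhds _ hε, fun y hy => ?_⟩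
    by_contra hyW
    have := h y hyW
    rw [dist_comm] at this
    exact absurd hy (not_lt.2 this)
  · by_contra hne
    obtain ⟨ε, hε, h⟩ := key x {y}ᶜ (isOpen_compl_singleton.mem_nhds hne)
    have := h y (by simp)
    rw [hxy, dist_self] at this
    linarith

end Hurewicz

/-! ### Fine subdivisions of locally finite complexes in `ℓ¹` -/

section FineSubdivision

variable {V : Type u} {L : PreAbstractSimplicialComplex V}

lemma mem_simplicialRealization_of_support {s : Finset V} (hs : s ∈ L.faces)
    {z : lp (fun _ : V => ℝ) 1} (h0 : ∀ v, 0 ≤ z v) (hz : ∀ v ∉ s, z v = 0)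
    (h1 : ∑ v ∈ s, z v = 1) : z ∈ simplicialRealization L := by
  classical
  have : z = lpOfFinset s z := by
    refine lp.ext (funext fun v => ?_)
    rw [lpOfFinset_apply]
    split_ifs with h
    · rfl
    · exact hz v h
  rw [this]
  exact lpOfFinset_mem hs (fun v _ => h0 v) h1

/-- The mass of `x` outside the support of `p` equals the mass it lacks on that support, so finitely
many coordinates control the `ℓ¹` distance. -/
lemma norm_sub_le_two_mul_sum (x p : simplicialRealization L) {s : Finset V}
    (hs : ∀ v, v ∈ s ↔ p.1 v ≠ 0) (hs1 : ∑ v ∈ s, p.1 v = 1) :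
    ‖x.1 - p.1‖ ≤ 2 * ∑ v ∈ s, |x.1 v - p.1 v| := by
  classical
  obtain ⟨t, -, ht, ht1⟩ := exists_support_face x
  have hx0 : ∀ v, v ∉ t → x.1 v = 0 := fun v hv => not_not.1 fun h => hv ((ht v).2 h)
  have hp0 : ∀ v, v ∉ s → p.1 v = 0 := fun v hv => not_not.1 fun h => hv ((hs v).2 h)
  have heq : x.1 - p.1 = lpOfFinset (s ∪ (t \ s)) fun v => x.1 v - p.1 v := by
    refine lp.ext (funext fun v => ?_)
    rw [lpOfFinset_apply, lp.coeFn_sub, Pi.sub_apply]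
    split_ifs with h
    · rfl
    · simp only [Finset.mem_union, Finset.mem_sdiff, not_or, not_and_or, not_not] at h
      rw [hp0 v h.1, hx0 v (h.2.resolve_right h.1), sub_zero]
  have h1 : ‖x.1 - p.1‖ ≤ ∑ v ∈ s ∪ (t \ s), |x.1 v - p.1 v| := by
    rw [heq, lpOfFinset]
    refine (norm_sum_le _ _).trans (Finset.sum_le_sum fun v _ => ?_)
    rw [norm_smul, lp.norm_single one_pos, norm_one, mul_one, Real.norm_eq_abs]
  rw [Finset.sum_union Finset.disjoint_sdiff] at h1
  have h2 : ∑ v ∈ t \ s, |x.1 v - p.1 v| = ∑ v ∈ t \ s, x.1 v :=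
    Finset.sum_congr rfl fun v hv => by
      rw [hp0 v (Finset.mem_sdiff.1 hv).2, sub_zero, abs_of_nonneg (realization_nonneg x v)]
  have h3 : ∑ v ∈ s, x.1 v + ∑ v ∈ t \ s, x.1 v = 1 := by
    rw [← Finset.sum_union Finset.disjoint_sdiff, ← ht1, Finset.union_sdiff_self_eq_union]
    exact (Finset.sum_subset Finset.subset_union_right fun v _ hv => hx0 v hv).symm
  have h4 : ∑ v ∈ s, p.1 v - ∑ v ∈ s, x.1 v ≤ ∑ v ∈ s, |x.1 v - p.1 v| := by
    rw [← Finset.sum_sub_distrib]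
    refine Finset.sum_le_sum fun v _ => ?_
    rw [abs_sub_comm]
    exact le_abs_self _
  linarith

/-- A locally finite countable complex has subdivisions that are as fine as one wishes. -/
theorem exists_fine_subdivision (hL : LocFin L) (hc : L.faces.Countable)
    (G : Set (lp (fun _ : V => ℝ) 1) → Prop) (hGmono : ∀ {A B}, A ⊆ B → G B → G A)
    (hG : ∀ p ∈ simplicialRealization L, ∃ U ∈ 𝓝 p, G (U ∩ simplicialRealization L)) :
    ∃ D : PreAbstractSimplicialComplex (lp (fun _ : V => ℝ) 1), LocFin D ∧
      IsEmbedding (bary D id) ∧ range (bary D id) = simplicialRealization L ∧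
      ∀ x : simplicialRealization D, ∃ A ⊆ simplicialRealization L,
        G A ∧ bary D id x ∈ A ∧ ∀ v, x.1 v ≠ 0 → v ∈ A := by
  classical
  let R := simplicialRealization L
  let T : Set V := ⋃ s ∈ L.faces, (s : Set V)
  have hT : T.Countable := hc.biUnion fun s _ => s.countable_toSet
  have hsuppT : ∀ x ∈ R, ∀ v, x v ≠ 0 → v ∈ T := by
    intro x hx v hv
    obtain ⟨s, hs, h1, -⟩ := exists_support_face (⟨x, hx⟩ : simplicialRealization L)
    exact mem_iUnion₂.2 ⟨s, hs, (h1 v).2 hv⟩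
  let g : V × ℚ → lp (fun _ : V => ℝ) 1 →ᴬ[ℝ] ℝ := fun i =>
    (lp.evalCLM ℝ (fun _ : V => ℝ) 1 i.1).toContinuousAffineMap -
      ContinuousAffineMap.const ℝ _ (i.2 : ℝ)
  have hcount : (insert 0 (g '' (T ×ˢ univ))).Countable :=
    ((hT.prod countable_univ).image g).insert 0
  obtain ⟨h, hh⟩ := hcount.exists_eq_range (insert_nonempty _ _)
  have hgh : ∀ v ∈ T, ∀ q : ℚ, ∃ j, ∀ x, h j x = x v - q := by
    intro v hv q
    have : g (v, q) ∈ range h := hh ▸ Or.inr ⟨(v, q), ⟨hv, mem_univ _⟩, rfl⟩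
    obtain ⟨j, hj⟩ := this
    exact ⟨j, fun x => by rw [hj]; rfl⟩
  have hidx : ∀ v ∈ T, ∃ j, ∀ x, h j x = x v := by
    intro v hv
    obtain ⟨j, hj⟩ := hgh v hv 0
    exact ⟨j, fun x => by rw [hj]; simp⟩
  choose! κ hκ using hidx
  -- Once the hyperplanes `x v = 0` of all vertices carrying points of `A` are among the first `k`,
  -- the sign order controls supports.
  let Good : ℕ → Set (lp (fun _ : V => ℝ) 1) → Prop := fun k A => G A ∧
    ∀ x ∈ A, x ∈ R → ∀ v, x v ≠ 0 → κ v < k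
  have hstar : ∀ {k p}, p ∈ R → p ∈ closedStar h R k p := fun hp =>
    ⟨hp, _, hp, signLE.refl, signLE.refl⟩
  have hsupp : ∀ {k p x}, p ∈ R → Good k (closedStar h R k p) → x ∈ R → signLE h k x p →
      ∀ v, x v ≠ 0 → p v ≠ 0 := by
    intro k p x hp hg hx hxp v hv
    have h1 := hg.2 x ⟨hx, p, hp, signLE.refl, hxp⟩ hx v hv
    have h2 := (hxp _ h1).1
    rw [hκ v (hsuppT x hx v hv), hκ v (hsuppT x hx v hv)] at h2
    exact (h2 (lt_of_le_of_ne (hx.1 v) hv.symm)).ne'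
  have hsumx : ∀ {x s}, x ∈ R → (∀ v, x v ≠ 0 → v ∈ s) → ∑ v ∈ s, x v = 1 := by
    intro x s hx hs
    obtain ⟨t, -, h1, h2⟩ := exists_support_face (⟨x, hx⟩ : simplicialRealization L)
    rw [← h2]
    exact (Finset.sum_subset (fun v hv => hs v ((h1 v).1 hv)) fun v _ hv =>
      not_not.1 fun h => hv ((h1 v).2 h)).symm
  have H : FineCells R R h Good :=
    { mono := fun hAB hB => ⟨hGmono hAB hB.1, fun x hx => hB.2 x (hAB hx)⟩
      subset := subset_rfl
      exists_good := by
        intro p hp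
        obtain ⟨U, hU, hGU⟩ := hG p hp
        obtain ⟨ε, hε, hball⟩ := Metric.mem_nhds_iff.1 hU
        obtain ⟨s, hs, hs1, hs2⟩ := exists_support_face (⟨p, hp⟩ : simplicialRealization L)
        obtain ⟨v₀, hv₀⟩ := (L.isRelLowerSet_faces hs).1
        have hpv₀ : 0 < p v₀ := lt_of_le_of_ne (hp.1 v₀) ((hs1 v₀).1 hv₀).symm
        let T₀ : Finset V := (hL v₀).toFinset.biUnion id
        -- The first bound keeps the star inside the open star of `v₀`, where only vertices of `T₀`
        -- occur; the second makes the norm at most `ε / 2`.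
        let δ := min (p v₀) (ε / (4 * s.card))
        have hcard : (0 : ℝ) < s.card := by exact_mod_cast Finset.card_pos.2 ⟨v₀, hv₀⟩
        have hδ : 0 < δ := lt_min hpv₀ (by positivity)
        have hcl : ∀ v ∈ s, ∃ k₀, ∀ k ≥ k₀, ∀ x ∈ closedStar h R k p, |x v - p v| < δ :=
          fun v hv => abs_sub_lt_of_mem_closedStar (f := fun x => x v) R
            (hgh v (mem_iUnion₂.2 ⟨s, hs, hv⟩)) p hδ
        choose! k₀ hk₀ using hcl
        refine ⟨max (T₀.sup κ + 1) (s.sup k₀), ?_⟩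
        have hin : ∀ x ∈ closedStar h R (max (T₀.sup κ + 1) (s.sup k₀)) p,
            ∀ v ∈ s, |x v - p v| < δ := fun x hx v hv =>
          hk₀ v hv _ ((Finset.le_sup hv).trans (le_max_right _ _)) x hx
        have hsub : closedStar h R (max (T₀.sup κ + 1) (s.sup k₀)) p ⊆
            U ∩ simplicialRealization L := by
          refine fun x hx => ⟨hball ?_, hx.1⟩
          rw [Metric.mem_ball, dist_eq_norm]
          have h1 := norm_sub_le_two_mul_sum (⟨x, hx.1⟩ : simplicialRealization L) ⟨p, hp⟩ hs1 hs2
          have h2 : ∑ v ∈ s, |x v - p v| ≤ ∑ v ∈ s, ε / (4 * s.card) :=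
            Finset.sum_le_sum fun v hv => (hin x hx v hv).le.trans (min_le_right _ _)
          rw [Finset.sum_const, nsmul_eq_mul] at h2
          have h3 : (s.card : ℝ) * (ε / (4 * s.card)) = ε / 4 := by field_simp
          rw [h3] at h2
          refine h1.trans_lt ?_
          change 2 * ∑ v ∈ s, |x v - p v| < ε
          linarith
        refine ⟨hGmono hsub hGU, fun x hx hxR v hv => ?_⟩
        have h1 := (abs_lt.1 ((hin x hx v₀ hv₀).trans_le (min_le_left _ _))).1
        have h2 : x v₀ ≠ 0 := by
          intro h0
          rw [h0] at h1
          linarith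
        obtain ⟨t, ht, ht1, -⟩ := exists_support_face (⟨x, hxR⟩ : simplicialRealization L)
        have h3 : v ∈ T₀ := Finset.mem_biUnion.2
          ⟨t, by simpa using ⟨ht, (ht1 v₀).2 h2⟩, (ht1 v).2 hv⟩
        exact lt_of_lt_of_le (Nat.lt_succ_of_le (Finset.le_sup h3)) (le_max_left _ _)
      star_subset := fun _ _ x hx => hx.1
      convex := by
        intro k p hp hg
        obtain ⟨s, hs, hs1, -⟩ := exists_support_face (⟨p, hp⟩ : simplicialRealization L)
        rintro x ⟨hx, hxp⟩ y ⟨hy, hyp⟩ a b ha hb hab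
        have hxs : ∀ v, x v ≠ 0 → v ∈ s := fun v hv => (hs1 v).2 (hsupp hp hg hx hxp v hv)
        have hys : ∀ v, y v ≠ 0 → v ∈ s := fun v hv => (hs1 v).2 (hsupp hp hg hy hyp v hv)
        have hcoord : ∀ v, (a • x + b • y) v = a * x v + b * y v := fun v => rfl
        refine ⟨mem_simplicialRealization_of_support hs (fun v => ?_) (fun v hv => ?_) ?_,
          convex_signLE h k p hxp hyp ha hb hab⟩
        · rw [hcoord]
          exact add_nonneg (mul_nonneg ha (hx.1 v)) (mul_nonneg hb (hy.1 v))
        · rw [hcoord, not_not.1 fun h => hv (hxs v h), not_not.1 fun h => hv (hys v h)]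
          simp
        · simp only [hcoord]
          rw [Finset.sum_add_distrib, ← Finset.mul_sum, ← Finset.mul_sum, hsumx hx hxs,
            hsumx hy hys, mul_one, mul_one, hab]
      compact := by
        intro k p hp hg
        obtain ⟨s, hs, hs1, -⟩ := exists_support_face (⟨p, hp⟩ : simplicialRealization L)
        have : {x ∈ R | signLE h k x p} =
            Subtype.val '' closedFace L s ∩ {x | signLE h k x p} := by
          ext x
          constructor
          · rintro ⟨hx, hxp⟩
            exact ⟨⟨⟨x, hx⟩, fun v hv => (hs1 v).2 (hsupp hp hg hx hxp v hv), rfl⟩, hxp⟩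
          · rintro ⟨⟨x, -, rfl⟩, hxp⟩
            exact ⟨x.2, hxp⟩
        rw [this]
        exact ((isCompact_closedFace hs).image continuous_subtype_val).inter_right
          (isClosed_signLE h k p)
      line_mem := by
        intro k p x hp hx hg hxp _ t _ hpz
        obtain ⟨s, hs, hs1, hs2⟩ := exists_support_face (⟨p, hp⟩ : simplicialRealization L)
        have hxs : ∀ v, x v ≠ 0 → v ∈ s := fun v hv => (hs1 v).2 (hsupp hp hg hx hxp v hv)
        have hcoord : ∀ v, (p + t • (x - p)) v = p v + t * (x v - p v) := fun v => rfl
        have hz : ∀ v ∉ s, (p + t • (x - p)) v = 0 := by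
          intro v hv
          have hpv : p v = 0 := not_not.1 fun h => hv ((hs1 v).2 h)
          rw [hcoord, hpv, not_not.1 fun h => hv (hxs v h)]
          simp
        refine mem_simplicialRealization_of_support hs (fun v => ?_) hz ?_
        · by_cases hv : v ∈ s
          · have hpv : p v ≠ 0 := (hs1 v).1 hv
            have h1 := (hpz _ (hg.2 p (hstar hp) hp v hpv)).1
            rw [hκ v (hsuppT p hp v hpv), hκ v (hsuppT p hp v hpv)] at h1
            exact (h1 (lt_of_le_of_ne (hp.1 v) hpv.symm)).le
          · exact (hz v hv).ge
        · simp only [hcoord]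
          rw [Finset.sum_add_distrib, ← Finset.mul_sum, Finset.sum_sub_distrib, hsumx hx hxs,
            hsumx hp fun v => (hs1 v).2]
          ring }
  obtain ⟨D, hD, hemb, hrange, htop⟩ := H.exists_triangulation
  refine ⟨D, hD, hemb, hrange, fun x => ?_⟩
  obtain ⟨w, hw, k, hwQ, hg, hv, hxw, hwx⟩ := htop x
  exact ⟨closedStar h R k w, fun y hy => hy.1, hg.1,
    ⟨hrange ▸ mem_range_self x, w, hwQ, signLE.refl, hxw⟩,
    fun v hvx => ⟨(hv v hvx).1, w, hwQ, signLE.refl, (hv v hvx).2⟩⟩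

/-- A locally compact second countable polyhedron `Y`, mapped to the complement of a closed set `B`,
has triangulations whose simplices are mapped to sets that are small compared with their
distance from `B`. -/
lemma IsPolyhedron.exists_small_triangulation {Y : Type u} [TopologicalSpace Y]
    (hY : IsPolyhedron Y) [LocallyCompactSpace Y] [SecondCountableTopology Y] {E : Type*}
    [NormedAddCommGroup E] {g : Y → E} (hg : Continuous g) {B : Set E} (hB : IsClosed B)
    (hgB : ∀ y, g y ∉ B) :
    ∃ (V : Type u) (D : PreAbstractSimplicialComplex V) (θ : simplicialRealization D ≃ₜ Y)
      (w : V → E), LocFin D ∧ ∀ x v, x.1 v ≠ 0 → ∀ z ∈ B,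
        4 * dist (w v) (g (θ x)) ≤ dist (w v) z ∧
        4 * dist (w v) (g (θ x)) ≤ dist (g (θ x)) z := by
  classical
  obtain ⟨V, L, ⟨e⟩⟩ := hY
  have hlc : LocallyCompactSpace (simplicialRealization L) :=
    e.symm.isClosedEmbedding.locallyCompactSpace
  have hL := locFin_of_locallyCompactSpace hlc
  have : SecondCountableTopology (simplicialRealization L) := e.symm.secondCountableTopology
  let G' : lp (fun _ : V => ℝ) 1 → E := fun z =>
    if h : z ∈ simplicialRealization L then g (e.symm ⟨z, h⟩) else 0
  have hG' : ∀ z : simplicialRealization L, G' z = g (e.symm z) := fun z => by simp [G']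
  have hG'c : ContinuousOn G' (simplicialRealization L) := by
    rw [continuousOn_iff_continuous_domRestrict]
    exact (hg.comp e.symm.continuous).congr fun z => (hG' z).symm
  obtain ⟨D, hD, hemb, hrange, hsmall⟩ := exists_fine_subdivision hL (countable_faces hL)
    (fun A => ∀ a ∈ A, ∀ b ∈ A, ∀ z ∈ B, 4 * dist (G' a) (G' b) ≤ dist (G' a) z)
    (fun hAB h a ha b hb => h a (hAB ha) b (hAB hb)) (by
      intro p hp
      have hpB : G' p ∉ B := by rw [hG' ⟨p, hp⟩]; exact hgB _
      obtain ⟨η, hη, hball⟩ := Metric.mem_nhds_iff.1 (hB.isOpen_compl.mem_nhds hpB)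
      have h1 := (hG'c p hp).eventually (Metric.ball_mem_nhds (G' p) (show 0 < η / 10 by positivity))
      obtain ⟨U, hU, hUs⟩ := mem_nhdsWithin_iff_exists_mem_nhds_inter.1 h1
      refine ⟨U, hU, fun a ha b hb z hz => ?_⟩
      have ha' : dist (G' a) (G' p) < η / 10 := hUs ha
      have hb' : dist (G' b) (G' p) < η / 10 := hUs hb
      have hz' : η ≤ dist (G' p) z := by
        by_contra hlt
        rw [not_le, dist_comm] at hlt
        exact hball hlt hz
      have h2 := dist_triangle_right (G' a) (G' b) (G' p)
      have h3 := dist_triangle_left (G' p) z (G' a)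
      linarith)
  let θ : simplicialRealization D ≃ₜ Y :=
    (hemb.toHomeomorph.trans (Homeomorph.setCongr hrange)).trans e.symm
  have hθ : ∀ x, g (θ x) = G' (bary D id x) := fun x =>
    (hG' ⟨bary D id x, hrange ▸ mem_range_self x⟩).symm
  refine ⟨_, D, θ, G', hD, fun x v hv z hz => ?_⟩
  obtain ⟨A, -, hA, hxA, hvA⟩ := hsmall x
  rw [hθ]
  exact ⟨hA v (hvA v hv) _ hxA z hz, dist_comm (G' v) _ ▸ hA _ hxA v (hvA v hv) z hz⟩

end FineSubdivision

/-! ### Perturbation to an affine polyhedron and part (c) -/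

section Embedding

lemma exists_general_position_of_subset {V E : Type*} [NormedAddCommGroup E] [NormedSpace ℝ E]
    [FiniteDimensional ℝ E] {T : Set V} (hT : T.Countable) (a : V → E) {δ : V → ℝ}
    (hδ : ∀ v ∈ T, 0 < δ v) : ∃ q : V → E, (∀ v ∈ T, dist (q v) (a v) < δ v) ∧
      ∀ s : Finset V, (s : Set V) ⊆ T → s.card ≤ Module.finrank ℝ E + 1 →
        AffineIndependent ℝ fun v : s => q v := by
  classical
  have := hT.to_subtype
  obtain ⟨q, hq1, hq2⟩ := exists_general_position (fun v : T => a v) (δ := fun v : T => δ v)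
    fun v => hδ v v.2
  let q' : V → E := fun v => if h : v ∈ T then q ⟨v, h⟩ else 0
  have hq' : ∀ v (h : v ∈ T), q' v = q ⟨v, h⟩ := fun v h => dif_pos h
  refine ⟨q', fun v hv => by rw [hq' v hv]; exact hq1 ⟨v, hv⟩, fun s hs hcard => ?_⟩
  let φ : s ↪ s.subtype (· ∈ T) := ⟨fun v => ⟨⟨v, hs v.2⟩, by simp⟩,
    fun v w h => Subtype.ext (congrArg (fun t : s.subtype (· ∈ T) => (t.1 : V)) h)⟩
  have := (hq2 (s.subtype (· ∈ T))
    ((Finset.card_subtype _ _).trans_le (Finset.card_filter_le _ _) |>.trans hcard)).comp_embedding φ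
  convert! this using 2 with v
  exact hq' v _

lemma bary_affineMap {V E F : Type*} [AddCommGroup E] [Module ℝ E] [AddCommGroup F] [Module ℝ F]
    {D : PreAbstractSimplicialComplex V} (w : V → E) (A : E →ᵃ[ℝ] F)
    (x : simplicialRealization D) : bary D (A ∘ w) x = A (bary D w x) := by
  obtain ⟨s, -, hs, h1⟩ := exists_support_face x
  rw [bary_eq_sum w x s fun v => (hs v).2, bary_eq_sum (A ∘ w) x s fun v => (hs v).2,
    ← s.affineCombination_eq_linear_combination w _ h1,
    ← s.affineCombination_eq_linear_combination (A ∘ w) _ h1, s.map_affineCombination w _ h1 A]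

/-- An embedding `g` that sends `K` to a closed set `B` missing the image of the rest of the space
remains an embedding after a perturbation that is small compared with the distance from `B`. -/
lemma isEmbedding_of_dist_le {X E : Type*} [TopologicalSpace X] [NormedAddCommGroup E]
    [ProperSpace E] {g f : X → E} (hg : IsEmbedding g) (hgb : Bornology.IsBounded (range g))
    {P : Set X} (hP : IsOpen P) {B : Set E} (hB : IsClosed B) (hgP : ∀ x, x ∈ P ↔ g x ∉ B)
    (hcl : closure (range g) ⊆ B ∪ g '' P) (hf : ContinuousOn f P) (hinj : InjOn f P)
    (hfg : ∀ x, ∀ z ∈ B, 2 * dist (f x) (g x) ≤ dist (g x) z) : IsEmbedding f := by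
  have hfB : ∀ x ∉ P, f x = g x := fun x hx => by
    have := hfg x (g x) (not_not.1 fun h => hx ((hgP x).2 h))
    rw [dist_self] at this
    exact dist_le_zero.1 (by linarith)
  have hlow : ∀ x, ∀ z ∈ B, dist (g x) z ≤ 2 * dist (f x) z := fun x z hz => by
    have h1 := hfg x z hz
    have h2 := dist_triangle_left (g x) z (f x)
    linarith
  have hup : ∀ x, ∀ z ∈ B, 2 * dist (f x) z ≤ 3 * dist (g x) z := fun x z hz => by
    have h1 := hfg x z hz
    have h2 := dist_triangle (f x) (g x) z
    linarith
  have hKB : ∀ x ∉ P, f x ∈ B := fun x hx =>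
    hfB x hx ▸ not_not.1 fun h => hx ((hgP x).2 h)
  have hcont : Continuous f := by
    refine continuous_iff_continuousAt.2 fun x => ?_
    by_cases hx : x ∈ P
    · exact hf.continuousAt (hP.mem_nhds hx)
    · refine tendsto_iff_dist_tendsto_zero.2 (squeeze_zero (fun _ => dist_nonneg)
        (g := fun y => 3 / 2 * dist (g y) (g x)) (fun y => ?_) ?_)
      · have := hup y (f x) (hKB x hx)
        rw [hfB x hx] at this ⊢
        linarith
      · have h1 := tendsto_iff_dist_tendsto_zero.1 (hg.continuous.tendsto x)
        simpa using h1.const_mul (3 / 2)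
  have hinj' : ∀ x y, x ∉ P → f y = f x → y = x := by
    intro x y hx hxy
    have h1 := hlow y (f x) (hKB x hx)
    rw [hxy, dist_self, hfB x hx] at h1
    exact hg.injective (dist_le_zero.1 (by linarith))
  have hinj'' : Function.Injective f := by
    intro x y hxy
    by_cases hx : x ∈ P
    · by_cases hy : y ∈ P
      · exact hinj hx hy hxy
      · exact hinj' y x hy hxy
    · exact (hinj' x y hx hxy.symm).symm
  refine ⟨isInducing_iff_nhds.2 fun x => le_antisymm (hcont.tendsto x).le_comap ?_, hinj''⟩
  by_cases hx : x ∈ P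
  · obtain ⟨η, hη, hball⟩ := Metric.mem_nhds_iff.1
      (hB.isOpen_compl.mem_nhds ((hgP x).1 hx))
    have hxB : ∀ z ∈ B, η ≤ dist (g x) z := fun z hz => by
      by_contra hlt
      rw [not_le, dist_comm] at hlt
      exact hball hlt hz
    -- Limit points of the range away from `B` belong to `g '' P`, so this compact set has compact
    -- preimage. If `f y` is within `η / 4` of `f x`, then it is at least `η / 4` from `B`, hence `g
    -- y` is at least `η / 6` from `B`.
    have hM : IsCompact (closure (range g) ∩ {m | ∀ z ∈ B, η / 6 ≤ dist m z}) := by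
      refine hgb.isCompact_closure.inter_right ?_
      simp only [ofPred_forall]
      exact isClosed_biInter fun z _ => isClosed_le continuous_const
        (continuous_id.dist continuous_const)
    have hMr : closure (range g) ∩ {m | ∀ z ∈ B, η / 6 ≤ dist m z} ⊆ range g := by
      rintro m ⟨hm, hmB⟩
      rcases hcl hm with h | h
      · have := hmB m h
        rw [dist_self] at this
        linarith
      · exact image_subset_range _ _ h
    refine comap_nhds_le_of_compact_preimage hcont hinj''
      (Metric.ball_mem_nhds (f x) (show 0 < η / 4 by positivity))
      ((hg.isInducing.isCompact_preimage_iff hMr).2 hM) fun y hy => ?_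
    refine ⟨subset_closure (mem_range_self y), fun z hz => ?_⟩
    have h1 : dist (f y) (f x) < η / 4 := hy
    have h2 := hxB z hz
    have h3 := hlow x z hz
    have h4 := hup y z hz
    have h5 := dist_triangle_left (f x) z (f y)
    linarith
  · intro W hW
    rw [hg.isInducing.nhds_eq_comap] at hW
    obtain ⟨O, hO, hOW⟩ := hW
    obtain ⟨ε, hε, hball⟩ := Metric.mem_nhds_iff.1 hO
    refine ⟨Metric.ball (f x) (ε / 2), Metric.ball_mem_nhds _ (by positivity), fun y hy =>
      hOW (hball ?_)⟩
    have h1 : dist (f y) (f x) < ε / 2 := hy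
    have h2 := hlow y (f x) (hKB x hx)
    rw [hfB x hx] at h1 h2
    rw [Metric.mem_ball]
    linarith

/-- The embedding of a bounded region as part of a face of the cube. -/
noncomputable def faceEmbedding (N : ℕ) (c : ℝ) :
    EuclideanSpace ℝ (Fin N) →ᵃ[ℝ] EuclideanSpace ℝ (Fin (N + 1)) where
  toFun y := WithLp.toLp 2 (Fin.snoc (fun i => c * y i) 1)
  linear :=
    { toFun := fun y => WithLp.toLp 2 (Fin.snoc (fun i => c * y i) 0)
      map_add' := fun x y => by
        ext i
        refine Fin.lastCases ?_ (fun i => ?_) i <;> simp [mul_add]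
      map_smul' := fun r y => by
        ext i
        refine Fin.lastCases ?_ (fun i => ?_) i <;> simp [mul_left_comm] }
  map_vadd' := fun x y => by
    ext i
    refine Fin.lastCases ?_ (fun i => ?_) i <;> simp [mul_add]

lemma faceEmbedding_castSucc {N : ℕ} (c : ℝ) (y : EuclideanSpace ℝ (Fin N)) (i : Fin N) :
    faceEmbedding N c y i.castSucc = c * y i := by
  simp [faceEmbedding]

lemma faceEmbedding_last {N : ℕ} (c : ℝ) (y : EuclideanSpace ℝ (Fin N)) :
    faceEmbedding N c y (Fin.last N) = 1 := by
  simp [faceEmbedding]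

lemma isEmbedding_faceEmbedding {N : ℕ} {c : ℝ} (hc : c ≠ 0) :
    IsEmbedding (faceEmbedding N c) := by
  refine Function.LeftInverse.isEmbedding
    (f := fun z : EuclideanSpace ℝ (Fin (N + 1)) =>
      (WithLp.toLp 2 fun i : Fin N => c⁻¹ * z i.castSucc : EuclideanSpace ℝ (Fin N)))
    (fun y => ?_) (by fun_prop) (AffineMap.continuous_of_finiteDimensional _)
  ext i
  simp [faceEmbedding_castSucc, hc]

theorem exists_isEmbedding_polyhedralSphere {n : ℕ} {X : Type v} [TopologicalSpace X]
    [TopologicalSpace.MetrizableSpace X] {K : Set X} (hX : CoveringDimLE X n) (hK : IsCompact K)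
    (hPp : IsPolyhedron (Kᶜ : Set X)) (hPl : LocallyCompactSpace (Kᶜ : Set X))
    (hPs : TopologicalSpace.SeparableSpace (Kᶜ : Set X)) :
    ∃ f : X → EuclideanSpace ℝ (Fin (2 * n + 1 + 1)), IsEmbedding f ∧
      range f ⊆ polyhedralSphere (2 * n + 1) ∧ IsAffinePolyhedron (f '' Kᶜ) := by
  classical
  have hXs : TopologicalSpace.SeparableSpace X := by
    rw [← TopologicalSpace.isSeparable_univ_iff, ← union_compl_self K]
    exact hK.isSeparable.union (.of_subtype _)
  obtain ⟨g, hg, hgb⟩ := exists_isEmbedding_of_coveringDimLE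
    (E := EuclideanSpace ℝ (Fin (2 * n + 1))) hX finrank_euclideanSpace_fin
  let := TopologicalSpace.metrizableSpaceMetric X
  have : SecondCountableTopology X := UniformSpace.secondCountable_of_separable X
  set P : Set X := Kᶜ with hPK
  have hP : IsOpen P := hK.isClosed.isOpen_compl
  -- The extra point `z₀` keeps `B` nonempty even when `K` is empty, so that closeness relative to
  -- `B` also bounds `f`.
  obtain ⟨z₀, hz₀⟩ : ∃ z₀, z₀ ∉ closure (range g) := by
    by_contra! h
    exact NormedSpace.unbounded_univ ℝ (EuclideanSpace ℝ (Fin (2 * n + 1)))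
      (hgb.closure.subset fun z _ => h z)
  set B : Set (EuclideanSpace ℝ (Fin (2 * n + 1))) :=
    insert z₀ (g '' K ∪ (closure (g '' P) \ g '' P)) with hBdef
  have hgPl : LocallyCompactSpace (g '' P) :=
    (hg.homeomorphImage P).symm.isClosedEmbedding.locallyCompactSpace
  have hB : IsClosed B := by
    rw [hBdef, insert_eq]
    exact isClosed_singleton.union ((hK.image hg.continuous).isClosed.union
      (isClosed_closure_diff_of_locallyCompactSpace hgPl))
  have hgP : ∀ x, x ∈ P ↔ g x ∉ B := by
    intro x
    constructor
    · rintro hx (h | ⟨y, hy, hyx⟩ | h)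
      · exact hz₀ (h ▸ subset_closure (mem_range_self x))
      · exact hx (hg.injective hyx ▸ hy)
      · exact h.2 (mem_image_of_mem g hx)
    · exact fun h hxK => h (Or.inr (Or.inl (mem_image_of_mem g hxK)))
  have hcl : closure (range g) ⊆ B ∪ g '' P := by
    rw [← image_univ, ← union_compl_self K, image_union, closure_union,
      (hK.image hg.continuous).isClosed.closure_eq]
    rintro z (hz | hz)
    · exact Or.inl (Or.inr (Or.inl hz))
    · by_cases hzP : z ∈ g '' P
      · exact Or.inr hzP
      · exact Or.inl (Or.inr (Or.inr ⟨hz, hzP⟩))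
  obtain ⟨V, D, θ, w, hD, hw⟩ := hPp.exists_small_triangulation
    (g := fun x : P => g x) (hg.continuous.comp continuous_subtype_val) hB
    fun x => (hgP x).1 x.2
  have := θ.secondCountableTopology
  have hcard : ∀ s ∈ D.faces, s.card ≤ n + 1 := fun s hs =>
    hX.card_face_le (IsEmbedding.subtypeVal.comp θ.isEmbedding) hs
  let T : Set V := ⋃ s ∈ D.faces, (s : Set V)
  have hT : T.Countable := (countable_faces hD).biUnion fun s _ => s.countable_toSet
  have hsuppT : ∀ (x : simplicialRealization D) v, x.1 v ≠ 0 → v ∈ T := by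
    intro x v hv
    obtain ⟨s, hs, h1, -⟩ := exists_support_face x
    exact mem_iUnion₂.2 ⟨s, hs, (h1 v).2 hv⟩
  -- With `d = dist (g (θ x)) z`, the vertex image is within `d / 4` of `g (θ x)`, so it is within
  -- `5d/4` of `z` and `δ ≤ d / 4`. The moved vertex is therefore within `d / 2`, as needed in
  -- `hclose`.
  have hδ : ∀ v ∈ T, ∃ δ > 0, ∀ z ∈ B, 5 * δ ≤ dist (w v) z := by
    intro v hv
    obtain ⟨s, hs, hvs⟩ := mem_iUnion₂.1 hv
    have hv1 : {v} ∈ D.faces := (D.isRelLowerSet_faces hs).2 (by simpa using hvs) (by simp)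
    let x : simplicialRealization D := pointOfFace hv1 (c := fun _ => 1) (by simp) (by simp)
    have hxv : x.1 v ≠ 0 := by simp [x, pointOfFace_apply]
    have hwB : w v ∉ B := by
      intro hwB
      have h1 := (hw x v hxv _ hwB).1
      rw [dist_self] at h1
      have h2 : w v = g (θ x) := dist_le_zero.1 (by linarith)
      exact (hgP _).1 (θ x).2 (h2 ▸ hwB)
    obtain ⟨η, hη, hball⟩ := Metric.mem_nhds_iff.1 (hB.isOpen_compl.mem_nhds hwB)
    refine ⟨η / 5, by positivity, fun z hz => ?_⟩
    by_contra hlt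
    rw [not_le, dist_comm] at hlt
    exact hball (show dist z (w v) < η by linarith) hz
  choose! δ hδ0 hδB using hδ
  obtain ⟨q, hq1, hq2⟩ := exists_general_position_of_subset hT w hδ0
  have hq : ∀ s ∈ D.faces, ∀ t ∈ D.faces, ∀ r : Finset V, (∀ v ∈ r, v ∈ s ∨ v ∈ t) →
      AffineIndependent ℝ fun v : r => q v := by
    intro s hs t ht r hr
    refine hq2 r (fun v hv => ?_) ?_
    · rcases hr v hv with h | h
      exacts [mem_iUnion₂.2 ⟨s, hs, h⟩, mem_iUnion₂.2 ⟨t, ht, h⟩]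
    · have h1 : r ⊆ s ∪ t := fun v hv => Finset.mem_union.2 (hr v hv)
      have h2 := (Finset.card_le_card h1).trans (Finset.card_union_le s t)
      have h3 := hcard s hs
      have h4 := hcard t ht
      rw [finrank_euclideanSpace_fin]
      lia
  have hclose : ∀ x, ∀ z ∈ B, 2 * dist (bary D q x) (g (θ x)) ≤ dist (g (θ x)) z := by
    intro x z hz
    obtain ⟨s, -, hs, -⟩ := exists_support_face x
    have h1 : bary D q x ∈ Metric.closedBall (g (θ x)) (dist (g (θ x)) z / 2) := by
      refine convexHull_min ?_ (convex_closedBall _ _)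
        (bary_mem_convexHull q x (s := s) fun v => (hs v).2)
      rintro _ ⟨v, hv, rfl⟩
      have hv := (hs v).1 hv
      have hvT := hsuppT x v hv
      have h1 := (hw x v hv z hz).2
      have h2 := hq1 v hvT
      have h3 := hδB v hvT z hz
      have h4 := dist_triangle (w v) (g (θ x)) z
      have h5 := dist_triangle (q v) (w v) (g (θ x))
      rw [Metric.mem_closedBall]
      linarith
    rw [Metric.mem_closedBall] at h1
    linarith
  let f : X → EuclideanSpace ℝ (Fin (2 * n + 1)) := fun x =>
    if h : x ∈ P then bary D q (θ.symm ⟨x, h⟩) else g x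
  have hfP : ∀ x : P, f x = bary D q (θ.symm x) := fun x => dif_pos x.2
  have hfg : ∀ x, ∀ z ∈ B, 2 * dist (f x) (g x) ≤ dist (g x) z := by
    intro x z hz
    by_cases hx : x ∈ P
    · have := hclose (θ.symm ⟨x, hx⟩) z hz
      rw [θ.apply_symm_apply] at this
      rwa [hfP ⟨x, hx⟩]
    · simp only [f, dif_neg hx, dist_self, mul_zero]
      exact dist_nonneg
  have hf : IsEmbedding f := by
    refine isEmbedding_of_dist_le hg hgb hP hB hgP hcl ?_ ?_ hfg
    · rw [continuousOn_iff_continuous_domRestrict]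
      exact ((continuous_bary hD q).comp θ.symm.continuous).congr fun x => (hfP x).symm
    · intro x hx y hy hxy
      rw [hfP ⟨x, hx⟩, hfP ⟨y, hy⟩] at hxy
      exact congrArg Subtype.val (θ.symm.injective (injective_bary hq hxy))
  obtain ⟨R, hR0, hR⟩ : ∃ R > 0, ∀ x, ‖f x‖ ≤ R := by
    obtain ⟨R, hR⟩ := hgb.subset_closedBall z₀
    refine ⟨3 * |R| + ‖z₀‖ + 1, by positivity, fun x => ?_⟩
    have h1 : dist (g x) z₀ ≤ R := hR (mem_range_self x)
    have h2 := hfg x z₀ (Or.inl rfl)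
    have h3 := dist_triangle (f x) (g x) z₀
    have h4 := norm_le_norm_add_norm_sub' (f x) z₀
    rw [← dist_eq_norm] at h4
    have h5 := le_abs_self R
    have h6 := abs_nonneg R
    linarith
  -- Scaling by `R⁻¹` puts the bounded image into the face of the cube on which the last coordinate
  -- is `1`.
  let A := faceEmbedding (2 * n + 1) R⁻¹
  have hA : IsEmbedding A := isEmbedding_faceEmbedding (inv_ne_zero hR0.ne')
  have hbary : ∀ x, bary D (A ∘ q) x = A (f (θ x)) := fun x => by
    rw [bary_affineMap, hfP, θ.symm_apply_apply]
  refine ⟨A ∘ f, hA.comp hf, ?_, ?_⟩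
  · rintro _ ⟨x, rfl⟩
    refine ⟨fun i => ?_, Fin.last _, by
      rw [Function.comp_apply, faceEmbedding_last, abs_one]⟩
    refine Fin.lastCases ?_ (fun i => ?_) i
    · rw [Function.comp_apply, faceEmbedding_last, abs_one]
    · rw [Function.comp_apply, faceEmbedding_castSucc, abs_mul, abs_of_pos (inv_pos.2 hR0)]
      have h1 : |f x i| ≤ ‖f x‖ := PiLp.norm_apply_le (f x) i
      rw [inv_mul_le_iff₀ hR0, mul_one]
      exact h1.trans (hR x)
  · have hrange : (A ∘ f) '' P = range (bary D (A ∘ q)) := by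
      ext z
      constructor
      · rintro ⟨x, hx, rfl⟩
        exact ⟨θ.symm ⟨x, hx⟩, by rw [hbary, θ.apply_symm_apply]; rfl⟩
      · rintro ⟨x, rfl⟩
        exact ⟨θ x, (θ x).2, (hbary x).symm⟩
    rw [hrange]
    refine isAffinePolyhedron_range hD (fun s hs t ht r hr =>
      (hq s hs t ht r hr).map' A hA.injective) ?_
    have : bary D (A ∘ q) = A ∘ f ∘ Subtype.val ∘ θ := funext hbary
    rw [this]
    exact hA.comp (hf.comp (IsEmbedding.subtypeVal.comp θ.isEmbedding))

end Embedding

theorem mainTheorem12 :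
    -- (a)
    (∀ (Q : Type u) [TopologicalSpace Q] [CompactSpace Q] (X K P : Set Q),
      IsANR Q → X = K ∪ P → IsCompact K → IsOpen P →
        IsANR P ∧ LocallyCompactSpace (Xᶜ : Set Q)) ∧
    -- (b)
    (∀ (m : ℕ) (Q X K P : Set (EuclideanSpace ℝ (Fin m))),
      IsCompact Q → IsAffinePolyhedron Q → X ⊆ Q → X = K ∪ P → P = X \ K → IsCompact K →
      IsAffinePolyhedron P → LocallyCompactSpace P →
        ∃ Y : Set (EuclideanSpace ℝ (Fin m)), Y ⊆ Q ∧ IsCoronatedPolyhedron Y ∧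
          DeformationRetractsOnto Y X ∧
          LocallyCompactSpace (Q \ Y : Set (EuclideanSpace ℝ (Fin m)))) ∧
    -- (c)
    (∀ (n : ℕ) (X : Type v) [TopologicalSpace X] [TopologicalSpace.MetrizableSpace X]
      (K P : Set X),
      CoveringDimLE X n → P = Kᶜ → IsCompact K →
      IsPolyhedron P → LocallyCompactSpace P → TopologicalSpace.SeparableSpace P →
        ∃ f : X → EuclideanSpace ℝ (Fin (2 * n + 1 + 1)), IsEmbedding f ∧
          range f ⊆ polyhedralSphere (2 * n + 1) ∧ IsAffinePolyhedron (f '' P)) := by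
  refine ⟨fun Q _ _ X K P hQ hX hK hP => ?_, fun m Q X K P hQ hQa hXQ hX hP hK hPa hPl => ?_,
    fun n X _ _ K P hX hP hK hPp hPl hPs => ?_⟩
  · subst hX
    have := hQ.1
    exact ⟨hQ.of_isOpen hP, locallyCompactSpace_compl_union hK hP⟩
  · have hKP : Disjoint K P := hP ▸ disjoint_sdiff_right
    subst hX
    exact exists_coronated_deformation_neighborhood hQ hQa (subset_union_left.trans hXQ)
      (subset_union_right.trans hXQ) hKP hK hPa hPl
  · subst hP
    exact exists_isEmbedding_polyhedralSphere hX hK hPp hPl hPs
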